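/- Let $G$ be a finite abelian group with a faithful representation on $\mathbb{C}^n$, let $R=\mathbb{C}[x_1,\dots,x_n]$ and $X=\mathbb{C}^n/G=\operatorname{Spec}R^G$, and let $\pi:Y\to X$ be a resolution ($Y$ integral and smooth over $\mathbb{C}$, $\pi$ proper and birational), so that $K(Y)=K(\mathbb{C}^n)^G\subseteq K(\mathbb{C}^n)$. Let $G$ act on functions by $(g.f)(v)=f(g^{-1}v)$, and for $\chi\in G^\vee$ call $f\in K(\mathbb{C}^n)$ homogeneous of weight $\chi$ if $g.f=\chi(g^{-1})f$ for all $g\in G$; $\chi_0$ denotes the trivial character. For a prime Weil divisor $P$ on $Y$ and a non-zero homogeneous $f$ put $v_P(f)=\frac1{|G|}v_P(f^{|G|})\in\mathbb{Q}$. A *$\chi$-Weil divisor* is a finite sum $D=\sum q_PP$ over prime divisors of $Y$, $q_P\in\mathbb{Q}$, such that $q_P-v_P(f)\in\mathbb{Z}$ for every $P$ and every non-zero $f$ of weight $\chi$; $\mathcal{L}(-D)$ is the sub-$\mathcal{O}_Y$-module of the constant sheaf $K(\mathbb{C}^n)$ generated by the local equations of $D$, that is, by the non-zero $f$ of weight $\chi$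 with $v_P(f)=q_P$ for all $P$ meeting the given open set. A *family of $G$-constellations* on $Y$ is a locally free $\mathcal{O}_Y$-module $\mathcal{F}$ on which $G$ and the $\mathbb{C}$-algebra $R$ act $\mathcal{O}_Y$-linearly with $g.(f.s)=(g.f).(g.s)$, and whose fibre at each point is the regular representation of $G$ (over the residue field of that point). A *deformation of the generic orbit* is such a family together with a $K(Y)$-linear, $G$- and $R$-equivariant isomorphism of its fibre at the generic point with $K(\mathbb{C}^n)$; this embeds $\mathcal{F}$ into the constant sheaf $K(\mathbb{C}^n)$, and we write $\mathcal{F}=\bigoplus_{\chi\in G^\vee}\mathcal{L}(-D_\chi)$, with $D_\chi$ a $\chi$-Weil divisor for each $\chi$, if the image is this subsheaf. Two families $\mathcal{F},\mathcal{F}'$ are *equivalent* if $\mathcal{F}$ is $G$- and $R$-equivariantly isomorphic to $\mathcal{F}'\otimes\mathcal{N}$ for some invertible sheaf $\mathcal{N}$ on $Y$. Let $\mathcal{F}=\bigoplus_\chi\mathcal{L}(-D_\chi)$ and $\mathcal{F}'=\bigoplus_\chi\mathcal{L}(-D'_\chi)$ be deformations of the generic orbit across $Y$. Then: 1. $\mathcal{F}$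 and $\mathcal{F}'$ are isomorphic as sheaves of modules with $G$- and $R$-action if and only if there is a single $g\in K(Y)^*$ with $D'_\chi-D_\chi=(g)$ for all $\chi\in G^\vee$. 2. $\mathcal{F}$ and $\mathcal{F}'$ are equivalent if and only if there is a single $\chi_0$-Weil divisor $N$ with $D'_\chi-D_\chi=N$ for all $\chi\in G^\vee$. 3. Every equivalence class of deformations of the generic orbit across $Y$ contains a family of the form $\bigoplus_\chi\mathcal{L}(-D_\chi)$ with $D_{\chi_0}=0$, and it is unique: the divisors $D_\chi$ are uniquely determined, and the family is unique up to isomorphism compatible with the identification of the generic fibre with $K(\mathbb{C}^n)$. -/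

import Mathlib

open CategoryTheory AlgebraicGeometry TopologicalSpace MonoidalCategory
open scoped TensorProduct

noncomputable section

namespace GOrbit

/-! ### The polynomial ring, its fraction field and the action of `G` -/

/-- The coordinate ring `R = ℂ[x₁, …, xₙ]` of `ℂⁿ`. -/
abbrev PolyRing (n : ℕ) : Type := MvPolynomial (Fin n) ℂ

/-- The field `K(ℂⁿ)` of rational functions on `ℂⁿ`. -/
abbrev RatField (n : ℕ) : Type := FractionRing (PolyRing n)

section Action

variable {n : ℕ} {G : Type*} [CommGroup G]

/-- The action of `G` on polynomials, `(g.f)(v) = f (g⁻¹ v)`. -/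
def polyAct (ρ : G →* GL (Fin n) ℂ) : G →* (PolyRing n →ₐ[ℂ] PolyRing n) where
  toFun g := MvPolynomial.aeval fun i =>
    ∑ j, MvPolynomial.C ((ρ g⁻¹ : GL (Fin n) ℂ).1 i j) * MvPolynomial.X j
  map_one' := by
    ext i
    simp [Matrix.one_apply]
  map_mul' g h := by
    apply MvPolynomial.algHom_ext
    intro i
    have hgh : (ρ (g * h)⁻¹ : GL (Fin n) ℂ).1 = (ρ h⁻¹).1 * (ρ g⁻¹).1 := by
      rw [mul_inv_rev, map_mul]; rfl
    simp only [MvPolynomial.aeval_X, AlgHom.mul_apply, map_sum, map_mul, hgh,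
      Matrix.mul_apply, MvPolynomial.algHom_C, MvPolynomial.algebraMap_eq,
      Finset.mul_sum, Finset.sum_mul]
    rw [Finset.sum_comm]
    simp only [mul_assoc]

/-- The same action, by ring automorphisms. -/
def polyAut (ρ : G →* GL (Fin n) ℂ) (g : G) : PolyRing n ≃+* PolyRing n :=
  RingEquiv.ofRingHom (polyAct ρ g : PolyRing n →+* PolyRing n)
    (polyAct ρ g⁻¹ : PolyRing n →+* PolyRing n)
    (by
      refine RingHom.ext fun x => ?_
      have : (polyAct ρ g * polyAct ρ g⁻¹) x = x := by rw [← map_mul]; simp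
      simpa using this)
    (by
      refine RingHom.ext fun x => ?_
      have : (polyAct ρ g⁻¹ * polyAct ρ g) x = x := by rw [← map_mul]; simp
      simpa using this)

/-- The induced action of `G` on rational functions. -/
def ratAct (ρ : G →* GL (Fin n) ℂ) (g : G) : RatField n ≃+* RatField n :=
  IsFractionRing.ringEquivOfRingEquiv (polyAut ρ g)

/-- The ring `R^G` of invariant polynomials. -/
def invariants (ρ : G →* GL (Fin n) ℂ) : Subalgebra ℂ (PolyRing n) where
  carrier := {f | ∀ g, polyAct ρ g f = f}
  mul_mem' ha hb g := by rw [map_mul, ha g, hb g]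
  add_mem' ha hb g := by rw [map_add, ha g, hb g]
  algebraMap_mem' c g := by simp

/-- A rational function `f` is `G`-homogeneous of weight `χ` if `g.f = χ(g⁻¹) f`. -/
def IsHomog (ρ : G →* GL (Fin n) ℂ) (χ : G →* ℂˣ) (f : RatField n) : Prop :=
  ∀ g : G, ratAct ρ g f = algebraMap (PolyRing n) (RatField n) (MvPolynomial.C (χ g⁻¹ : ℂ)) * f

/-- The quotient `X = ℂⁿ / G = Spec R^G`. -/
abbrev quotientScheme (ρ : G →* GL (Fin n) ℂ) : Scheme.{0} := Spec (.of (invariants ρ))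

/-- The structure morphism of `X` over `ℂ`. -/
def quotientOver (ρ : G →* GL (Fin n) ℂ) : quotientScheme ρ ⟶ Spec (.of ℂ) :=
  Spec.map (CommRingCat.ofHom (algebraMap ℂ (invariants ρ)))

/-- A resolution `π : Y ⟶ X` of the quotient: `Y` is an integral scheme, smooth over `ℂ`, and `π`
is proper and birational. -/
structure Resolution (ρ : G →* GL (Fin n) ℂ) where
  Y : Scheme.{0}
  π : Y ⟶ quotientScheme ρ
  isIntegral : IsIntegral Y
  isProper : IsProper π
  smooth : Smooth (π ≫ quotientOver ρ)
  birational : Scheme.BirationalOver π (𝟙 (quotientScheme ρ))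

end Action

/-! ### The function field of `Y` as a subfield of `K(ℂⁿ)` -/

namespace Resolution

variable {n : ℕ} {G : Type*} [CommGroup G] {ρ : G →* GL (Fin n) ℂ} (S : Resolution ρ)

instance : IsIntegral S.Y := S.isIntegral

instance : IsLocallyNoetherian S.Y :=
  have := S.smooth
  have : IsLocallyNoetherian (Spec (.of ℂ)) := inferInstance
  LocallyOfFiniteType.isLocallyNoetherian (S.π ≫ quotientOver ρ)

/-- The pullback `π^* : R^G → Γ(Y, 𝒪_Y)`. -/
def pullback : invariants ρ →+* Γ(S.Y, ⊤) :=
  (((Scheme.ΓSpecIso (.of (invariants ρ))).inv ≫ S.π.appTop).hom :)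

/-- The pullback `R^G → K(Y)`. -/
def pullbackField : invariants ρ →+* S.Y.functionField :=
  (S.Y.presheaf.germ ⊤ (genericPoint S.Y) trivial).hom.comp S.pullback

lemma isOpenImmersion_of_partialIso (f : S.Y.PartialIso (quotientScheme ρ))
    (hf : f.IsOver S.π (𝟙 _)) : IsOpenImmersion (f.source.ι ≫ S.π) := by
  have hf' : f.iso.hom ≫ f.target.ι ≫ 𝟙 _ = f.source.ι ≫ S.π := hf
  rw [← hf', Category.comp_id]
  infer_instance

lemma isIso_stalkMap_genericPoint : IsIso (S.π.stalkMap (genericPoint S.Y)) := by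
  obtain ⟨f, hf⟩ := S.birational
  have := S.isOpenImmersion_of_partialIso f hf
  have hη : genericPoint S.Y ∈ f.source :=
    ((genericPoint_spec S.Y).mem_open_set_iff f.source.isOpen).mpr
      (by simpa using f.dense_source.nonempty)
  let x : f.source.toScheme := ⟨genericPoint S.Y, hη⟩
  have h1 : IsIso ((f.source.ι ≫ S.π).stalkMap x) := inferInstance
  rw [Scheme.Hom.stalkMap_comp] at h1
  exact @IsIso.of_isIso_comp_right _ _ _ _ _ (S.π.stalkMap (f.source.ι x))
    (f.source.ι.stalkMap x) _ h1

lemma π_genericPoint :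
    S.π (genericPoint S.Y) = (⊥ : PrimeSpectrum (invariants ρ)) := by
  obtain ⟨f, hf⟩ := S.birational
  have := S.isOpenImmersion_of_partialIso f hf
  have : Nonempty f.source := by simpa using f.dense_source.nonempty
  have h1 := genericPoint_eq_of_isOpenImmersion f.source.ι
  have h2 := genericPoint_eq_of_isOpenImmersion (f.source.ι ≫ S.π)
  rw [Scheme.Hom.comp_apply, h1] at h2
  rw [h2]
  exact genericPoint_eq_bot_of_affine (.of (invariants ρ))

instance : Algebra (invariants ρ) S.Y.functionField := S.pullbackField.toAlgebra

/-- `K(Y)` is the fraction field of `R^G`. -/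
instance : IsFractionRing (invariants ρ) S.Y.functionField := by
  have := S.isIso_stalkMap_genericPoint
  let x : PrimeSpectrum (invariants ρ) := S.π (genericPoint S.Y)
  have hx : x = ⊥ := S.π_genericPoint
  let A : Type := (Spec (.of (invariants ρ))).presheaf.stalk x
  let _ : CommRing A := inferInstanceAs (CommRing ((Spec (.of (invariants ρ))).presheaf.stalk x))
  let _ : Algebra (invariants ρ) A := StructureSheaf.stalkAlgebra (invariants ρ) x
  have h1 : IsLocalization.AtPrime A x.asIdeal :=
    StructureSheaf.IsLocalization.to_stalk (invariants ρ) x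
  have h2 : x.asIdeal.primeCompl = nonZeroDivisors (invariants ρ) := by
    rw [hx]; ext y; exact mem_nonZeroDivisors_iff_ne_zero.symm
  have h3 : IsLocalization (nonZeroDivisors (invariants ρ)) A := by
    rw [← h2]; exact h1
  let e : A ≃+* S.Y.functionField :=
    (asIso (S.π.stalkMap (genericPoint S.Y))).commRingCatIsoToRingEquiv
  refine IsLocalization.isLocalization_of_algEquiv _
    (AlgEquiv.ofRingEquiv (f := e) (R := invariants ρ) fun r => ?_)
  change S.π.stalkMap (genericPoint S.Y) (StructureSheaf.toStalk (invariants ρ) x r) =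
    S.pullbackField r
  have h4 : StructureSheaf.toStalk (invariants ρ) x r =
     (quotientScheme ρ).presheaf.germ ⊤ x trivial
      ((Scheme.ΓSpecIso (.of (invariants ρ))).inv r) := rfl
  rw [h4]
  exact Scheme.Hom.germ_stalkMap_apply S.π ⊤ (genericPoint S.Y) trivial _

/-- The constant function `c ∈ ℂ ⊆ R^G`, as a section of `𝒪_Y` over `U`. -/
def const (c : ℂ) (U : S.Y.Opens) : Γ(S.Y, U) :=
  S.Y.presheaf.map (homOfLE (le_top : U ≤ ⊤)).op (S.pullback (algebraMap ℂ (invariants ρ) c))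

/-- The embedding `K(Y) = K(X) = K(ℂⁿ)^G ⊆ K(ℂⁿ)`, determined by `π^* f ↦ f` for `f ∈ R^G`. -/
def fieldEmb : S.Y.functionField →+* RatField n :=
  IsFractionRing.lift (A := invariants ρ) (K := S.Y.functionField)
    (g := (algebraMap (PolyRing n) (RatField n)).comp (invariants ρ).val.toRingHom)
    ((IsFractionRing.injective (PolyRing n) (RatField n)).comp Subtype.val_injective)

/-- The stalk of `𝒪_Y` at `y`, inside `K(ℂⁿ)`. -/
def stalkEmb (y : S.Y) : S.Y.presheaf.stalk y →+* RatField n :=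
  S.fieldEmb.comp (algebraMap (S.Y.presheaf.stalk y) S.Y.functionField)

end Resolution

/-! ### Sheaves of modules: stalks, fibres, tensor products -/

section Modules

variable {Y : Scheme.{0}} {M N : Y.Modules}

instance (M : Y.Modules) (y : Y) : Module (Y.presheaf.stalk y) (M.presheaf.stalk y) :=
  PresheafOfModules.instModuleCarrierStalkCommRingCatCarrierAbPresheafOpensCarrier
    (R := Y.presheaf) M.val y

lemma germ_smul (M : Y.Modules) (y : Y) (U : Y.Opens) (hy : y ∈ U) (r : Γ(Y, U)) (m : Γ(M, U)) :
    M.presheaf.germ U y hy (r • m) = Y.presheaf.germ U y hy r • M.presheaf.germ U y hy m :=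
  PresheafOfModules.germ_smul (R := Y.presheaf) M.val y U hy r m

/-- The additive map on stalks induced by a morphism of sheaves of modules. -/
def stalkAddHom (φ : M ⟶ N) (y : Y) : M.presheaf.stalk y →+ N.presheaf.stalk y :=
  ((TopCat.Presheaf.stalkFunctor Ab y).map φ.mapPresheaf).hom

lemma stalkAddHom_germ (φ : M ⟶ N) (y : Y) (U : Y.Opens) (hy : y ∈ U) (m : Γ(M, U)) :
    stalkAddHom φ y (M.presheaf.germ U y hy m) = N.presheaf.germ U y hy (φ.app U m) :=
  TopCat.Presheaf.stalkFunctor_map_germ_apply U y hy φ.mapPresheaf m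

/-- The linear map on stalks induced by a morphism of sheaves of modules. -/
def stalkLinearMap (φ : M ⟶ N) (y : Y) :
    M.presheaf.stalk y →ₗ[Y.presheaf.stalk y] N.presheaf.stalk y where
  __ := stalkAddHom φ y
  map_smul' r m := by
    obtain ⟨U, hU, a, rfl⟩ := Y.presheaf.exists_germ_eq r
    obtain ⟨V, hV, b, rfl⟩ := M.presheaf.exists_germ_eq m
    have hW : y ∈ U ⊓ V := ⟨hU, hV⟩
    change stalkAddHom φ y _ = _ • stalkAddHom φ y _
    rw [← Y.presheaf.germ_res_apply (homOfLE inf_le_left : U ⊓ V ⟶ U) y hW a,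
      ← M.presheaf.germ_res_apply (homOfLE inf_le_right : U ⊓ V ⟶ V) y hW b]
    erw [← germ_smul, stalkAddHom_germ, stalkAddHom_germ, ← germ_smul]
    congr 1
    exact φ.app_smul _ _

/-- The tensor product of sheaves of `𝒪_Y`-modules: the sheaf associated with the presheaf
`U ↦ M(U) ⊗ N(U)`. -/
def tensorSheaf (M N : Y.Modules) : Y.Modules :=
  (PresheafOfModules.sheafification (𝟙 Y.ringCatSheaf.obj)).obj
    (MonoidalCategory.tensorObj (C := PresheafOfModules.{0} (Y.presheaf ⋙ forget₂ _ _))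
      M.val N.val)

/-- The morphism `φ ⊗ id : M ⊗ L ⟶ N ⊗ L`. -/
def tensorSheafMap (φ : M ⟶ N) (L : Y.Modules) : tensorSheaf M L ⟶ tensorSheaf N L :=
  (PresheafOfModules.sheafification (𝟙 Y.ringCatSheaf.obj)).map
    (MonoidalCategory.whiskerRight (C := PresheafOfModules.{0} (Y.presheaf ⋙ forget₂ _ _))
      φ.val L.val)

/-- `M` is free of rank `m` on the open set `U`: there is a family of `m` sections over `U` whose
restrictions form a basis of `M(V)` over `𝒪_Y(V)` for every open `V ⊆ U`, i.e. which define an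
isomorphism `𝒪_U^m ≅ M|_U`. -/
def IsFreeOn (M : Y.Modules) (U : Y.Opens) (m : ℕ) : Prop :=
  ∃ e : Fin m → Γ(M, U), ∀ (V : Y.Opens) (h : V ≤ U),
    LinearIndependent Γ(Y, V) (fun i => M.presheaf.map (homOfLE h).op (e i)) ∧
    Submodule.span Γ(Y, V) (Set.range fun i => M.presheaf.map (homOfLE h).op (e i)) = ⊤

/-- `M` is locally free (of finite rank). -/
def IsLocallyFree (M : Y.Modules) : Prop := ∀ y : Y, ∃ U : Y.Opens, y ∈ U ∧ ∃ m, IsFreeOn M U m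

/-- `M` is invertible, i.e. locally free of rank one. -/
def IsInvertible (M : Y.Modules) : Prop := ∀ y : Y, ∃ U : Y.Opens, y ∈ U ∧ IsFreeOn M U 1

/-- The residue field `k(y)`. -/
abbrev ResField (Y : Scheme.{0}) (y : Y) : Type := IsLocalRing.ResidueField (Y.presheaf.stalk y)

/-- The fibre `M_y ⊗ k(y)` of `M` at `y`. -/
abbrev Fibre (M : Y.Modules) (y : Y) : Type :=
  ResField Y y ⊗[Y.presheaf.stalk y] M.presheaf.stalk y

/-- The map on fibres induced by a morphism of sheaves of modules. -/
def fibreMap (φ : M ⟶ N) (y : Y) : Fibre M y →ₗ[ResField Y y] Fibre N y :=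
  (stalkLinearMap φ y).baseChange (ResField Y y)

end Modules

/-! ### Families of `G`-constellations and deformations of the generic orbit -/

variable {n : ℕ} {G : Type*} [CommGroup G] {ρ : G →* GL (Fin n) ℂ}

/-- A family of `(G, R)`-modules parametrised by `Y`: a locally free sheaf of `𝒪_Y`-modules on which
`G` and the `ℂ`-algebra `R` act by `𝒪_Y`-linear endomorphisms with `g.(f.s) = (g.f).(g.s)`. -/
structure GRFamily (S : Resolution ρ) where
  sheaf : S.Y.Modules
  locallyFree : IsLocallyFree sheaf
  actG : G →* End sheaf
  actR : PolyRing n →+* End sheaf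
  actR_const : ∀ (c : ℂ) (U : S.Y.Opens) (s : Γ(sheaf, U)),
    Scheme.Modules.Hom.app (actR (MvPolynomial.C c)) U s = S.const c U • s
  equivariant : ∀ (g : G) (f : PolyRing n), actG g * actR f = actR (polyAct ρ g f) * actG g

namespace GRFamily

variable {S : Resolution ρ}

/-- The family is a family of `G`-constellations: each fibre is, as a representation of `G` over
the residue field, the regular representation. -/
def IsConstellation (F : GRFamily S) : Prop :=
  ∀ y : S.Y, ∃ b : Module.Basis G (ResField S.Y y) (Fibre F.sheaf y),
    ∀ g h : G, fibreMap (F.actG g) y (b h) = b (g * h)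

/-- `e` is `G`- and `R`-equivariant. -/
def IsEquivariant (F F' : GRFamily S) (e : F.sheaf ⟶ F'.sheaf) : Prop :=
  (∀ g : G, F.actG g ≫ e = e ≫ F'.actG g) ∧
  (∀ f : PolyRing n, F.actR f ≫ e = e ≫ F'.actR f)

/-- Isomorphism of sheaves of `(G, R)`-modules. -/
def Isomorphic (F F' : GRFamily S) : Prop :=
  ∃ e : F.sheaf ≅ F'.sheaf, IsEquivariant F F' e.hom

/-- Equivalence of families: `F` is `(G, R)`-equivariantly isomorphic to `F' ⊗ L` for an invertible
sheaf `L` on `Y`. -/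
def Equivalent (F F' : GRFamily S) : Prop :=
  ∃ L : S.Y.Modules, IsInvertible L ∧ ∃ e : F.sheaf ≅ tensorSheaf F'.sheaf L,
    (∀ g : G, F.actG g ≫ e.hom = e.hom ≫ tensorSheafMap (F'.actG g) L) ∧
    (∀ f : PolyRing n, F.actR f ≫ e.hom = e.hom ≫ tensorSheafMap (F'.actR f) L)

end GRFamily

/-- A deformation of the generic orbit of `G` across `Y`: a family of `G`-constellations together
with a `(G, R)`-equivariant isomorphism, linear over `K(Y)`, of its fibre at the generic point with
`K(ℂⁿ)`. -/
structure Deformation (S : Resolution ρ) extends GRFamily S where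
  isConstellation : toGRFamily.IsConstellation
  ι : sheaf.presheaf.stalk (genericPoint S.Y) ≃+ RatField n
  ι_smul : ∀ (a : S.Y.functionField) (m : sheaf.presheaf.stalk (genericPoint S.Y)),
    ι (a • m) = S.fieldEmb a * ι m
  ι_actG : ∀ (g : G) (m : sheaf.presheaf.stalk (genericPoint S.Y)),
    ι (stalkAddHom (actG g) _ m) = ratAct ρ g (ι m)
  ι_actR : ∀ (f : PolyRing n) (m : sheaf.presheaf.stalk (genericPoint S.Y)),
    ι (stalkAddHom (actR f) _ m) = algebraMap (PolyRing n) (RatField n) f * ι m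

/-- The embedding `ι' : F → K(ℂⁿ)` into the constant sheaf, on sections over a non-empty open `U`
(that is, an open set containing the generic point). -/
def Deformation.embed {S : Resolution ρ} (F : Deformation S) (U : S.Y.Opens)
    (hU : genericPoint S.Y ∈ U) (s : Γ(F.sheaf, U)) : RatField n :=
  F.ι (F.sheaf.presheaf.germ U (genericPoint S.Y) hU s)

/-- Isomorphism as deformations of the generic orbit: an isomorphism of sheaves of `(G, R)`-modules
compatible with the identifications of the generic fibres with `K(ℂⁿ)`. -/
def Deformation.IsomorphicAsDeformation {S : Resolution ρ} (F F' : Deformation S) : Prop :=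
  ∃ e : F.sheaf ≅ F'.sheaf, GRFamily.IsEquivariant F.toGRFamily F'.toGRFamily e.hom ∧
    ∀ m, F'.ι (stalkAddHom e.hom _ m) = F.ι m

/-! ### `G`-Weil divisors -/

namespace Resolution

variable (S : Resolution ρ)

/-- Prime Weil divisors on `Y`, represented by their generic points. -/
abbrev PrimeDivisor : Type := {y : S.Y // Order.coheight y = 1}

/-- Finite sums of prime Weil divisors with rational coefficients. -/
abbrev QDivisor : Type := S.PrimeDivisor →₀ ℚ

/-- The valuation `v_P(f) = v_P(f^m) / m ∈ ℚ`, `m = |G|`, of a non-zero `G`-homogeneous rational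
function `f`; here `f^m` is invariant, so it lies in `K(Y)`. -/
def val (P : S.PrimeDivisor) (f : RatField n) : ℚ :=
  (Scheme.ord (Function.invFun S.fieldEmb (f ^ Nat.card G)) P.1 : ℚ) / Nat.card G

/-- `D` is a `χ`-Weil divisor: at each prime divisor `P` its coefficient is congruent modulo `ℤ` to
the fractional part of `v_P(f)` for `f` any non-zero rational function of weight `χ`. -/
def IsWeil (χ : G →* ℂˣ) (D : S.QDivisor) : Prop :=
  ∀ (P : S.PrimeDivisor) (f : RatField n), f ≠ 0 → IsHomog ρ χ f →
    ∃ k : ℤ, D P - Int.fract (S.val P f) = k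

/-- `D` is the principal divisor `(g)` of `g ∈ K(Y)`. -/
def IsPrincipal (g : S.Y.functionField) (D : S.QDivisor) : Prop :=
  ∀ P : S.PrimeDivisor, D P = Scheme.ord g P.1

/-- `f` is a local equation of the `χ`-Weil divisor `D` at `y`: a non-zero rational function of
weight `χ` with `(f) = D` on a neighbourhood of `y`. -/
def IsLocalEquation (χ : G →* ℂˣ) (D : S.QDivisor) (y : S.Y) (f : RatField n) : Prop :=
  f ≠ 0 ∧ IsHomog ρ χ f ∧
    ∃ V : S.Y.Opens, y ∈ V ∧ ∀ P : S.PrimeDivisor, P.1 ∈ V → D P = S.val P f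

/-- The sections over a non-empty open set `U` of the sheaf `𝓛(-D)`, for a `χ`-Weil divisor `D`:
the sub-`𝒪_Y`-module of the constant sheaf `K(ℂⁿ)` generated by the local equations of `D`. -/
def negSections (χ : G →* ℂˣ) (D : S.QDivisor) (U : S.Y.Opens) : Set (RatField n) :=
  {s | ∀ y ∈ U, ∃ f, S.IsLocalEquation χ D y f ∧ ∃ a : S.Y.presheaf.stalk y, s = S.stalkEmb y a * f}

/-- Families `{D_χ}` consisting of one `χ`-Weil divisor `D_χ` for each character `χ` of `G`. -/
def IsDivisorSet (D : (G →* ℂˣ) → S.QDivisor) : Prop := ∀ χ, S.IsWeil χ (D χ)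

/-- The sections over a non-empty open set `U` of `⨁_χ 𝓛(-D_χ) ⊆ K(ℂⁿ)`. -/
def sumNegSections (D : (G →* ℂˣ) → S.QDivisor) (U : S.Y.Opens) : Set (RatField n) :=
  {s | ∃ t : (G →* ℂˣ) → RatField n, (∀ χ, t χ ∈ S.negSections χ (D χ) U) ∧ s = ∑ᶠ χ, t χ}

end Resolution

/-- The deformation `F` is `⨁_χ 𝓛(-D_χ)`, where each `D_χ` is a `χ`-Weil divisor: its image in the
constant sheaf `K(ℂⁿ)` is this subsheaf. -/
def Deformation.IsSum {S : Resolution ρ} (F : Deformation S) (D : (G →* ℂˣ) → S.QDivisor) : Prop :=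
  S.IsDivisorSet D ∧ ∀ (U : S.Y.Opens) (hU : genericPoint S.Y ∈ U),
    Set.range (F.embed U hU) = S.sumNegSections D U

end GOrbit

end

/-! Everything takes place inside `K(ℂⁿ)`. A locally free sheaf on an integral scheme has no
sections vanishing at the generic point, so a deformation `F` embeds into the constant sheaf and is
recovered from the images `F_y ⊆ K(ℂⁿ)` of its stalks (`GenericEmbedding.mem_range_emb`).
Isomorphisms, twists and divisors all become statements about these subgroups.

Each `F_y` is stable under `G` and under constants, so it is the sum of its weight parts. Since the
fibre is the regular representation, Nakayama's lemma makes `F_y` the span of one orbit `G·x`. Its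
weight `χ` part is therefore generated by the projection of `x`, and that element still generates on
a neighbourhood (`exists_isLocalGenerator`). Two generators differ by a unit, so their valuations
define `weilDivisor`. Conversely `Y` is smooth, hence normal, so a function in `K(Y)` of order zero
at every prime divisor near `y` is a unit at `y`. Thus the divisor determines the weight part, `F =
⨁ 𝓛(-D_χ)` holds with these `D_χ` and with no others (`isSum_weilDivisor`, `IsSum.eq_weilDivisor`),
and for `h ∈ K(Y)*` one has `D'_χ - D_χ = (h)` on `V` for all `χ` exactly when `F'_y = h F_y` for
all `y ∈ V` (`weilDivisor_sub_eq_ord_iff`).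

For the first assertion, an equivariant isomorphism gives a second embedding of `F`. `R`-linearity
forces it to be the first one times some `c`, since the generic fibre is a line over `Frac R`;
`G`-equivariance forces `c ∈ K(Y)` (`exists_emb_eq_fieldEmb_mul`). For the second, tensoring with an
invertible sheaf rescales stalks by locally defined factors in `K(Y)`, and conversely locally
proportional families differ by the invertible sheaf of those `x ∈ K(Y)` with `x F' ⊆ F`
(`IsLocallyProportional`). For the third, dividing `F` locally by a generator of its invariants
gives a normalized family; the trivial character fixes the twist `N`, whence uniqueness. -/

noncomputable section

namespace GOrbit

/-! ### Sections of sheaves of modules: restriction, gluing, morphisms -/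

section SheafBasics

variable {Y : Scheme.{0}} {M N L : Y.Modules}

/-- Restriction of sections of a sheaf of modules. -/
def res {U V : Y.Opens} (h : V ≤ U) : Γ(M, U) →+ Γ(M, V) :=
  (M.presheaf.map (homOfLE h).op).hom

/-- Restriction of regular functions. -/
def resO {U V : Y.Opens} (h : V ≤ U) : Γ(Y, U) →+* Γ(Y, V) :=
  (Y.presheaf.map (homOfLE h).op).hom

lemma res_res {U V W : Y.Opens} (h : V ≤ U) (h' : W ≤ V) (s : Γ(M, U)) :
    res h' (res h s) = res (h'.trans h) s := by
  change (M.presheaf.map (homOfLE h').op) ((M.presheaf.map (homOfLE h).op) s) = _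
  rw [← ConcreteCategory.comp_apply, ← Functor.map_comp]
  rfl

lemma res_self {U : Y.Opens} (h : U ≤ U) (s : Γ(M, U)) : res h s = s := by
  change (M.presheaf.map (𝟙 _)) s = s
  rw [CategoryTheory.Functor.map_id]; rfl

lemma res_smul {U V : Y.Opens} (h : V ≤ U) (r : Γ(Y, U)) (s : Γ(M, U)) :
    res h (r • s) = resO h r • res h s :=
  Scheme.Modules.map_smul M (homOfLE h) r s

lemma app_res (φ : M ⟶ N) {U V : Y.Opens} (h : V ≤ U) (s : Γ(M, U)) :
    φ.app V (res h s) = res h (φ.app U s) :=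
  ConcreteCategory.congr_hom (φ.mapPresheaf.naturality (homOfLE h).op) s

/-- The underlying sheaf of abelian groups. -/
abbrev abSheaf (M : Y.Modules) : TopCat.Sheaf Ab Y := ⟨M.presheaf, M.isSheaf⟩

lemma section_ext {U : Y.Opens} {s t : Γ(M, U)}
    (H : ∀ y ∈ U, ∃ (V : Y.Opens) (h : V ≤ U), y ∈ V ∧ res h s = res h t) : s = t := by
  choose V hV hy hs using H
  refine (abSheaf M).eq_of_locally_eq' (fun y : U => V y.1 y.2) U
    (fun y => homOfLE (hV y.1 y.2)) ?_ s t (fun y => hs y.1 y.2)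
  intro y hyU
  exact Opens.mem_iSup.mpr ⟨⟨y, hyU⟩, hy y hyU⟩

lemma section_glue {U : Y.Opens} (V : U → Y.Opens) (hV : ∀ y, V y ≤ U) (hy : ∀ y : U, y.1 ∈ V y)
    (s : ∀ y, Γ(M, V y))
    (H : ∀ y z, res (inf_le_left : V y ⊓ V z ≤ V y) (s y) = res inf_le_right (s z)) :
    ∃ t : Γ(M, U), ∀ y, res (hV y) t = s y := by
  obtain ⟨t, ht, -⟩ := (abSheaf M).existsUnique_gluing' V U (fun y => homOfLE (hV y))
    (fun y hyU => Opens.mem_iSup.mpr ⟨⟨y, hyU⟩, hy ⟨y, hyU⟩⟩) s (fun y z => H y z)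
  exact ⟨t, ht⟩

lemma section_subsingleton {U : Y.Opens} (hU : ∀ y, y ∉ U) : Subsingleton Γ(M, U) :=
  ⟨fun _ _ => section_ext fun y hy => (hU y hy).elim⟩

lemma sectionO_ext {U : Y.Opens} {s t : Γ(Y, U)}
    (H : ∀ y ∈ U, ∃ (V : Y.Opens) (h : V ≤ U), y ∈ V ∧ resO h s = resO h t) : s = t := by
  choose V hV hy hs using H
  refine Y.sheaf.eq_of_locally_eq' (fun y : U => V y.1 y.2) U
    (fun y => homOfLE (hV y.1 y.2)) ?_ s t (fun y => hs y.1 y.2)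
  intro y hyU
  exact Opens.mem_iSup.mpr ⟨⟨y, hyU⟩, hy y hyU⟩

lemma sectionO_glue {U : Y.Opens} (V : U → Y.Opens) (hV : ∀ y, V y ≤ U) (hy : ∀ y : U, y.1 ∈ V y)
    (s : ∀ y, Γ(Y, V y))
    (H : ∀ y z, resO (inf_le_left : V y ⊓ V z ≤ V y) (s y) = resO inf_le_right (s z)) :
    ∃ t : Γ(Y, U), ∀ y, resO (hV y) t = s y := by
  obtain ⟨t, ht, -⟩ := Y.sheaf.existsUnique_gluing' V U (fun y => homOfLE (hV y))
    (fun y hyU => Opens.mem_iSup.mpr ⟨⟨y, hyU⟩, hy ⟨y, hyU⟩⟩) s (fun y z => H y z)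
  exact ⟨t, ht⟩

/-- Morphisms of sheaves of modules from natural families of linear maps on sections. -/
def homMk (f : ∀ U : Y.Opens, Γ(M, U) →ₗ[Γ(Y, U)] Γ(N, U))
    (hf : ∀ {U V : Y.Opens} (h : V ≤ U) (s : Γ(M, U)), f V (res h s) = res h (f U s)) :
    M ⟶ N :=
  SheafOfModules.Hom.mk (PresheafOfModules.Hom.mk (fun U => ModuleCat.ofHom (f U.unop)) (by
    intro U V i
    ext s
    exact hf i.unop.le s))

lemma app_inv_hom (e : M ≅ N) (U : Y.Opens) (t : Γ(N, U)) :
    e.hom.app U (e.inv.app U t) = t := by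
  rw [← ConcreteCategory.comp_apply, ← Scheme.Modules.Hom.comp_app, e.inv_hom_id]; rfl

lemma app_hom_inv (e : M ≅ N) (U : Y.Opens) (t : Γ(M, U)) :
    e.inv.app U (e.hom.app U t) = t := by
  rw [← ConcreteCategory.comp_apply, ← Scheme.Modules.Hom.comp_app, e.hom_inv_id]; rfl

lemma mem_inf_opens {U V : Y.Opens} {y : Y} (h : y ∈ U) (h' : y ∈ V) : y ∈ U ⊓ V := ⟨h, h'⟩

lemma germ_eq_germ_res {U V : Y.Opens} {y : Y} (h : V ≤ U) (hy : y ∈ V) (s : Γ(M, U)) :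
    M.presheaf.germ V y hy (res h s) = M.presheaf.germ U y (h hy) s :=
  M.presheaf.germ_res_apply (homOfLE h) y hy s

end SheafBasics

/-! ### Tensor products, and tensoring with a sheaf that has a free generator -/

section Tensor

variable {Y : Scheme.{0}} {M N L : Y.Modules}

variable (M L) in
/-- The presheaf `U ↦ M(U) ⊗ L(U)`. -/
def tensorPre : PresheafOfModules.{0} (Y.presheaf ⋙ forget₂ CommRingCat RingCat) :=
  MonoidalCategory.tensorObj (C := PresheafOfModules.{0} (Y.presheaf ⋙ forget₂ _ _)) M.val L.val

variable (M L) in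
/-- The canonical map from the tensor product of modules of sections to sections of the tensor
product. -/
def toTensor (U : Y.Opens) : (Γ(M, U) ⊗[Γ(Y, U)] Γ(L, U)) →ₗ[Γ(Y, U)] Γ(tensorSheaf M L, U) :=
  (((PresheafOfModules.sheafificationAdjunction (𝟙 Y.ringCatSheaf.obj)).unit.app
    (tensorPre M L)).app (.op U)).hom

/-- The section `s ⊗ l` of the tensor product. -/
def tmulSection {U : Y.Opens} (s : Γ(M, U)) (l : Γ(L, U)) : Γ(tensorSheaf M L, U) :=
  toTensor M L U (s ⊗ₜ l)

lemma res_tmulSection {U V : Y.Opens} (h : V ≤ U) (s : Γ(M, U)) (l : Γ(L, U)) :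
    res h (tmulSection s l) = tmulSection (res h s) (res h l) := by
  exact (ConcreteCategory.congr_hom ((CategoryTheory.toSheafify (Opens.grothendieckTopology Y)
    (tensorPre M L).presheaf).naturality (homOfLE h).op) (s ⊗ₜ[Γ(Y, U)] l)).symm

lemma tensorSheafMap_tmulSection (φ : M ⟶ N) {U : Y.Opens} (s : Γ(M, U)) (l : Γ(L, U)) :
    (tensorSheafMap φ L).app U (tmulSection s l) = tmulSection (φ.app U s) l := by
  let ψ : tensorPre M L ⟶ tensorPre N L :=
    MonoidalCategory.whiskerRight (C := PresheafOfModules.{0} (Y.presheaf ⋙ forget₂ _ _))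
      φ.val L.val
  exact (ConcreteCategory.congr_hom (NatTrans.congr_app (CategoryTheory.toSheafify_naturality
    (Opens.grothendieckTopology Y) ((PresheafOfModules.toPresheaf _).map ψ)) (.op U)) (s ⊗ₜ[Γ(Y, U)] l)).symm

/-- Restriction for the presheaf `U ↦ M(U) ⊗ L(U)`. -/
def resPre {U V : Y.Opens} (h : V ≤ U) :
    (Γ(M, U) ⊗[Γ(Y, U)] Γ(L, U)) →+ (Γ(M, V) ⊗[Γ(Y, V)] Γ(L, V)) :=
  ((tensorPre M L).presheaf.map (homOfLE h).op).hom

lemma resPre_tmul {U V : Y.Opens} (h : V ≤ U) (s : Γ(M, U)) (l : Γ(L, U)) :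
    resPre h (s ⊗ₜ[Γ(Y, U)] l) = res h s ⊗ₜ[Γ(Y, V)] res h l := rfl

/-- Presheaf sections identified by sheafification agree on a covering sieve, and some member of
that sieve contains `y`. -/
lemma toTensor_locally_injective {U : Y.Opens} {t t' : Γ(M, U) ⊗[Γ(Y, U)] Γ(L, U)}
    (ht : toTensor M L U t = toTensor M L U t') (y : Y) (hy : y ∈ U) :
    ∃ (V : Y.Opens) (h : V ≤ U), y ∈ V ∧ resPre h t = resPre h t' := by
  have := Presheaf.equalizerSieve_mem (Opens.grothendieckTopology Y)
    (CategoryTheory.toSheafify (Opens.grothendieckTopology Y) (tensorPre M L).presheaf) t t' ht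
  obtain ⟨V, f, hf, hyV⟩ := this y hy
  exact ⟨V, f.le, hyV, hf⟩

lemma toTensor_locally_surjective {U : Y.Opens} (t : Γ(tensorSheaf M L, U)) (y : Y) (hy : y ∈ U) :
    ∃ (V : Y.Opens) (h : V ≤ U) (p : _), y ∈ V ∧ res h t = toTensor M L V p := by
  have := Presheaf.imageSieve_mem (Opens.grothendieckTopology Y)
    (CategoryTheory.toSheafify (Opens.grothendieckTopology Y) (tensorPre M L).presheaf) t
  obtain ⟨V, f, ⟨p, hp⟩, hyV⟩ := this y hy
  exact ⟨V, f.le, p, hyV, hp.symm⟩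

/-- `l` is a free generator of `L` over `U`. -/
def IsGenerator {U : Y.Opens} (l : Γ(L, U)) : Prop :=
  ∀ (V : Y.Opens) (h : V ≤ U), Function.Bijective fun r : Γ(Y, V) => r • res h l

lemma exists_isGenerator {U : Y.Opens} (hL : IsFreeOn L U 1) : ∃ l : Γ(L, U), IsGenerator l := by
  obtain ⟨e, he⟩ := hL
  refine ⟨e 0, fun V h => ⟨?_, fun m => ?_⟩⟩
  · have := (he V h).1
    intro r r' hr
    have h2 := linearIndependent_iff'.mp this Finset.univ (fun _ => r - r') (by
      simp only [Finset.univ_unique, Finset.sum_singleton, sub_smul]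
      exact sub_eq_zero.mpr hr) 0 (Finset.mem_univ _)
    exact sub_eq_zero.mp h2
  · have : m ∈ Submodule.span Γ(Y, V)
      (Set.range fun i => L.presheaf.map (homOfLE h).op (e i)) := by rw [(he V h).2]; trivial
    rw [Set.range_unique, Submodule.mem_span_singleton] at this
    exact this

lemma isFreeOn_of_isGenerator {U : Y.Opens} {l : Γ(L, U)} (hl : IsGenerator l) :
    IsFreeOn L U 1 := by
  refine ⟨fun _ => l, fun V h => ⟨?_, ?_⟩⟩
  · refine linearIndependent_iff'.mpr fun s g hg i _ => ?_
    have := (hl V h).1 (a₁ := g 0) (a₂ := 0)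
    by_cases h0 : (0 : Fin 1) ∈ s
    · have hs : s = {0} := by ext j; simp [Subsingleton.elim j 0, h0]
      subst hs
      rw [Subsingleton.elim i 0]
      apply this
      rw [Finset.sum_singleton] at hg
      exact hg.trans (zero_smul _ _).symm
    · rw [Subsingleton.elim i 0] at *; contradiction
  · rw [eq_top_iff]
    rintro m -
    obtain ⟨r, rfl⟩ := (hl V h).2 m
    exact Submodule.smul_mem _ _ (Submodule.subset_span ⟨0, rfl⟩)

lemma IsGenerator.res {U V : Y.Opens} (h : V ≤ U) {l : Γ(L, U)} (hl : IsGenerator l) :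
    IsGenerator (res h l) := by
  intro W hW
  simp only [res_res]
  exact hl W _

/-- A generator identifies `L(U)` with `𝒪(U)`, and the claim becomes the unit law `M ⊗ 𝒪 ≅ M`. -/
lemma tmul_bijective_of_isGenerator {U : Y.Opens} {l : Γ(L, U)} (hl : IsGenerator l) :
    Function.Bijective fun s : Γ(M, U) => s ⊗ₜ[Γ(Y, U)] l := by
  have hb : Function.Bijective fun r : Γ(Y, U) => r • l := by simpa only [res_self] using hl U le_rfl
  let e : Γ(Y, U) ≃ₗ[Γ(Y, U)] Γ(L, U) :=
    LinearEquiv.ofBijective (LinearMap.toSpanSingleton _ _ l) hb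
  let E := (TensorProduct.rid Γ(Y, U) Γ(M, U)).symm ≪≫ₗ TensorProduct.congr (LinearEquiv.refl _ _) e
  have : (fun s : Γ(M, U) => s ⊗ₜ[Γ(Y, U)] l) = E := by
    funext s
    have he : e 1 = l := one_smul _ l
    simp [E, he]
  rw [this]
  exact E.bijective

/-- The presheaf version is `tmul_bijective_of_isGenerator`; after sheafification it survives
locally. Injectivity is therefore proved over every `V ≤ U`, and used on overlaps to glue the local
preimages. -/
lemma tmulSection_bijective {U : Y.Opens} {l : Γ(L, U)} (hl : IsGenerator l) :
    Function.Bijective fun s : Γ(M, U) => tmulSection s l := by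
  have hinj : ∀ (V : Y.Opens) (h : V ≤ U) (s s' : Γ(M, V)),
      tmulSection s (res h l) = tmulSection s' (res h l) → s = s' := by
    intro V h s s' hs
    refine section_ext fun y hy => ?_
    obtain ⟨W, hW, hyW, hp⟩ := toTensor_locally_injective hs y hy
    refine ⟨W, hW, hyW, ?_⟩
    rw [resPre_tmul, resPre_tmul] at hp
    exact (tmul_bijective_of_isGenerator (IsGenerator.res hW (IsGenerator.res h hl))).1 hp
  refine ⟨fun s s' hs => hinj U le_rfl s s' (by simpa only [res_self] using hs), fun t => ?_⟩
  have : ∀ y : U, ∃ (V : Y.Opens) (h : V ≤ U) (s : Γ(M, V)), y.1 ∈ V ∧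
      tmulSection s (res h l) = res h t := by
    intro y
    obtain ⟨V, h, p, hyV, hp⟩ := toTensor_locally_surjective t y.1 y.2
    obtain ⟨s, rfl⟩ := (tmul_bijective_of_isGenerator (M := M) (IsGenerator.res h hl)).2 p
    exact ⟨V, h, s, hyV, hp.symm⟩
  choose V h s hyV hs using this
  obtain ⟨s₀, hs₀⟩ := section_glue V h hyV s (fun y z => by
    apply hinj (V y ⊓ V z) (inf_le_left.trans (h y))
    have h1 := congrArg (res (inf_le_left : V y ⊓ V z ≤ V y)) (hs y)
    have h2 := congrArg (res (inf_le_right : V y ⊓ V z ≤ V z)) (hs z)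
    rw [res_tmulSection, res_res, res_res] at h1 h2
    rw [h1, h2])
  refine ⟨s₀, section_ext fun y hy => ⟨V ⟨y, hy⟩, h _, hyV ⟨y, hy⟩, ?_⟩⟩
  dsimp only
  rw [res_tmulSection, hs₀, hs]

lemma tmulSection_add {U : Y.Opens} (s s' : Γ(M, U)) (l : Γ(L, U)) :
    tmulSection (s + s') l = tmulSection s l + tmulSection s' l := by
  simp [tmulSection, TensorProduct.add_tmul]

lemma smul_tmulSection {U : Y.Opens} (r : Γ(Y, U)) (s : Γ(M, U)) (l : Γ(L, U)) :
    tmulSection (r • s) l = r • tmulSection s l := by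
  rw [tmulSection, ← TensorProduct.smul_tmul', map_smul]; rfl

lemma tmulSection_smul {U : Y.Opens} (r : Γ(Y, U)) (s : Γ(M, U)) (l : Γ(L, U)) :
    tmulSection s (r • l) = tmulSection (r • s) l := by
  rw [tmulSection, tmulSection, TensorProduct.smul_tmul]

/-- Tensoring with a generator is an isomorphism on sections. -/
def tensorEquiv {U : Y.Opens} {l : Γ(L, U)} (hl : IsGenerator l) :
    Γ(M, U) ≃+ Γ(tensorSheaf M L, U) :=
  AddEquiv.ofBijective (AddMonoidHom.mk' (fun s => tmulSection s l)
    (fun s s' => tmulSection_add s s' l)) (tmulSection_bijective hl)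

lemma tensorEquiv_apply {U : Y.Opens} {l : Γ(L, U)} (hl : IsGenerator l) (s : Γ(M, U)) :
    tensorEquiv hl s = tmulSection s l := rfl

lemma exists_res_eq_tmulSection {U U₀ : Y.Opens} {l₀ : Γ(L, U₀)} (hl₀ : IsGenerator l₀)
    (t : Γ(tensorSheaf M L, U)) :
    ∃ s : Γ(M, U ⊓ U₀), res inf_le_left t = tmulSection s (res inf_le_right l₀) := by
  obtain ⟨s, hs⟩ := (tmulSection_bijective (M := M)
    (IsGenerator.res (inf_le_right : U ⊓ U₀ ≤ U₀) hl₀)).2 (res inf_le_left t)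
  exact ⟨s, hs.symm⟩

end Tensor

/-! ### Sheaves of modules embedded in a constant sheaf `K` -/

section Generic

variable {Y : Scheme.{0}} [IsIntegral Y] {K : Type} [Field K] (κ : Y.functionField →+* K)

lemma genericPoint_mem {U : Y.Opens} {y : Y} (hy : y ∈ U) : genericPoint Y ∈ U :=
  (genericPoint_specializes y).mem_open U.2 hy

lemma notMem_of_genericPoint_notMem {U : Y.Opens} (hU : genericPoint Y ∉ U) (y : Y) : y ∉ U :=
  fun hy => hU (genericPoint_mem hy)

/-- The value in `K` of a regular function. -/
def value {U : Y.Opens} (hU : genericPoint Y ∈ U) : Γ(Y, U) →+* K :=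
  κ.comp (Y.presheaf.germ U (genericPoint Y) hU).hom

/-- The local ring at `y`, as a subring of `K`. -/
def localSubring (y : Y) : Subring K :=
  (κ.comp (algebraMap (Y.presheaf.stalk y) Y.functionField)).range

variable {κ}

lemma value_resO {U V : Y.Opens} (h : V ≤ U) (hV : genericPoint Y ∈ V) (r : Γ(Y, U)) :
    value κ hV (resO h r) = value κ (h hV) r :=
  congrArg κ (Y.presheaf.germ_res_apply (homOfLE h) _ hV r)

lemma value_injective {U : Y.Opens} (hU : genericPoint Y ∈ U) :
    Function.Injective (value κ hU) :=
  κ.injective.comp (germ_injective_of_isIntegral _ _ hU)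

lemma algebraMap_germ {U : Y.Opens} {y : Y} (hy : y ∈ U) (r : Γ(Y, U)) :
    κ (algebraMap (Y.presheaf.stalk y) Y.functionField (Y.presheaf.germ U y hy r)) =
      value κ (genericPoint_mem hy) r := by
  have : Nonempty U := ⟨⟨y, hy⟩⟩
  exact congrArg κ (ConcreteCategory.congr_hom
    (Y.presheaf.germ_stalkSpecializes hy (genericPoint_specializes y)) r)

lemma mem_localSubring {y : Y} {x : K} :
    x ∈ localSubring κ y ↔
      ∃ (U : Y.Opens) (hy : y ∈ U) (r : Γ(Y, U)), value κ (genericPoint_mem hy) r = x := by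
  constructor
  · rintro ⟨a, rfl⟩
    obtain ⟨U, hy, r, rfl⟩ := Y.presheaf.exists_germ_eq a
    exact ⟨U, hy, r, (algebraMap_germ hy r).symm⟩
  · rintro ⟨U, hy, r, rfl⟩
    exact ⟨Y.presheaf.germ U y hy r, algebraMap_germ hy r⟩

lemma value_mem_localSubring {U : Y.Opens} {y : Y} (hy : y ∈ U) (r : Γ(Y, U)) :
    value κ (genericPoint_mem hy) r ∈ localSubring κ y :=
  mem_localSubring.mpr ⟨U, hy, r, rfl⟩

/-- On an integral scheme `𝒪(U)` is the intersection of the local rings: local functions with the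
same value `x` agree on overlaps, so they glue. -/
lemma exists_value_eq {U : Y.Opens} (hU : genericPoint Y ∈ U) {x : K}
    (hx : ∀ y ∈ U, x ∈ localSubring κ y) : ∃ r : Γ(Y, U), value κ hU r = x := by
  have : ∀ y : U, ∃ (V : Y.Opens) (_ : V ≤ U) (hy : y.1 ∈ V) (r : Γ(Y, V)),
      value κ (genericPoint_mem hy) r = x := by
    intro y
    obtain ⟨V, hV, r, hr⟩ := mem_localSubring.mp (hx y.1 y.2)
    exact ⟨V ⊓ U, inf_le_right, ⟨hV, y.2⟩, resO inf_le_left r, by rw [value_resO, hr]⟩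
  choose V h hy r hr using this
  obtain ⟨t, ht⟩ := sectionO_glue V h hy r (fun y z => by
    apply value_injective (κ := κ) (U := V y ⊓ V z)
      (mem_inf_opens (genericPoint_mem (hy y)) (genericPoint_mem (hy z)))
    rw [value_resO, value_resO, hr, hr])
  refine ⟨t, ?_⟩
  rw [← hr ⟨_, hU⟩, ← ht, value_resO]

variable (κ) in
/-- An embedding of a sheaf of modules into the constant sheaf `K`. -/
structure GenericEmbedding (M : Y.Modules) where
  emb : ∀ U : Y.Opens, genericPoint Y ∈ U → Γ(M, U) →+ K
  emb_res : ∀ {U V : Y.Opens} (h : V ≤ U) (hV : genericPoint Y ∈ V) (s : Γ(M, U)),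
    emb V hV (res h s) = emb U (h hV) s
  emb_smul : ∀ {U : Y.Opens} (hU : genericPoint Y ∈ U) (r : Γ(Y, U)) (s : Γ(M, U)),
    emb U hU (r • s) = value κ hU r * emb U hU s
  emb_injective : ∀ {U : Y.Opens} (hU : genericPoint Y ∈ U), Function.Injective (emb U hU)

namespace GenericEmbedding

variable {M M' L : Y.Modules} (j : GenericEmbedding κ M) (j' : GenericEmbedding κ M')

/-- The image of the stalk at `y` in `K`. -/
def stalkImage (y : Y) : AddSubgroup K where
  carrier := {x | ∃ (U : Y.Opens) (hy : y ∈ U) (s : Γ(M, U)), j.emb U (genericPoint_mem hy) s = x}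
  zero_mem' := ⟨⊤, trivial, 0, map_zero _⟩
  add_mem' := by
    rintro _ _ ⟨U, hy, s, rfl⟩ ⟨U', hy', s', rfl⟩
    refine ⟨U ⊓ U', ⟨hy, hy'⟩, res inf_le_left s + res inf_le_right s', ?_⟩
    rw [map_add, emb_res, emb_res]
  neg_mem' := by
    rintro _ ⟨U, hy, s, rfl⟩
    exact ⟨U, hy, -s, map_neg _ _⟩

lemma emb_mem_stalkImage {U : Y.Opens} {y : Y} (hy : y ∈ U) (hU : genericPoint Y ∈ U)
    (s : Γ(M, U)) : j.emb U hU s ∈ j.stalkImage y := ⟨U, hy, s, rfl⟩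

lemma mul_mem_stalkImage {y : Y} {a x : K} (ha : a ∈ localSubring κ y)
    (hx : x ∈ j.stalkImage y) : a * x ∈ j.stalkImage y := by
  obtain ⟨U, hy, r, rfl⟩ := mem_localSubring.mp ha
  obtain ⟨V, hy', s, rfl⟩ := hx
  refine ⟨U ⊓ V, mem_inf_opens hy hy',
    resO (inf_le_left : U ⊓ V ≤ U) r • res (inf_le_right : U ⊓ V ≤ V) s, ?_⟩
  rw [emb_smul, emb_res, value_resO]

/-- The same gluing for modules. It shows that an embedded sheaf is determined by its stalk images.
-/
lemma exists_emb_eq {U : Y.Opens} (hU : genericPoint Y ∈ U) {x : K}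
    (hx : ∀ y ∈ U, x ∈ j.stalkImage y) : ∃ s : Γ(M, U), j.emb U hU s = x := by
  have : ∀ y : U, ∃ (V : Y.Opens) (_ : V ≤ U) (hy : y.1 ∈ V) (s : Γ(M, V)),
      j.emb V (genericPoint_mem hy) s = x := by
    intro y
    obtain ⟨V, hV, s, hs⟩ := hx y.1 y.2
    exact ⟨V ⊓ U, inf_le_right, ⟨hV, y.2⟩, res inf_le_left s, by rw [emb_res, hs]⟩
  choose V h hy s hs using this
  obtain ⟨t, ht⟩ := section_glue V h hy s (fun y z => by
    apply j.emb_injective (U := V y ⊓ V z)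
      (mem_inf_opens (genericPoint_mem (hy y)) (genericPoint_mem (hy z)))
    rw [emb_res, emb_res, hs, hs])
  refine ⟨t, ?_⟩
  rw [← hs ⟨_, hU⟩, ← ht, emb_res]

lemma mem_range_emb {U : Y.Opens} (hU : genericPoint Y ∈ U) {x : K} :
    x ∈ Set.range (j.emb U hU) ↔ ∀ y ∈ U, x ∈ j.stalkImage y :=
  ⟨by rintro ⟨s, rfl⟩ y hy; exact j.emb_mem_stalkImage hy hU s, fun hx => j.exists_emb_eq hU hx⟩

/-- Transport of an embedding along an isomorphism. -/
def comap (e : M ≅ M') : GenericEmbedding κ M where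
  emb U hU := (j'.emb U hU).comp (e.hom.app U).hom
  emb_res h hV s := by
    change j'.emb _ _ (e.hom.app _ (res h s)) = _
    rw [app_res, emb_res]; rfl
  emb_smul hU r s := by
    change j'.emb _ _ (e.hom.app _ (r • s)) = _
    rw [Scheme.Modules.Hom.app_smul, emb_smul]; rfl
  emb_injective {U} hU s s' hs := by
    have h1 := j'.emb_injective hU hs
    rw [← app_hom_inv e U s, ← app_hom_inv e U s']
    exact congrArg _ h1

lemma stalkImage_comap (e : M ≅ M') (y : Y) : (j'.comap e).stalkImage y = j'.stalkImage y := by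
  ext x
  constructor
  · rintro ⟨U, hy, s, rfl⟩
    exact ⟨U, hy, e.hom.app U s, rfl⟩
  · rintro ⟨U, hy, s, rfl⟩
    refine ⟨U, hy, e.inv.app U s, ?_⟩
    change j'.emb _ _ (e.hom.app U (e.inv.app U s)) = _
    rw [app_inv_hom]

/-- Rescaling of an embedding. -/
def scale (c : K) (hc : c ≠ 0) : GenericEmbedding κ M where
  emb U hU := (AddMonoidHom.mulLeft c).comp (j.emb U hU)
  emb_res h hV s := by simp [emb_res]
  emb_smul hU r s := by simp [emb_smul, mul_left_comm]
  emb_injective hU := (mul_right_injective₀ hc).comp (j.emb_injective hU)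

lemma scale_emb (c : K) (hc : c ≠ 0) {U : Y.Opens} (hU : genericPoint Y ∈ U) (s : Γ(M, U)) :
    (j.scale c hc).emb U hU s = c * j.emb U hU s := rfl

lemma mem_stalkImage_scale (c : K) (hc : c ≠ 0) (y : Y) (x : K) :
    x ∈ (j.scale c hc).stalkImage y ↔ ∃ z ∈ j.stalkImage y, x = c * z := by
  constructor
  · rintro ⟨U, hy, s, rfl⟩
    exact ⟨_, ⟨U, hy, s, rfl⟩, rfl⟩
  · rintro ⟨_, ⟨U, hy, s, rfl⟩, rfl⟩
    exact ⟨U, hy, s, rfl⟩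

variable {j j'}

/-- An open set missing the generic point is empty and carries a single section, so one formula,
conditional on `hU`, covers all open sets. -/
lemma existsUnique_section (H : ∀ y, j.stalkImage y ≤ j'.stalkImage y) (U : Y.Opens)
    (s : Γ(M, U)) : ∃! t : Γ(M', U), ∀ hU : genericPoint Y ∈ U, j'.emb U hU t = j.emb U hU s := by
  by_cases hU : genericPoint Y ∈ U
  · obtain ⟨t, ht⟩ := j'.exists_emb_eq hU (x := j.emb U hU s)
      (fun y hy => H y (j.emb_mem_stalkImage hy hU s))
    exact ⟨t, fun _ => ht, fun t' ht' => j'.emb_injective hU ((ht' hU).trans ht.symm)⟩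
  · have := section_subsingleton (M := M') (notMem_of_genericPoint_notMem hU)
    exact ⟨0, fun h => (hU h).elim, fun _ _ => Subsingleton.elim _ _⟩

/-- The section of `M'` with the same value in `K` as a given section of `M`. -/
def sectionOfLE (H : ∀ y, j.stalkImage y ≤ j'.stalkImage y) (U : Y.Opens) (s : Γ(M, U)) :
    Γ(M', U) := (existsUnique_section H U s).choose

lemma emb_sectionOfLE (H : ∀ y, j.stalkImage y ≤ j'.stalkImage y) (U : Y.Opens) (s : Γ(M, U))
    (hU : genericPoint Y ∈ U) : j'.emb U hU (sectionOfLE H U s) = j.emb U hU s :=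
  (existsUnique_section H U s).choose_spec.1 hU

variable (j') in
lemma section_eq {U : Y.Opens} {t t' : Γ(M', U)}
    (h : ∀ hU : genericPoint Y ∈ U, j'.emb U hU t = j'.emb U hU t') : t = t' := by
  by_cases hU : genericPoint Y ∈ U
  · exact j'.emb_injective hU (h hU)
  · have := section_subsingleton (M := M') (notMem_of_genericPoint_notMem hU)
    exact Subsingleton.elim _ _

/-- The morphism of sheaves of modules given by an inclusion inside `K`. -/
def homOfLE (H : ∀ y, j.stalkImage y ≤ j'.stalkImage y) : M ⟶ M' :=
  homMk (fun U =>
    { toFun := sectionOfLE H U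
      map_add' := fun s t => section_eq j' fun hU => by
        rw [map_add, emb_sectionOfLE, emb_sectionOfLE, emb_sectionOfLE, map_add]
      map_smul' := fun r t => section_eq j' fun hU => by
        rw [RingHom.id_apply, emb_smul, emb_sectionOfLE, emb_sectionOfLE, emb_smul] })
    (fun h s => section_eq j' fun hV => by
      change j'.emb _ hV (sectionOfLE H _ _) = j'.emb _ hV (res h (sectionOfLE H _ _))
      rw [emb_res, emb_sectionOfLE, emb_sectionOfLE, emb_res])

lemma emb_homOfLE (H : ∀ y, j.stalkImage y ≤ j'.stalkImage y) {U : Y.Opens}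
    (hU : genericPoint Y ∈ U) (s : Γ(M, U)) :
    j'.emb U hU ((homOfLE H).app U s) = j.emb U hU s := emb_sectionOfLE H U s hU

variable (j') in
lemma hom_eq {φ ψ : M ⟶ M'}
    (h : ∀ (U : Y.Opens) (hU : genericPoint Y ∈ U) (s : Γ(M, U)),
      j'.emb U hU (φ.app U s) = j'.emb U hU (ψ.app U s)) : φ = ψ := by
  apply Scheme.Modules.hom_ext
  intro U
  ext s
  exact section_eq j' fun hU => h U hU s

/-- Two sheaves of modules with the same image in `K` are isomorphic. -/
def isoOfEq (H : ∀ y, j.stalkImage y = j'.stalkImage y) : M ≅ M' where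
  hom := homOfLE fun y => (H y).le
  inv := homOfLE fun y => (H y).ge
  hom_inv_id := hom_eq j fun U hU s => by
    rw [Scheme.Modules.Hom.comp_app, ConcreteCategory.comp_apply, emb_homOfLE, emb_homOfLE]; rfl
  inv_hom_id := hom_eq j' fun U hU s => by
    rw [Scheme.Modules.Hom.comp_app, ConcreteCategory.comp_apply, emb_homOfLE, emb_homOfLE]; rfl

lemma emb_isoOfEq (H : ∀ y, j.stalkImage y = j'.stalkImage y) {U : Y.Opens}
    (hU : genericPoint Y ∈ U) (s : Γ(M, U)) :
    j'.emb U hU ((isoOfEq H).hom.app U s) = j.emb U hU s := emb_homOfLE _ hU s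

end GenericEmbedding

end Generic

/-! ### Stalks of embedded sheaves, proportional embeddings, embeddings of tensor products -/

section Generic

variable {Y : Scheme.{0}} [IsIntegral Y] {K : Type} [Field K] {κ : Y.functionField →+* K}

namespace GenericEmbedding

variable {M M' L : Y.Modules} (j : GenericEmbedding κ M) (j' : GenericEmbedding κ M')

/-- The embedding of the stalk at `y` in `K`. -/
def stalkMap (y : Y) : M.presheaf.stalk y →+ K :=
  (Limits.colimit.desc ((OpenNhds.inclusion y).op ⋙ M.presheaf)
    { pt := AddCommGrpCat.of K
      ι :=
        { app := fun U => AddCommGrpCat.ofHom (j.emb U.unop.1 (genericPoint_mem U.unop.2))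
          naturality := by
            intro U V i
            ext s
            exact j.emb_res i.unop.le _ s } }).hom

lemma stalkMap_germ {U : Y.Opens} {y : Y} (hy : y ∈ U) (s : Γ(M, U)) :
    j.stalkMap y (M.presheaf.germ U y hy s) = j.emb U (genericPoint_mem hy) s :=
  ConcreteCategory.congr_hom (Limits.colimit.ι_desc (F := (OpenNhds.inclusion y).op ⋙ M.presheaf)
    _ (.op ⟨U, hy⟩)) s

lemma stalkMap_injective (y : Y) : Function.Injective (j.stalkMap y) := by
  rw [injective_iff_map_eq_zero]
  intro m hm
  obtain ⟨U, hy, s, rfl⟩ := M.presheaf.exists_germ_eq m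
  rw [stalkMap_germ] at hm
  rw [j.emb_injective _ (hm.trans (map_zero _).symm), map_zero]

lemma range_stalkMap (y : Y) (x : K) : (∃ m, j.stalkMap y m = x) ↔ x ∈ j.stalkImage y := by
  constructor
  · rintro ⟨m, rfl⟩
    obtain ⟨U, hy, s, rfl⟩ := M.presheaf.exists_germ_eq m
    exact ⟨U, hy, s, (j.stalkMap_germ hy s).symm⟩
  · rintro ⟨U, hy, s, rfl⟩
    exact ⟨_, j.stalkMap_germ hy s⟩

lemma stalkMap_smul (y : Y) (a : Y.presheaf.stalk y) (m : M.presheaf.stalk y) :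
    j.stalkMap y (a • m) = κ (algebraMap _ Y.functionField a) * j.stalkMap y m := by
  obtain ⟨U, hU, a, rfl⟩ := Y.presheaf.exists_germ_eq a
  obtain ⟨V, hV, b, rfl⟩ := M.presheaf.exists_germ_eq m
  have h1 : Y.presheaf.germ (U ⊓ V) y (mem_inf_opens hU hV) (resO inf_le_left a) =
      Y.presheaf.germ U y hU a :=
    Y.presheaf.germ_res_apply (CategoryTheory.homOfLE inf_le_left) y (mem_inf_opens hU hV) a
  have hW : y ∈ U ⊓ V := mem_inf_opens hU hV
  rw [← h1, ← germ_eq_germ_res (inf_le_right : U ⊓ V ≤ V) hW]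
  have h2 := germ_smul M y (U ⊓ V) hW (resO inf_le_left a) (res inf_le_right b)
  rw [← h2, stalkMap_germ, stalkMap_germ, emb_smul, algebraMap_germ]

lemma stalkMap_stalkAddHom {φ : M ⟶ M'} {f : K → K}
    (hφ : ∀ (U : Y.Opens) (hU : genericPoint Y ∈ U) (s : Γ(M, U)),
      j'.emb U hU (φ.app U s) = f (j.emb U hU s)) (y : Y) (m : M.presheaf.stalk y) :
    j'.stalkMap y (stalkAddHom φ y m) = f (j.stalkMap y m) := by
  obtain ⟨U, hy, s, rfl⟩ := M.presheaf.exists_germ_eq m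
  rw [stalkAddHom_germ, stalkMap_germ, stalkMap_germ, hφ]

/-- Two embeddings which are equivariant for a ring with fraction field `K` are proportional. -/
lemma exists_emb_eq_mul {R : Type*} [CommRing R] [Nontrivial R] [Algebra R K] [IsFractionRing R K]
    (act : R → End M) (j₁ j₂ : GenericEmbedding κ M)
    (h₁ : ∀ (f : R) (U : Y.Opens) (hU : genericPoint Y ∈ U) (s : Γ(M, U)),
      j₁.emb U hU (Scheme.Modules.Hom.app (act f) U s) = algebraMap R K f * j₁.emb U hU s)
    (h₂ : ∀ (f : R) (U : Y.Opens) (hU : genericPoint Y ∈ U) (s : Γ(M, U)),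
      j₂.emb U hU (Scheme.Modules.Hom.app (act f) U s) = algebraMap R K f * j₂.emb U hU s)
    (hone : (1 : K) ∈ j₁.stalkImage (genericPoint Y)) :
    ∃ c : K, c ≠ 0 ∧ c ∈ j₂.stalkImage (genericPoint Y) ∧
      ∀ (U : Y.Opens) (hU : genericPoint Y ∈ U) (s : Γ(M, U)),
        j₂.emb U hU s = c * j₁.emb U hU s := by
  obtain ⟨U₁, hU₁, s₁, hs₁⟩ := hone
  refine ⟨j₂.emb U₁ hU₁ s₁, ?_, ⟨U₁, hU₁, s₁, rfl⟩, fun U hU s => ?_⟩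
  · intro h
    rw [j₂.emb_injective hU₁ (h.trans (map_zero _).symm), map_zero] at hs₁
    exact zero_ne_one hs₁
  · obtain ⟨a, b, hb, hab⟩ := IsFractionRing.div_surjective (A := R) (j₁.emb U hU s)
    have hb' : algebraMap R K b ≠ 0 := IsFractionRing.to_map_ne_zero_of_mem_nonZeroDivisors hb
    have hW : genericPoint Y ∈ U ⊓ U₁ := ⟨hU, hU₁⟩
    -- If `s` has value `a / b`, then `b s` and `a s₁` have equal values under `j₁`, hence are equal
    -- sections; applying `j₂` determines the other value of `s`.
    have key : Scheme.Modules.Hom.app (act b) (U ⊓ U₁) (res inf_le_left s) =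
        Scheme.Modules.Hom.app (act a) (U ⊓ U₁) (res inf_le_right s₁) := by
      apply j₁.emb_injective hW
      rw [h₁, h₁, emb_res, emb_res, hs₁, ← hab]
      field_simp
    have key2 := congrArg (j₂.emb _ hW) key
    rw [h₂, h₂, emb_res, emb_res] at key2
    rw [← hab, div_eq_inv_mul, mul_comm (j₂.emb U₁ hU₁ s₁), mul_assoc, ← key2]
    field_simp

end GenericEmbedding

section TensorEmbedding

variable {M M' L : Y.Modules}

/-- The transition function of two trivialisations. It is non-zero because otherwise `l` would
restrict to `0`, which `0` and `1` multiply to the same section. -/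
lemma exists_unit_of_isGenerator {U U₀ : Y.Opens} {l : Γ(L, U)} {l₀ : Γ(L, U₀)}
    (hl : IsGenerator l) (hl₀ : IsGenerator l₀) (hU : genericPoint Y ∈ U ⊓ U₀) :
    ∃ u : Γ(Y, U ⊓ U₀), res inf_le_left l = u • res inf_le_right l₀ ∧ value κ hU u ≠ 0 := by
  obtain ⟨u, hu⟩ := (hl₀ (U ⊓ U₀) inf_le_right).2 (res inf_le_left l)
  refine ⟨u, hu.symm, fun h0 => ?_⟩
  have hu0 : u = 0 := value_injective hU (h0.trans (map_zero _).symm)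
  subst hu0
  replace hu : res (inf_le_left : U ⊓ U₀ ≤ U) l = 0 := hu.symm.trans (zero_smul _ _)
  have := (hl (U ⊓ U₀) inf_le_left).1 (a₁ := 0) (a₂ := 1) (by simp [hu])
  have := congrArg (value κ hU) this
  simp at this

variable (j : GenericEmbedding κ M) {U₀ : Y.Opens} {l₀ : Γ(L, U₀)} (hl₀ : IsGenerator l₀)
  (hU₀ : genericPoint Y ∈ U₀)

/-- The embedding of the restriction to `U₀`, on which `L` is trivialised by `l₀`. -/
def tensorEmb (U : Y.Opens) (hU : genericPoint Y ∈ U) : Γ(tensorSheaf M L, U) →+ K :=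
  (j.emb (U ⊓ U₀) (mem_inf_opens hU hU₀)).comp
    ((tensorEquiv (IsGenerator.res (inf_le_right : U ⊓ U₀ ≤ U₀) hl₀)).symm.toAddMonoidHom.comp
      (res inf_le_left))

lemma tensorEmb_apply (U : Y.Opens) (hU : genericPoint Y ∈ U) (t : Γ(tensorSheaf M L, U)) :
    tensorEmb j hl₀ hU₀ U hU t = j.emb (U ⊓ U₀) (mem_inf_opens hU hU₀)
      ((tensorEquiv (IsGenerator.res (inf_le_right : U ⊓ U₀ ≤ U₀) hl₀)).symm
        (res inf_le_left t)) := rfl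

lemma tensorEmb_eq {U : Y.Opens} (hU : genericPoint Y ∈ U) (t : Γ(tensorSheaf M L, U))
    (s : Γ(M, U ⊓ U₀)) (hs : res inf_le_left t = tmulSection s (res inf_le_right l₀)) :
    tensorEmb j hl₀ hU₀ U hU t = j.emb (U ⊓ U₀) (mem_inf_opens hU hU₀) s := by
  rw [tensorEmb_apply, hs, ← tensorEquiv_apply (IsGenerator.res (inf_le_right : U ⊓ U₀ ≤ U₀) hl₀),
    AddEquiv.symm_apply_apply]

lemma tensorEmb_res {U V : Y.Opens} (h : V ≤ U) (hV : genericPoint Y ∈ V)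
    (t : Γ(tensorSheaf M L, U)) :
    tensorEmb j hl₀ hU₀ V hV (res h t) = tensorEmb j hl₀ hU₀ U (h hV) t := by
  obtain ⟨s, hs⟩ := exists_res_eq_tmulSection hl₀ t
  have h' : V ⊓ U₀ ≤ U ⊓ U₀ := inf_le_inf_right _ h
  rw [tensorEmb_eq j hl₀ hU₀ _ t s hs, tensorEmb_eq j hl₀ hU₀ hV (res h t) (res h' s)]
  · exact j.emb_res h' _ s
  · have := congrArg (res h') hs
    rw [res_tmulSection, res_res, res_res] at this
    rw [res_res, this]

/-- On the overlap with `U₀` one has `s ⊗ l = us ⊗ l₀`, and `tensorEmb` reads off the coefficient of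
`l₀`. -/
lemma tensorEmb_tmulSection {U V : Y.Opens} (hU : genericPoint Y ∈ U) {l : Γ(L, V)}
    (h : U ≤ V) (u : Γ(Y, V ⊓ U₀)) (hu : res inf_le_left l = u • res inf_le_right l₀)
    (s : Γ(M, U)) :
    tensorEmb j hl₀ hU₀ U hU (tmulSection s (res h l)) =
      value κ (mem_inf_opens (h hU) hU₀) u * j.emb U hU s := by
  have h' : U ⊓ U₀ ≤ V ⊓ U₀ := inf_le_inf_right _ h
  have hW := mem_inf_opens hU hU₀
  rw [tensorEmb_eq j hl₀ hU₀ hU _ (resO h' u • res inf_le_left s)]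
  · rw [j.emb_smul, j.emb_res, value_resO]
  · rw [res_tmulSection, res_res]
    have := congrArg (res h') hu
    rw [res_res, res_smul, res_res] at this
    rw [this, tmulSection_smul]

/-- The embedding into `K` of the tensor product with an invertible sheaf. -/
def tensorEmbedding (hL : IsInvertible L) : GenericEmbedding κ (tensorSheaf M L) where
  emb := tensorEmb j hl₀ hU₀
  emb_res := tensorEmb_res j hl₀ hU₀
  emb_smul := by
    intro U hU r t
    obtain ⟨s, hs⟩ := exists_res_eq_tmulSection hl₀ t
    rw [tensorEmb_eq j hl₀ hU₀ hU t s hs,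
      tensorEmb_eq j hl₀ hU₀ hU (r • t) (resO (inf_le_left : U ⊓ U₀ ≤ U) r • s), j.emb_smul,
      value_resO]
    rw [res_smul, hs, smul_tmulSection]
  emb_injective := by
    intro U hU
    rw [injective_iff_map_eq_zero]
    intro t ht
    -- The point `y` may lie outside `U₀`, so a generator `l` near `y` replaces `l₀`; this changes
    -- values only by the non-zero factor `u`.
    refine section_ext fun y hy => ?_
    obtain ⟨V, hyV, hV⟩ := hL y
    obtain ⟨l, hl⟩ := exists_isGenerator hV
    have hη : genericPoint Y ∈ U ⊓ V := genericPoint_mem (mem_inf_opens hy hyV)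
    obtain ⟨u, hu, hu0⟩ := exists_unit_of_isGenerator (κ := κ) hl hl₀ (mem_inf_opens hη.2 hU₀)
    refine ⟨U ⊓ V, inf_le_left, mem_inf_opens hy hyV, ?_⟩
    obtain ⟨s, hs⟩ := exists_res_eq_tmulSection hl t
    have h1 := tensorEmb_tmulSection j hl₀ hU₀ hη inf_le_right u hu s
    rw [← hs, tensorEmb_res, ht, eq_comm, mul_eq_zero, or_iff_right hu0] at h1
    rw [hs, j.emb_injective hη (h1.trans (map_zero _).symm), map_zero, tmulSection,
      TensorProduct.zero_tmul, map_zero]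

/-- Near `y` every section is some `s ⊗ l`, so twisting by an invertible sheaf amounts locally to
rescaling by the transition function `u`. -/
lemma mem_stalkImage_tensorEmbedding (hL : IsInvertible L) {V : Y.Opens} {l : Γ(L, V)}
    (hl : IsGenerator l) (hη : genericPoint Y ∈ V ⊓ U₀) (u : Γ(Y, V ⊓ U₀))
    (hu : res inf_le_left l = u • res inf_le_right l₀) {y : Y} (hy : y ∈ V) (x : K) :
    x ∈ (tensorEmbedding j hl₀ hU₀ hL).stalkImage y ↔
      ∃ z ∈ j.stalkImage y, x = value κ hη u * z := by
  constructor
  · rintro ⟨U, hyU, t, rfl⟩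
    obtain ⟨s, hs⟩ := exists_res_eq_tmulSection hl t
    refine ⟨_, ⟨U ⊓ V, mem_inf_opens hyU hy, s, rfl⟩, ?_⟩
    rw [← (tensorEmbedding j hl₀ hU₀ hL).emb_res (inf_le_left : U ⊓ V ≤ U)
      (genericPoint_mem (mem_inf_opens hyU hy)), hs]
    exact tensorEmb_tmulSection j hl₀ hU₀ _ inf_le_right u hu s
  · rintro ⟨_, ⟨U, hyU, s, rfl⟩, rfl⟩
    refine ⟨U ⊓ V, mem_inf_opens hyU hy, tmulSection (res inf_le_left s) (res inf_le_right l), ?_⟩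
    rw [← j.emb_res (inf_le_left : U ⊓ V ≤ U) (genericPoint_mem (mem_inf_opens hyU hy))]
    exact tensorEmb_tmulSection j hl₀ hU₀ _ inf_le_right u hu _

lemma tensorEmb_map (φ : End M) {f : K → K}
    (hφ : ∀ (U : Y.Opens) (hU : genericPoint Y ∈ U) (s : Γ(M, U)),
      j.emb U hU (Scheme.Modules.Hom.app φ U s) = f (j.emb U hU s))
    (U : Y.Opens) (hU : genericPoint Y ∈ U) (t : Γ(tensorSheaf M L, U)) :
    tensorEmb j hl₀ hU₀ U hU ((tensorSheafMap φ L).app U t) = f (tensorEmb j hl₀ hU₀ U hU t) := by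
  obtain ⟨s, hs⟩ := exists_res_eq_tmulSection hl₀ t
  rw [tensorEmb_eq j hl₀ hU₀ hU t s hs, tensorEmb_eq j hl₀ hU₀ hU _ (Scheme.Modules.Hom.app φ _ s),
    hφ]
  rw [← app_res, hs, tensorSheafMap_tmulSection]

end TensorEmbedding

end Generic

/-! ### The subsheaf of `K` cut out by subgroups `N y` -/

section SubSheaf

variable {Y : Scheme.{0}} [IsIntegral Y] {K : Type} [Field K] {κ : Y.functionField →+* K}

/-- Constant functions on `U` with values in `N y` at each `y ∈ U`. -/
def constSections (N : Y → AddSubgroup K) (U : Y.Opens) : AddSubgroup (U → K) where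
  carrier := {f | (∀ y z, f y = f z) ∧ ∀ y, f y ∈ N y.1}
  zero_mem' := ⟨fun _ _ => rfl, fun _ => zero_mem _⟩
  add_mem' ha hb := ⟨fun y z => congrArg₂ (· + ·) (ha.1 y z) (hb.1 y z),
    fun y => add_mem (ha.2 y) (hb.2 y)⟩
  neg_mem' ha := ⟨fun y z => congrArg Neg.neg (ha.1 y z), fun y => neg_mem (ha.2 y)⟩

/-- The presheaf of constant functions with values in the subgroups `N y`. -/
def constPresheaf (N : Y → AddSubgroup K) : TopCat.Presheaf Ab Y where
  obj U := AddCommGrpCat.of (constSections N U.unop)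
  map {U V} i := AddCommGrpCat.ofHom
    { toFun := fun f => ⟨fun y => f.1 ⟨y.1, i.unop.le y.2⟩,
        fun y z => f.2.1 _ _, fun y => f.2.2 ⟨y.1, i.unop.le y.2⟩⟩
      map_zero' := rfl
      map_add' := fun _ _ => rfl }

/-- Taking functions on `U`, rather than elements of `K`, leaves a single section over the empty
set, as a sheaf requires. -/
lemma constPresheaf_isSheaf (N : Y → AddSubgroup K) : (constPresheaf N).IsSheaf := by
  rw [TopCat.Presheaf.isSheaf_iff_isSheaf_comp (forget Ab),
    TopCat.Presheaf.isSheaf_iff_isSheafUniqueGluing_types]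
  intro ι U sf hsf
  let f : ∀ i, constSections N (U i) := sf
  have hf : ∀ i k (y : Y) (hi : y ∈ U i) (hk : y ∈ U k), (f i).1 ⟨y, hi⟩ = (f k).1 ⟨y, hk⟩ := by
    intro i k y hi hk
    exact congrFun (congrArg Subtype.val (hsf i k)) ⟨y, mem_inf_opens hi hk⟩
  have hU : ∀ y : (iSup U : Y.Opens), ∃ i, y.1 ∈ U i := fun y => Opens.mem_iSup.mp y.2
  choose i hi using hU
  let g : constSections N (iSup U) :=
    ⟨fun y => (f (i y)).1 ⟨y.1, hi y⟩, fun y z => by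
      -- The glued function is constant because any two non-empty members of the cover meet in the
      -- generic point.
      have h1 := genericPoint_mem (hi y)
      have h2 := genericPoint_mem (hi z)
      exact ((f (i y)).2.1 _ ⟨_, h1⟩).trans ((hf _ _ _ h1 h2).trans ((f (i z)).2.1 _ _)),
      fun y => (f (i y)).2.2 ⟨y.1, hi y⟩⟩
  refine ⟨g, fun k => Subtype.ext (funext fun y => hf _ _ _ _ _), fun g' hg' => ?_⟩
  refine Subtype.ext (funext fun y => ?_)
  exact congrFun (congrArg Subtype.val (hg' (i y))) ⟨y.1, hi y⟩

variable (κ) in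
/-- The module structure on constant functions with values in `N y` at each `y`. -/
@[reducible]
def subSheafModule (N : Y → AddSubgroup K)
    (hN : ∀ y, ∀ a ∈ localSubring κ y, ∀ x ∈ N y, a * x ∈ N y) (U : Y.Opens) :
    Module Γ(Y, U) (constSections N U) where
  smul r f := ⟨fun y => value κ (genericPoint_mem y.2) r * f.1 y,
    fun y z => congrArg _ (f.2.1 y z),
    fun y => hN _ _ (value_mem_localSubring y.2 r) _ (f.2.2 y)⟩
  one_smul f := Subtype.ext (funext fun y => by
    change value κ _ 1 * f.1 y = f.1 y
    rw [map_one, one_mul])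
  mul_smul r s f := Subtype.ext (funext fun y => by
    change value κ _ (r * s) * f.1 y = value κ _ r * (value κ _ s * f.1 y)
    rw [map_mul, mul_assoc])
  smul_zero r := Subtype.ext (funext fun y => mul_zero _)
  smul_add r f g := Subtype.ext (funext fun y => mul_add _ _ _)
  add_smul r s f := Subtype.ext (funext fun y => by
    change value κ _ (r + s) * f.1 y = value κ _ r * f.1 y + value κ _ s * f.1 y
    rw [map_add, add_mul])
  zero_smul f := Subtype.ext (funext fun y => by
    change value κ _ 0 * f.1 y = 0
    rw [map_zero, zero_mul])

variable (κ) in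
/-- The subsheaf of modules of the constant sheaf `K` with stalk contained in `N y` at each `y`. -/
def subSheaf (N : Y → AddSubgroup K)
    (hN : ∀ y, ∀ a ∈ localSubring κ y, ∀ x ∈ N y, a * x ∈ N y) : Y.Modules :=
  letI : ∀ U, Module (Y.ringCatSheaf.obj.obj U) ((constPresheaf N).obj U) :=
    fun U => subSheafModule κ N hN U.unop
  SheafOfModules.mk (PresheafOfModules.ofPresheaf (constPresheaf N) (by
    intro U V i r f
    refine Subtype.ext (funext fun y => ?_)
    exact congrArg₂ (· * ·) (value_resO (κ := κ) i.unop.le (genericPoint_mem y.2) r).symm rfl))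
    (constPresheaf_isSheaf N)

variable (κ) in
/-- The tautological embedding of a subsheaf of `K`. -/
def subSheafEmbedding (N : Y → AddSubgroup K)
    (hN : ∀ y, ∀ a ∈ localSubring κ y, ∀ x ∈ N y, a * x ∈ N y) :
    GenericEmbedding κ (subSheaf κ N hN) where
  emb U hU := (Pi.evalAddMonoidHom (fun _ : U => K) ⟨_, hU⟩).comp (constSections N U).subtype
  emb_res h hV s := rfl
  emb_smul hU r s := rfl
  emb_injective {U} hU f g hfg := Subtype.ext (funext fun y => by
    have h1 : (f : constSections N U).1 ⟨_, hU⟩ = (g : constSections N U).1 ⟨_, hU⟩ := hfg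
    exact ((f : constSections N U).2.1 _ _).trans (h1.trans ((g : constSections N U).2.1 _ _)))

variable {N : Y → AddSubgroup K} {hN : ∀ y, ∀ a ∈ localSubring κ y, ∀ x ∈ N y, a * x ∈ N y}

lemma exists_subSheaf_section {U : Y.Opens} (hU : genericPoint Y ∈ U) {x : K}
    (hx : ∀ y ∈ U, x ∈ N y) :
    ∃ s : Γ(subSheaf κ N hN, U), (subSheafEmbedding κ N hN).emb U hU s = x :=
  ⟨(⟨fun _ => x, fun _ _ => rfl, fun y => hx y.1 y.2⟩ : constSections N U), rfl⟩

/-- The stalk may be smaller than `N y`: membership has to persist on a neighbourhood. -/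
lemma mem_stalkImage_subSheaf {y : Y} {x : K} :
    x ∈ (subSheafEmbedding κ N hN).stalkImage y ↔ ∃ U : Y.Opens, y ∈ U ∧ ∀ z ∈ U, x ∈ N z := by
  constructor
  · rintro ⟨U, hy, s, rfl⟩
    refine ⟨U, hy, fun z hz => ?_⟩
    have h1 : (s : constSections N U).1 ⟨z, hz⟩ =
        (subSheafEmbedding κ N hN).emb U (genericPoint_mem hy) s :=
      (s : constSections N U).2.1 ⟨z, hz⟩ ⟨_, genericPoint_mem hy⟩
    rw [← h1]
    exact (s : constSections N U).2.2 ⟨z, hz⟩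
  · rintro ⟨U, hy, hx⟩
    obtain ⟨s, hs⟩ := exists_subSheaf_section (hN := hN) (genericPoint_mem hy) hx
    exact ⟨U, hy, s, hs⟩

end SubSheaf

/-! ### Commutative algebra: regularity in codimension one, normality of smooth algebras -/

section CommutativeAlgebra

/-- The ideal of denominators of an element of an algebra. -/
def denominatorIdeal (A : Type*) {K : Type*} [CommRing A] [CommRing K] [Algebra A K] (x : K) :
    Ideal A where
  carrier := {a | ∃ b, a • x = algebraMap A K b}
  zero_mem' := ⟨0, by simp⟩
  add_mem' := by
    rintro a a' ⟨b, hb⟩ ⟨b', hb'⟩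
    exact ⟨b + b', by rw [add_smul, hb, hb', map_add]⟩
  smul_mem' := by
    rintro c a ⟨b, hb⟩
    exact ⟨c * b, by rw [smul_assoc, hb, map_mul, Algebra.smul_def]⟩

lemma mem_denominatorIdeal {A : Type*} {K : Type*} [CommRing A] [CommRing K] [Algebra A K] {x : K}
    {a : A} : a ∈ denominatorIdeal A x ↔ ∃ b, a • x = algebraMap A K b := Iff.rfl

lemma mem_range_of_denominatorIdeal_eq_top {A : Type*} {K : Type*} [CommRing A] [CommRing K]
    [Algebra A K] {x : K} (h : denominatorIdeal A x = ⊤) : ∃ b, algebraMap A K b = x := by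
  obtain ⟨b, hb⟩ := mem_denominatorIdeal.mp ((Ideal.eq_top_iff_one _).mp h)
  exact ⟨b, by rw [← hb, one_smul]⟩

/-- In a Noetherian normal domain, an element of the fraction field which is regular in codimension
one is regular. -/
lemma exists_algebraMap_eq_of_height_one {A K : Type*} [CommRing A] [IsDomain A]
    [IsNoetherianRing A] [IsIntegrallyClosed A] [Field K] [Algebra A K] [IsFractionRing A K] (h : K)
    (H : ∀ p : Ideal A, p.IsPrime → p.height = 1 → ¬ denominatorIdeal A h ≤ p) :
    ∃ b, algebraMap A K b = h := by
  by_contra hcon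
  let M := K ⧸ LinearMap.range (Algebra.linearMap A K)
  let π : K →ₗ[A] M := Submodule.mkQ _
  have hπ : ∀ x : K, π x = 0 ↔ ∃ b, algebraMap A K b = x := fun x => by
    rw [Submodule.mkQ_apply, Submodule.Quotient.mk_eq_zero]; rfl
  have hh : π h ≠ 0 := fun h0 => hcon ((hπ h).mp h0)
  -- An associated prime of `K / A`: it contains all denominators of `h` and is the annihilator of
  -- the class of some `x ∉ A`. It remains to see that its height is one.
  obtain ⟨p, hp, hle⟩ := exists_le_isAssociatedPrime_of_isNoetherianRing A (π h) hh
  have hpp := hp.1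
  obtain ⟨-, m, hm⟩ := (isAssociatedPrime_iff_exists_injective_linearMap p M).mp hp
  obtain ⟨x, hx⟩ := Submodule.mkQ_surjective _ (m (Ideal.Quotient.mk p 1))
  change π x = _ at hx
  have hann : ∀ a : A, a ∈ p ↔ ∃ b, algebraMap A K b = a • x := by
    intro a
    rw [← hπ, map_smul, hx, ← map_smul]
    constructor
    · intro ha
      have : a • (Ideal.Quotient.mk p 1 : A ⧸ p) = 0 := by
        rw [Algebra.smul_def]
        simpa using Ideal.Quotient.eq_zero_iff_mem.mpr ha
      rw [this, map_zero]
    · intro ha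
      have := hm (ha.trans (map_zero m).symm)
      rw [Algebra.smul_def] at this
      exact Ideal.Quotient.eq_zero_iff_mem.mp (by simpa using this)
  have hxA : ¬ ∃ b, algebraMap A K b = x := by
    intro hb
    have : (1 : A) ∈ p := (hann 1).mpr (by rwa [one_smul])
    exact hpp.ne_top ((Ideal.eq_top_iff_one _).mpr this)
  have hdp : denominatorIdeal A h ≤ p := by
    rintro a ⟨b, hb⟩
    refine hle ?_
    rw [Submodule.mem_colon_singleton, Submodule.mem_bot, ← map_smul, hπ]
    exact ⟨b, hb.symm⟩
  have hpbot : p ≠ ⊥ := by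
    obtain ⟨a, b, hb, hab⟩ := IsFractionRing.div_surjective (A := A) h
    intro h0
    have : b ∈ p := hdp ⟨a, by
      rw [← hab, Algebra.smul_def, mul_div_cancel₀]
      exact IsFractionRing.to_map_ne_zero_of_mem_nonZeroDivisors hb⟩
    rw [h0] at this
    exact nonZeroDivisors.ne_zero hb this
  refine H p hpp ?_ hdp
  -- If `px ⊆ p`, then `x` stabilises a non-zero finitely generated submodule of `K`, so it is
  -- integral over `A` and lies in `A` by normality.
  by_cases hJ : ∀ a ∈ p, ∃ b ∈ p, algebraMap A K b = a • x
  · exfalso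
    refine hxA (IsIntegrallyClosed.isIntegral_iff.mp ?_)
    refine isIntegral_of_smul_mem_submodule (Submodule.map (Algebra.linearMap A K) p) ?_ ?_ x ?_
    · intro h0
      obtain ⟨a, ha, ha0⟩ := Submodule.exists_mem_ne_zero_of_ne_bot hpbot
      have : algebraMap A K a ∈ Submodule.map (Algebra.linearMap A K) p := ⟨a, ha, rfl⟩
      rw [h0, Submodule.mem_bot] at this
      exact ha0 ((map_eq_zero_iff _ (IsFractionRing.injective A K)).mp this)
    · exact Submodule.FG.map _ (IsNoetherian.noetherian p)
    · rintro _ ⟨a, ha, rfl⟩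
      obtain ⟨b, hb, hba⟩ := hJ a ha
      exact ⟨b, hb, hba.trans (by rw [Algebra.smul_def, smul_eq_mul, mul_comm]; rfl)⟩
  · push Not at hJ
    obtain ⟨p₀, hp₀, hu⟩ := hJ
    obtain ⟨u, hux⟩ := (hann p₀).mp hp₀
    have hup : u ∉ p := fun h => hu u h hux
    -- Otherwise `u = p₀ x` lies outside `p`, and `a u = p₀ (a x)` for `a ∈ p` puts `a` in every
    -- prime between `(p₀)` and `p`. Krull's principal ideal theorem then bounds the height.
    have hmin : p ∈ (Ideal.span {p₀}).minimalPrimes := by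
      refine ⟨⟨hpp, (Ideal.span_singleton_le_iff_mem _).mpr hp₀⟩, fun q hq hqp a ha => ?_⟩
      obtain ⟨v, hv⟩ := (hann a).mp ha
      have hmul : a * u = p₀ * v := by
        apply IsFractionRing.injective A K
        rw [map_mul, map_mul, hux, hv, Algebra.smul_def, Algebra.smul_def]
        ring
      have : a * u ∈ q := by
        rw [hmul]
        exact q.mul_mem_right _ (hq.2 (Ideal.mem_span_singleton_self _))
      exact (hq.1.mem_or_mem this).resolve_right fun h => hup (hqp h)
    refine le_antisymm (Ideal.height_le_one_of_isPrincipal_of_mem_minimalPrimes _ p hmin) ?_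
    rw [Order.one_le_iff_ne_zero, Ne, Ideal.height_eq_zero_iff,
      IsDomain.minimalPrimes_eq_singleton_bot]
    exact hpbot

/-- A domain which is étale over a normal domain is normal. -/
lemma isIntegrallyClosed_of_etale (P A : Type) [CommRing P] [IsDomain P] [IsIntegrallyClosed P]
    [CommRing A] [IsDomain A] [Algebra P A] [Algebra.Etale P A] : IsIntegrallyClosed A := by
  let F := FractionRing P
  let B := A ⊗[P] F
  have hinj : Function.Injective (algebraMap P A) := by
    rw [injective_iff_map_eq_zero]
    intro a ha
    by_contra h0
    -- By flatness, multiplication by `a ≠ 0` stays injective after tensoring with `A`; it would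
    -- kill `1 ⊗ 1` if `a` mapped to zero.
    have hflat : Module.Flat P A := inferInstance
    have h1 : Function.Injective (LinearMap.lTensor A (LinearMap.mulLeft P a)) :=
      Module.Flat.lTensor_preserves_injective_linearMap _ (mul_right_injective₀ h0)
    have h2 : LinearMap.lTensor A (LinearMap.mulLeft P a) (1 ⊗ₜ 1) = 0 := by
      rw [LinearMap.lTensor_tmul, LinearMap.mulLeft_apply, mul_one,
        show a = a • (1 : P) by simp, ← TensorProduct.smul_tmul, Algebra.smul_def, ha, zero_mul,
        TensorProduct.zero_tmul]
    have h3 := h1 (h2.trans (map_zero _).symm)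
    have h4 := congrArg (TensorProduct.rid P A) h3
    simp at h4
  have hM : Algebra.algebraMapSubmonoid A (nonZeroDivisors P) ≤ nonZeroDivisors A := by
    rintro _ ⟨p, hp, rfl⟩
    exact mem_nonZeroDivisors_of_ne_zero
      ((map_ne_zero_iff _ hinj).mpr (nonZeroDivisors.ne_zero hp))
  -- `B` is a localization of the domain `A`, and it is finite over the field `F`, being unramified
  -- over it. A domain finite over a field is a field, so `B` is the fraction field of `A`.
  have hloc : IsLocalization (Algebra.algebraMapSubmonoid A (nonZeroDivisors P)) B := inferInstance
  have hBdom : IsDomain B := IsLocalization.isDomain_of_le_nonZeroDivisors B hM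
  have hfin : Module.Finite F (F ⊗[P] A) := Algebra.FormallyUnramified.finite_of_free F _
  have e : F ⊗[P] A ≃+* B := (Algebra.TensorProduct.comm P F A).toRingEquiv
  have hdom' : IsDomain (F ⊗[P] A) := e.toMulEquiv.isDomain
  have hfield' : IsField (F ⊗[P] A) :=
    isField_of_isIntegral_of_isField' (R := F) (Field.toIsField F)
  have hfield : IsField B := e.symm.toMulEquiv.isField hfield'
  let : Field B := hfield.toField
  have hfaith : FaithfulSMul A B := (faithfulSMul_iff_algebraMap_injective A B).mpr
    (IsLocalization.injective B hM)
  have hfrac : IsFractionRing A B := by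
    refine IsFractionRing.of_field A B fun z => ?_
    obtain ⟨x, y, rfl⟩ := IsLocalization.exists_mk'_eq
      (Algebra.algebraMapSubmonoid A (nonZeroDivisors P)) z
    refine ⟨x, y, ?_⟩
    rw [eq_div_iff]
    · exact IsLocalization.mk'_spec _ _ _
    · exact (map_ne_zero_iff _ (IsLocalization.injective B hM)).mpr
        (nonZeroDivisors.ne_zero (hM y.2))
  rw [isIntegrallyClosed_iff B]
  intro x hx
  -- Integral closure commutes with smooth base change: an element of `A ⊗ F` integral over `A`
  -- comes from `A` tensored with the integral closure of `P` in `F`, which is `P`.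
  obtain ⟨t, ht⟩ := (TensorProduct.toIntegralClosure_bijective_of_smooth (R := P) (S := A)
    (B := F)).2 ⟨x, hx⟩
  have ht' := congrArg Subtype.val ht
  change _ = x at ht'
  rw [← ht']
  clear ht ht' hx
  induction t using TensorProduct.induction_on with
  | zero => exact ⟨0, by simp⟩
  | add s t hs ht =>
    obtain ⟨a, ha⟩ := hs
    obtain ⟨b, hb⟩ := ht
    exact ⟨a + b, by rw [map_add, ha, hb, map_add]; rfl⟩
  | tmul a b =>
    obtain ⟨p, hp⟩ := IsIntegrallyClosed.isIntegral_iff.mp b.2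
    refine ⟨p • a, ?_⟩
    change (p • a) ⊗ₜ[P] (1 : F) = a ⊗ₜ[P] (b : F)
    rw [TensorProduct.smul_tmul, ← hp, Algebra.smul_def, mul_one]

/-- A domain which is smooth over a field is normal. -/
lemma isIntegrallyClosed_of_smooth (k A : Type) [Field k] [CommRing A] [IsDomain A] [Algebra k A]
    [Algebra.Smooth k A] : IsIntegrallyClosed A := by
  let K := FractionRing A
  rw [isIntegrallyClosed_iff K]
  intro x hx
  apply mem_range_of_denominatorIdeal_eq_top
  by_contra hne
  -- Near `m` the algebra is étale over a polynomial ring, so `A_f` is normal for some `f ∉ m`. Then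
  -- `x ∈ A_f`, and a power of `f` is a denominator of `x` outside `m`.
  obtain ⟨m, hm, hle⟩ := Ideal.exists_le_maximal _ hne
  obtain ⟨f, hfm, n, _, _, _⟩ :=
    Algebra.IsSmoothAt.exists_isStandardEtale_mvPolynomial (R := k) (p := m)
  have hf0 : f ≠ 0 := fun h => hfm (h ▸ m.zero_mem)
  have hM : Submonoid.powers f ≤ nonZeroDivisors A :=
    powers_le_nonZeroDivisors_of_noZeroDivisors hf0
  have : IsDomain (Localization.Away f) := IsLocalization.isDomain_localization hM
  have : IsIntegrallyClosed (Localization.Away f) :=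
    isIntegrallyClosed_of_etale (MvPolynomial (Fin n) k) _
  have hM' : Submonoid.powers f ≤ (nonZeroDivisors A).comap (RingHom.id A) := hM
  let : Algebra (Localization.Away f) K :=
    (IsLocalization.map K (RingHom.id A) hM' :
      Localization.Away f →+* K).toAlgebra
  have hst : IsScalarTower A (Localization.Away f) K :=
    IsScalarTower.of_algebraMap_eq fun a =>
      (IsLocalization.map_eq (S := Localization.Away f) (Q := K)
      hM' a).symm
  have : IsFractionRing (Localization.Away f) K :=
    IsFractionRing.isFractionRing_of_isDomain_of_isLocalization (Submonoid.powers f) _ _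
  obtain ⟨y, hy⟩ := IsIntegrallyClosed.isIntegral_iff.mp (hx.tower_top (A := Localization.Away f))
  obtain ⟨a, ⟨s, k, rfl⟩, hs⟩ := IsLocalization.exists_mk'_eq (Submonoid.powers f) y
  have h1 : f ^ k ∈ denominatorIdeal A x := by
    refine ⟨a, ?_⟩
    rw [← hy, ← hs, Algebra.smul_def, IsScalarTower.algebraMap_apply A (Localization.Away f) K,
      ← map_mul, mul_comm, IsLocalization.mk'_spec, ← IsScalarTower.algebraMap_apply]
  exact hfm (hm.isPrime.mem_of_pow_mem k (hle h1))

end CommutativeAlgebra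

/-! ### Points of codimension one and orders of rational functions -/

section CodimensionOne

/-- In an irreducible Noetherian scheme, only finitely many points of codimension one lie outside
a given non-empty open set. -/
lemma finite_coheight_eq_one_notMem {Y : Scheme.{0}} [IsIntegral Y] [NoetherianSpace Y]
    {W : Y.Opens} (hW : genericPoint Y ∈ W) :
    {y : Y | Order.coheight y = 1 ∧ y ∉ W}.Finite := by
  obtain ⟨T, hT, hTcl, hTirr, hZ⟩ :=
    NoetherianSpace.exists_finite_set_isClosed_irreducible W.isOpen.isClosed_compl
  have hgen : ∀ C ∈ T, ∃ q : Y, IsGenericPoint q C := fun C hC =>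
    QuasiSober.sober (hTirr C hC) (hTcl C hC)
  classical
  let q : Set Y → Y := fun C => if h : ∃ q : Y, IsGenericPoint q C then h.choose else genericPoint Y
  refine (hT.image q).subset ?_
  rintro P ⟨hP, hPW⟩
  have hPZ : P ∈ ((W : Set Y)ᶜ) := hPW
  rw [hZ] at hPZ
  obtain ⟨C, hC, hPC⟩ := hPZ
  refine ⟨C, hC, ?_⟩
  have hq : IsGenericPoint (q C) C := by
    have h := hgen C hC
    simp only [q, dif_pos h]
    exact h.choose_spec
  have hle : P ≤ q C := hq.specializes hPC
  -- If `P` were not the generic point of its irreducible closed piece `C`, then `P < q C <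
  -- genericPoint Y` would give `P` codimension at least two.
  by_contra hne
  have hlt : P < q C := by
    refine lt_of_le_not_ge hle fun h => hne ?_
    exact (hq.specializes hPC).antisymm h |>.eq
  have hqW : q C ∉ W := by
    have : q C ∈ ((W : Set Y)ᶜ) := by
      rw [hZ]
      exact ⟨C, hC, hq.mem⟩
    exact this
  have hlt' : q C < genericPoint Y := by
    refine lt_of_le_not_ge (genericPoint_specializes _) fun h => hqW ?_
    exact (show q C ⤳ genericPoint Y from h).mem_open W.2 hW
  have h1 := Order.coheight_add_one_le hlt
  have h2 := Order.coheight_add_one_le hlt'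
  rw [hP] at h1
  have h3 : (1 : ℕ∞) + 1 ≤ 1 := by
    refine le_trans ?_ h1
    gcongr
    exact le_trans (by simp) h2
  exact absurd h3 (by decide)

/-- A rational function of order zero at all points of codimension one near `y` is regular at `y`
if the scheme is normal near `y`. -/
lemma mem_range_stalk_of_ord_eq_zero {Y : Scheme.{0}} [IsIntegral Y] [IsLocallyNoetherian Y]
    (hnorm : ∀ U : Y.Opens, IsAffineOpen U → Nonempty U → IsIntegrallyClosed Γ(Y, U))
    {V : Y.Opens} {h : Y.functionField} (hh : h ≠ 0)
    (H : ∀ P ∈ V, Order.coheight P = 1 → Scheme.ord h P = 0) {y : Y} (hy : y ∈ V) :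
    ∃ a : Y.presheaf.stalk y, algebraMap _ Y.functionField a = h := by
  obtain ⟨_, ⟨U, hU, rfl⟩, hyU, hUV⟩ := Y.isBasis_affineOpens.exists_subset_of_mem_open hy V.isOpen
  have hne : Nonempty U := ⟨⟨y, hyU⟩⟩
  have := hnorm U hU hne
  have := functionField_isFractionRing_of_isAffineOpen (X := Y) U hU
  have : IsNoetherianRing Γ(Y, U) := IsLocallyNoetherian.component_noetherian ⟨U, hU⟩
  obtain ⟨b, hb⟩ := exists_algebraMap_eq_of_height_one (A := Γ(Y, U)) h (by
    intro p hp hp1 hle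
    let x : PrimeSpectrum Γ(Y, U) := ⟨p, hp⟩
    let P : Y := hU.fromSpec x
    have hPU : P ∈ U := by
      rw [← SetLike.mem_coe, ← hU.range_fromSpec]
      exact ⟨x, rfl⟩
    let : Algebra Γ(Y, U) (Y.presheaf.stalk P) := (Y.presheaf.germ U P hPU).hom.toAlgebra
    have hloc : IsLocalization.AtPrime (Y.presheaf.stalk P) p := hU.isLocalization_stalk' x hPU
    have htower : IsScalarTower Γ(Y, U) (Y.presheaf.stalk P) Y.functionField :=
      functionField_isScalarTower Y U ⟨P, hPU⟩
    have hdim := IsLocalization.AtPrime.ringKrullDim_eq_height p (Y.presheaf.stalk P)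
    rw [hp1, ringKrullDim_stalk_eq_coheight] at hdim
    have hP1 : Order.coheight P = 1 := by exact_mod_cast hdim
    have : IsIntegrallyClosed (Y.presheaf.stalk P) :=
      isIntegrallyClosed_of_isLocalization _ p.primeCompl p.primeCompl_le_nonZeroDivisors
    have hk : Ring.KrullDimLE 1 (Y.presheaf.stalk P) := krullDimLE_of_coheight_le hP1.le
    have hnf : ¬ IsField (Y.presheaf.stalk P) := fun hf => by
      have h0 := ringKrullDim_eq_zero_of_isField hf
      rw [ringKrullDim_stalk_eq_coheight, hP1] at h0
      exact absurd h0 (by decide)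
    -- Normal, Noetherian and of dimension one; the criterion used asks for a unique non-zero prime.
    have : IsDiscreteValuationRing (Y.presheaf.stalk P) := by
      have key : IsDiscreteValuationRing (Y.presheaf.stalk P) ↔
          IsIntegrallyClosed (Y.presheaf.stalk P) ∧
            ∃! Q : Ideal (Y.presheaf.stalk P), Q ≠ ⊥ ∧ Q.IsPrime :=
        (IsDiscreteValuationRing.TFAE (Y.presheaf.stalk P) hnf).out 0 3
      refine key.mpr ⟨inferInstance,
        IsLocalRing.maximalIdeal _, ⟨?_, inferInstance⟩, ?_⟩
      · exact fun h => hnf (IsLocalRing.isField_iff_maximalIdeal_eq.mpr h)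
      · rintro Q ⟨hQ, hQp⟩
        exact IsLocalRing.eq_maximalIdeal (hQp.isMaximal_of_ne_bot hQ)
    -- In a discrete valuation ring the elements of trivial order are the units. So `h = c / s` with
    -- `s ∉ p`, and `s` is a denominator of `h` outside `p`.
    have hord : Ring.ordFrac (Y.presheaf.stalk P) h = 1 :=
      (Scheme.ord_eq_iff hP1 hh (n := 0)).mp (H P (hUV hPU) hP1)
    have hmem : h ∈ MonoidHom.mker (Ring.ordFrac (K := Y.functionField) (Y.presheaf.stalk P)) := hord
    rw [Ring.mker_ordFrac_eq_isUnitSubmonoid] at hmem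
    obtain ⟨a, -, ha⟩ := hmem
    obtain ⟨c, s, rfl⟩ := IsLocalization.exists_mk'_eq p.primeCompl a
    refine s.2 (hle ⟨c, ?_⟩)
    rw [← ha, Algebra.smul_def, IsScalarTower.algebraMap_apply _ (Y.presheaf.stalk P)]
    rw [← map_mul, mul_comm, IsLocalization.mk'_spec, ← IsScalarTower.algebraMap_apply])
  exact ⟨Y.presheaf.germ U y hyU b, by
    rw [Scheme.algebraMap_germ_eq_germToFunctionField]; exact hb⟩

lemma ord_eq_zero_of_isUnit_stalk {Y : Scheme.{0}} [IsIntegral Y] [IsLocallyNoetherian Y]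
    {y : Y} {a : Y.presheaf.stalk y} (ha : IsUnit a) :
    Scheme.ord (algebraMap _ Y.functionField a) y = 0 := by
  by_cases hy : Order.coheight y = 1
  · have : Ring.KrullDimLE 1 (Y.presheaf.stalk y) := krullDimLE_of_coheight_le hy.le
    have hne : algebraMap _ Y.functionField a ≠ 0 := (ha.map _).ne_zero
    rw [Scheme.ord_eq_iff hy hne]
    exact Ring.ordFrac_of_isUnit ha
  · exact Scheme.ord_eq_zero_of_coheight_neq_one hy _

end CodimensionOne

/-! ### The resolution is normal and Noetherian -/

section Resolution

variable {n : ℕ} {G : Type*} [CommGroup G] {ρ : G →* GL (Fin n) ℂ} (S : Resolution ρ)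

lemma Resolution.isIntegrallyClosed_sections (U : S.Y.Opens) (hU : IsAffineOpen U)
    (hne : Nonempty U) : IsIntegrallyClosed Γ(S.Y, U) := by
  have hs : Smooth (S.π ≫ quotientOver ρ) := S.smooth
  have h := Scheme.Hom.smooth_appLE (S.π ≫ quotientOver ρ) (isAffineOpen_top (Spec (.of ℂ))) hU le_top
  let φ : ℂ →+* Γ(S.Y, U) := (((S.π ≫ quotientOver ρ).appLE ⊤ U le_top).hom).comp
    (Scheme.ΓSpecIso (.of ℂ)).inv.hom
  have hφ : φ.Smooth := 
    (RingHom.Smooth.of_bijective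
      (ConcreteCategory.bijective_of_isIso (Scheme.ΓSpecIso (.of ℂ)).inv)).comp h
  algebraize [φ]
  exact isIntegrallyClosed_of_smooth ℂ Γ(S.Y, U)

/-- `Y` is locally Noetherian and quasi-compact, being proper over an affine scheme. This makes the
divisors constructed below finite sums. -/
instance : NoetherianSpace S.Y := by
  have := S.isProper
  have : CompactSpace S.Y := QuasiCompact.compactSpace_of_compactSpace S.π
  have : IsNoetherian S.Y := {}
  infer_instance

end Resolution

/-! ### The decomposition of `K(ℂⁿ)` into weight spaces over `K(Y)` -/

section Weights

variable {n : ℕ} {G : Type*} [CommGroup G] {ρ : G →* GL (Fin n) ℂ}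

/-- The constant rational functions. -/
def constRat (n : ℕ) : ℂ →+* RatField n :=
  (algebraMap (PolyRing n) (RatField n)).comp MvPolynomial.C

lemma constRat_apply (c : ℂ) :
    constRat n c = algebraMap (PolyRing n) (RatField n) (MvPolynomial.C c) := rfl

lemma ratAct_algebraMap (g : G) (p : PolyRing n) :
    ratAct ρ g (algebraMap _ _ p) = algebraMap _ (RatField n) (polyAct ρ g p) :=
  IsFractionRing.ringEquivOfRingEquiv_algebraMap _ _

lemma ratAct_constRat (g : G) (c : ℂ) : ratAct ρ g (constRat n c) = constRat n c := by
  rw [constRat_apply, ratAct_algebraMap]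
  simp [MvPolynomial.algHom_C]

lemma ratAct_mul (g h : G) (x : RatField n) :
    ratAct ρ (g * h) x = ratAct ρ g (ratAct ρ h x) := by
  obtain ⟨a, b, -, rfl⟩ := IsFractionRing.div_surjective (A := PolyRing n) x
  simp [ratAct_algebraMap, map_div₀]

lemma ratAct_one (x : RatField n) : ratAct ρ 1 x = x := by
  obtain ⟨a, b, -, rfl⟩ := IsFractionRing.div_surjective (A := PolyRing n) x
  simp [ratAct_algebraMap, map_div₀]

lemma Resolution.fieldEmb_algebraMap (S : Resolution ρ) (f : invariants ρ) :
    S.fieldEmb (algebraMap _ _ f) = algebraMap (PolyRing n) (RatField n) f.1 :=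
  IsFractionRing.lift_algebraMap _ f

lemma Resolution.ratAct_fieldEmb (S : Resolution ρ) (g : G) (a : S.Y.functionField) :
    ratAct ρ g (S.fieldEmb a) = S.fieldEmb a := by
  obtain ⟨a, b, -, rfl⟩ := IsFractionRing.div_surjective (A := invariants ρ) a
  simp only [map_div₀, fieldEmb_algebraMap, ratAct_algebraMap]
  rw [a.2 g, b.2 g]

/-- An invariant rational function belongs to `K(Y)`. -/
lemma Resolution.exists_fieldEmb_eq [Finite G] (S : Resolution ρ) {x : RatField n}
    (hx : ∀ g, ratAct ρ g x = x) : ∃ a, S.fieldEmb a = x := by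
  classical
  have := Fintype.ofFinite G
  obtain ⟨a, b, hb, rfl⟩ := IsFractionRing.div_surjective (A := PolyRing n) x
  have hb0 : b ≠ 0 := nonZeroDivisors.ne_zero hb
  have hinj := IsFractionRing.injective (PolyRing n) (RatField n)
  -- Multiplying by the other conjugates of `b` makes the denominator its norm; an invariant
  -- fraction with invariant denominator has an invariant numerator.
  let N : PolyRing n := ∏ g, polyAct ρ g b
  have hN : ∀ g, polyAct ρ g N = N := fun g => by
    rw [map_prod]
    refine Fintype.prod_equiv (Equiv.mulLeft g) _ _ fun h => ?_
    simp
  have hNb : N = b * ∏ g ∈ Finset.univ.erase (1 : G), polyAct ρ g b := by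
    have := Finset.mul_prod_erase Finset.univ (fun g => polyAct ρ g b) (Finset.mem_univ (1 : G))
    rw [map_one] at this
    exact this.symm
  have hN0 : N ≠ 0 := Finset.prod_ne_zero_iff.mpr fun g _ =>
    (map_ne_zero_iff _ (polyAut ρ g).injective).mpr hb0
  let c := a * ∏ g ∈ Finset.univ.erase (1 : G), polyAct ρ g b
  have hab : algebraMap _ (RatField n) a / algebraMap _ _ b =
      algebraMap _ _ c / algebraMap _ _ N := by
    rw [div_eq_div_iff ((map_ne_zero_iff _ hinj).mpr hb0) ((map_ne_zero_iff _ hinj).mpr hN0),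
      ← map_mul, ← map_mul, hNb]
    congr 1
    ring
  have hc : ∀ g, polyAct ρ g c = c := fun g => by
    have h := hx g
    rw [hab, map_div₀, ratAct_algebraMap, ratAct_algebraMap, hN g,
      div_left_inj' ((map_ne_zero_iff _ hinj).mpr hN0)] at h
    exact hinj h
  refine ⟨algebraMap (invariants ρ) _ ⟨c, hc⟩ / algebraMap (invariants ρ) _ ⟨N, hN⟩, ?_⟩
  rw [map_div₀, fieldEmb_algebraMap, fieldEmb_algebraMap, hab]

namespace IsHomog

variable {χ χ' : G →* ℂˣ} {f f' : RatField n}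

lemma iff_constRat : IsHomog ρ χ f ↔ ∀ g : G, ratAct ρ g f = constRat n (χ g⁻¹ : ℂˣ) * f := Iff.rfl

lemma mul (hf : IsHomog ρ χ f) (hf' : IsHomog ρ χ' f') : IsHomog ρ (χ * χ') (f * f') :=
  iff_constRat.mpr fun g => by
    rw [map_mul, iff_constRat.mp hf g, iff_constRat.mp hf' g, MonoidHom.mul_apply, Units.val_mul,
      map_mul]
    ring

lemma inv (hf : IsHomog ρ χ f) : IsHomog ρ χ⁻¹ f⁻¹ := iff_constRat.mpr fun g => by
  rw [map_inv₀, iff_constRat.mp hf g, mul_inv, MonoidHom.inv_apply, Units.val_inv_eq_inv_val,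
    map_inv₀]

lemma one_iff : IsHomog ρ 1 f ↔ ∀ g, ratAct ρ g f = f := by
  simp [IsHomog]

lemma fieldEmb_mul {S : Resolution ρ} (h : S.Y.functionField) (hf : IsHomog ρ χ f) :
    IsHomog ρ χ (S.fieldEmb h * f) := by
  have h1 : (1 : G →* ℂˣ) * χ = χ := one_mul χ
  exact h1 ▸ (one_iff.mpr fun g => S.ratAct_fieldEmb g h).mul hf

/-- The quotient of two functions of the same weight is invariant: a non-zero weight space is a line
over `K(Y)`. -/
lemma exists_fieldEmb_mul [Finite G] (S : Resolution ρ) (hf : IsHomog ρ χ f) (h0 : f ≠ 0)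
    (hf' : IsHomog ρ χ f') : ∃ h, f' = S.fieldEmb h * f := by
  have h1 : χ * χ⁻¹ = 1 := mul_inv_cancel χ
  obtain ⟨a, ha⟩ := S.exists_fieldEmb_eq (one_iff.mp (h1 ▸ hf'.mul hf.inv))
  exact ⟨a, by rw [ha, mul_assoc, inv_mul_cancel₀ h0, mul_one]⟩

lemma pow (hf : IsHomog ρ χ f) (m : ℕ) : IsHomog ρ (χ ^ m) (f ^ m) := by
  induction m with
  | zero =>
    have h1 : χ ^ 0 = 1 := pow_zero χ
    rw [h1, pow_zero]
    exact one_iff.mpr fun g => map_one _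
  | succ m ih =>
    have h1 : χ ^ (m + 1) = χ ^ m * χ := pow_succ χ m
    rw [h1, pow_succ]
    exact ih.mul hf

/-- Since `χ ^ |G| = 1`, this power is invariant; it justifies the inverse of `fieldEmb` in the
definition of `val`. -/
lemma exists_fieldEmb_eq_pow_card [Finite G] (S : Resolution ρ) (hf : IsHomog ρ χ f) :
    ∃ h, S.fieldEmb h = f ^ Nat.card G := by
  refine S.exists_fieldEmb_eq (one_iff.mp ?_)
  have : χ ^ Nat.card G = 1 := MonoidHom.ext fun g => by
    rw [MonoidHom.pow_apply, ← map_pow, pow_card_eq_one']; simp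
  rw [← this]
  exact hf.pow _

end IsHomog

instance [Finite G] : Finite (G →* ℂˣ) := by
  have := Fintype.ofFinite G
  obtain ⟨e⟩ := CommGroup.monoidHom_mulEquiv_of_hasEnoughRootsOfUnity G ℂ
  exact Finite.of_equiv _ e.symm.toEquiv

lemma sum_character [Fintype G] (χ : G →* ℂˣ) (hχ : χ ≠ 1) : ∑ g, (χ g : ℂ) = 0 := by
  refine (sum_hom_units_eq_zero ((Units.coeHom ℂ).comp χ) fun h => hχ ?_)
  ext g
  exact DFunLike.congr_fun h g

lemma sum_eval_character [Finite G] [Fintype (G →* ℂˣ)] (g : G) (hg : g ≠ 1) :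
    ∑ χ : G →* ℂˣ, (χ g : ℂ) = 0 := by
  obtain ⟨χ, hχ⟩ := CommGroup.exists_apply_ne_one_of_hasEnoughRootsOfUnity G ℂ hg
  let ev : (G →* ℂˣ) →* ℂ := (Units.coeHom ℂ).comp (MonoidHom.eval g)
  exact sum_hom_units_eq_zero ev fun h => hχ (Units.ext (DFunLike.congr_fun h χ))

section Projection

variable [Finite G]

/-- The projection of `K(ℂⁿ)` onto its subspace of weight `χ`. -/
def weightProj (ρ : G →* GL (Fin n) ℂ) (χ : G →* ℂˣ) : RatField n →+ RatField n :=
  have := Fintype.ofFinite G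
  ∑ g : G, (AddMonoidHom.mulLeft (constRat n ((Nat.card G : ℂ)⁻¹ * χ g))).comp
    (ratAct ρ g : RatField n →+ RatField n)

lemma weightProj_apply [Fintype G] (χ : G →* ℂˣ) (x : RatField n) :
    weightProj ρ χ x = ∑ g : G, constRat n ((Nat.card G : ℂ)⁻¹ * χ g) * ratAct ρ g x := by
  simp only [weightProj, AddMonoidHom.finsetSum_apply]
  refine Finset.sum_congr (by congr!) fun g _ => rfl

lemma isHomog_weightProj (χ : G →* ℂˣ) (x : RatField n) : IsHomog ρ χ (weightProj ρ χ x) :=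
  IsHomog.iff_constRat.mpr fun h => by
    have := Fintype.ofFinite G
    rw [weightProj_apply, map_sum, Finset.mul_sum, ← Equiv.sum_comp (Equiv.mulLeft h⁻¹)]
    refine Finset.sum_congr rfl fun g _ => ?_
    rw [map_mul, ratAct_constRat, ← ratAct_mul, ← mul_assoc, ← map_mul]
    simp only [Equiv.coe_mulLeft, map_mul, Units.val_mul, mul_inv_cancel_left]
    ring

lemma weightProj_of_isHomog {χ : G →* ℂˣ} {x : RatField n} (hx : IsHomog ρ χ x) :
    weightProj ρ χ x = x := by
  have := Fintype.ofFinite G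
  have hm : (Nat.card G : ℂ) ≠ 0 := by simp
  rw [weightProj_apply]
  have : ∀ g : G, constRat n ((Nat.card G : ℂ)⁻¹ * χ g) * ratAct ρ g x =
      constRat n ((Nat.card G : ℂ)⁻¹) * x := fun g => by
    rw [IsHomog.iff_constRat.mp hx g, ← mul_assoc, ← map_mul, mul_assoc, ← Units.val_mul,
      ← map_mul, mul_inv_cancel, map_one, Units.val_one, mul_one]
  rw [Finset.sum_congr rfl fun g _ => this g, Finset.sum_const, Finset.card_univ,
    ← Nat.card_eq_fintype_card, nsmul_eq_mul, ← mul_assoc, ← map_natCast (constRat n), ← map_mul,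
    mul_inv_cancel₀ hm, map_one, one_mul]

lemma weightProj_of_isHomog_of_ne {χ χ' : G →* ℂˣ} (h : χ' ≠ χ) {x : RatField n}
    (hx : IsHomog ρ χ x) : weightProj ρ χ' x = 0 := by
  have := Fintype.ofFinite G
  rw [weightProj_apply]
  have : ∀ g : G, constRat n ((Nat.card G : ℂ)⁻¹ * χ' g) * ratAct ρ g x =
      constRat n ((Nat.card G : ℂ)⁻¹ * ((χ' * χ⁻¹) g : ℂˣ)) * x := fun g => by
    rw [IsHomog.iff_constRat.mp hx g, ← mul_assoc, ← map_mul, mul_assoc, ← Units.val_mul,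
      MonoidHom.mul_apply, MonoidHom.inv_apply, map_inv]
  rw [Finset.sum_congr rfl fun g _ => this g, ← Finset.sum_mul, ← map_sum, ← Finset.mul_sum,
    sum_character _ (fun h' => h (mul_inv_eq_one.mp h')), mul_zero, map_zero, zero_mul]

/-- Orthogonality over characters: `∑ χ(g)` vanishes for `g ≠ 1` and equals `|G|` at `g = 1`, where
the action is trivial. -/
lemma sum_weightProj [Fintype (G →* ℂˣ)] (x : RatField n) :
    ∑ χ : G →* ℂˣ, weightProj ρ χ x = x := by
  have := Fintype.ofFinite G
  classical
  have hm : (Nat.card G : ℂ) ≠ 0 := by simp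
  simp only [weightProj_apply]
  rw [Finset.sum_comm, Finset.sum_eq_single 1]
  · simp only [map_one, Units.val_one, mul_one, ratAct_one, Finset.sum_const, Finset.card_univ]
    rw [← Nat.card_eq_fintype_card, CommGroup.card_monoidHom_of_hasEnoughRootsOfUnity G ℂ,
      nsmul_eq_mul, ← mul_assoc, ← map_natCast (constRat n), ← map_mul,
      mul_inv_cancel₀ hm, map_one, one_mul]
  · intro g _ hg
    rw [← Finset.sum_mul, ← map_sum, ← Finset.mul_sum, sum_eval_character g hg, mul_zero, map_zero,
      zero_mul]
  · simp

lemma weightProj_finsum {t : (G →* ℂˣ) → RatField n} (ht : ∀ χ, IsHomog ρ χ (t χ)) (χ : G →* ℂˣ) :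
    weightProj ρ χ (∑ᶠ χ, t χ) = t χ := by
  have := Fintype.ofFinite (G →* ℂˣ)
  rw [finsum_eq_sum_of_fintype, map_sum, Finset.sum_eq_single χ]
  · exact weightProj_of_isHomog (ht χ)
  · exact fun χ' _ h => weightProj_of_isHomog_of_ne h.symm (ht χ')
  · simp

lemma finsum_weightProj (x : RatField n) : ∑ᶠ χ : G →* ℂˣ, weightProj ρ χ x = x := by
  have := Fintype.ofFinite (G →* ℂˣ)
  rw [finsum_eq_sum_of_fintype, sum_weightProj]

lemma weightProj_fieldEmb_mul (S : Resolution ρ) (χ : G →* ℂˣ) (h : S.Y.functionField)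
    (x : RatField n) : weightProj ρ χ (S.fieldEmb h * x) = S.fieldEmb h * weightProj ρ χ x := by
  have := Fintype.ofFinite G
  rw [weightProj_apply, weightProj_apply, Finset.mul_sum]
  refine Finset.sum_congr rfl fun g _ => ?_
  rw [map_mul (ratAct ρ g), S.ratAct_fieldEmb]
  ring

lemma weightProj_mem {N : AddSubgroup (RatField n)} (hc : ∀ c, ∀ x ∈ N, constRat n c * x ∈ N)
    (hg : ∀ g, ∀ x ∈ N, ratAct ρ g x ∈ N) (χ : G →* ℂˣ) {x : RatField n} (hx : x ∈ N) :
    weightProj ρ χ x ∈ N := by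
  have := Fintype.ofFinite G
  rw [weightProj_apply]
  exact sum_mem fun g _ => hc _ _ (hg g x hx)

end Projection

end Weights

/-! ### Units of the local rings, seen in `K` -/

section LocalUnit

variable {Y : Scheme.{0}} [IsIntegral Y] {K : Type} [Field K] {κ : Y.functionField →+* K}

variable (κ) in
/-- `u ∈ K` is a unit of the local ring at `y`. -/
def IsLocalUnit (y : Y) (u : K) : Prop :=
  u ≠ 0 ∧ u ∈ localSubring κ y ∧ u⁻¹ ∈ localSubring κ y

lemma eventually_mem_localSubring {y : Y} {x : K} (hx : x ∈ localSubring κ y) :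
    ∃ V : Y.Opens, y ∈ V ∧ ∀ z ∈ V, x ∈ localSubring κ z := by
  obtain ⟨U, hy, r, rfl⟩ := mem_localSubring.mp hx
  exact ⟨U, hy, fun z hz => value_mem_localSubring hz r⟩

lemma IsLocalUnit.eventually {y : Y} {u : K} (hu : IsLocalUnit κ y u) :
    ∃ V : Y.Opens, y ∈ V ∧ ∀ z ∈ V, IsLocalUnit κ z u := by
  obtain ⟨V, hy, h⟩ := eventually_mem_localSubring hu.2.1
  obtain ⟨V', hy', h'⟩ := eventually_mem_localSubring hu.2.2
  exact ⟨V ⊓ V', ⟨hy, hy'⟩, fun z hz => ⟨hu.1, h z hz.1, h' z hz.2⟩⟩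

lemma isLocalUnit_genericPoint {h : Y.functionField} (hh : h ≠ 0) :
    IsLocalUnit κ (genericPoint Y) (κ h) := by
  have key : ∀ a : Y.functionField, κ a ∈ localSubring κ (genericPoint Y) := fun a => by
    obtain ⟨U, hU, r, rfl⟩ := Y.presheaf.exists_germ_eq a
    exact mem_localSubring.mpr ⟨U, hU, r, rfl⟩
  exact ⟨(map_ne_zero κ).mpr hh, key h, by rw [← map_inv₀]; exact key _⟩

lemma ord_one [IsLocallyNoetherian Y] (y : Y) : Scheme.ord (1 : Y.functionField) y = 0 := by
  have h := Scheme.ord_mul (x := y) (one_ne_zero (α := Y.functionField)) one_ne_zero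
  rw [mul_one] at h
  omega

lemma ord_pow [IsLocallyNoetherian Y] {h : Y.functionField} (hh : h ≠ 0) (m : ℕ) (y : Y) :
    Scheme.ord (h ^ m) y = m * Scheme.ord h y := by
  induction m with
  | zero => rw [pow_zero, Nat.cast_zero, zero_mul, ord_one]
  | succ m ih =>
    rw [pow_succ, Scheme.ord_mul (pow_ne_zero m hh) hh, ih]
    push_cast
    ring

lemma ord_eq_zero_of_isLocalUnit [IsLocallyNoetherian Y] {y : Y} {h : Y.functionField}
    (hu : IsLocalUnit κ y (κ h)) : Scheme.ord h y = 0 := by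
  obtain ⟨h0, ⟨a, ha⟩, b, hb⟩ := hu
  have ha' : algebraMap _ Y.functionField a = h := κ.injective ha
  have hab : a * b = 1 := by
    have : Function.Injective (algebraMap (Y.presheaf.stalk y) Y.functionField) :=
      IsFractionRing.injective _ _
    apply κ.injective.comp this
    simp only [Function.comp_apply, map_mul, map_one]
    rw [RingHom.comp_apply] at ha hb
    rw [ha, hb, mul_inv_cancel₀ h0]
  rw [← ha']
  exact ord_eq_zero_of_isUnit_stalk (IsUnit.of_mul_eq_one _ hab)

end LocalUnit

/-! ### Valuations of homogeneous functions -/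

section Valuation

variable {n : ℕ} {G : Type*} [CommGroup G] {ρ : G →* GL (Fin n) ℂ} (S : Resolution ρ)

namespace Resolution

/-- Here normality of `Y` enters: both `h` and `h⁻¹` are regular in codimension one near `y`, hence
regular at `y`. -/
lemma isLocalUnit_of_ord_eq_zero {V : S.Y.Opens} {h : S.Y.functionField} (hh : h ≠ 0)
    (H : ∀ P : S.PrimeDivisor, P.1 ∈ V → Scheme.ord h P.1 = 0) {y : S.Y} (hy : y ∈ V) :
    IsLocalUnit S.fieldEmb y (S.fieldEmb h) := by
  obtain ⟨a, ha⟩ := mem_range_stalk_of_ord_eq_zero S.isIntegrallyClosed_sections hh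
    (fun P hP h1 => H ⟨P, h1⟩ hP) hy
  obtain ⟨b, hb⟩ := mem_range_stalk_of_ord_eq_zero S.isIntegrallyClosed_sections (inv_ne_zero hh)
    (fun P hP h1 => by
      have h2 := Scheme.ord_mul (x := P) hh (inv_ne_zero hh)
      rwa [mul_inv_cancel₀ hh, H ⟨P, h1⟩ hP, zero_add, ord_one, eq_comm] at h2) hy
  exact ⟨(map_ne_zero _).mpr hh, ⟨a, congrArg S.fieldEmb ha⟩, b, by
    rw [← map_inv₀]; exact congrArg S.fieldEmb hb⟩

variable {S}

lemma val_eq (P : S.PrimeDivisor) {f : RatField n} {h : S.Y.functionField}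
    (hf : S.fieldEmb h = f ^ Nat.card G) : S.val P f = Scheme.ord h P.1 / Nat.card G := by
  rw [val, ← hf, Function.leftInverse_invFun S.fieldEmb.injective]

variable [Finite G]

lemma val_fieldEmb (P : S.PrimeDivisor) {h : S.Y.functionField} (hh : h ≠ 0) :
    S.val P (S.fieldEmb h) = Scheme.ord h P.1 := by
  have hm : (Nat.card G : ℚ) ≠ 0 := Nat.cast_ne_zero.mpr Nat.card_pos.ne'
  rw [val_eq P (map_pow S.fieldEmb h _), ord_pow hh]
  push_cast
  field_simp

lemma val_fieldEmb_mul (P : S.PrimeDivisor) {χ : G →* ℂˣ} {h : S.Y.functionField} (hh : h ≠ 0)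
    {f : RatField n} (hf0 : f ≠ 0) (hf : IsHomog ρ χ f) :
    S.val P (S.fieldEmb h * f) = Scheme.ord h P.1 + S.val P f := by
  obtain ⟨k, hk⟩ := hf.exists_fieldEmb_eq_pow_card S
  have hk0 : k ≠ 0 := fun h0 => pow_ne_zero (Nat.card G) hf0 (by rw [← hk, h0, map_zero])
  have hm : (Nat.card G : ℚ) ≠ 0 := Nat.cast_ne_zero.mpr Nat.card_pos.ne'
  have e : S.fieldEmb (h ^ Nat.card G * k) = (S.fieldEmb h * f) ^ Nat.card G := by
    rw [map_mul, map_pow, hk, mul_pow]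
  rw [val_eq P e, val_eq P hk, Scheme.ord_mul (pow_ne_zero _ hh) hk0, ord_pow hh]
  push_cast
  field_simp

lemma val_one (P : S.PrimeDivisor) : S.val P 1 = 0 := by
  rw [← map_one S.fieldEmb, val_fieldEmb P one_ne_zero, ord_one, Int.cast_zero]

/-- Homogeneous rational functions of weight `χ` whose valuations agree near `y` differ by a unit
at `y`. -/
lemma isLocalUnit_div {χ : G →* ℂˣ} {f f' : RatField n} (hf0 : f ≠ 0) (hf'0 : f' ≠ 0)
    (hf : IsHomog ρ χ f) (hf' : IsHomog ρ χ f') {V : S.Y.Opens}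
    (H : ∀ P : S.PrimeDivisor, P.1 ∈ V → S.val P f' = S.val P f) {y : S.Y} (hy : y ∈ V) :
    IsLocalUnit S.fieldEmb y (f' / f) := by
  obtain ⟨h, hh⟩ := hf.exists_fieldEmb_mul S hf0 hf'
  have h0 : h ≠ 0 := by rintro rfl; exact hf'0 (by rw [hh, map_zero, zero_mul])
  have e : f' / f = S.fieldEmb h := by rw [hh, mul_div_cancel_right₀ _ hf0]
  rw [e]
  refine S.isLocalUnit_of_ord_eq_zero h0 (fun P hP => ?_) hy
  have h1 := H P hP
  rw [hh, val_fieldEmb_mul P h0 hf0 hf] at h1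
  have h2 : (Scheme.ord h P.1 : ℚ) = 0 := by linarith
  exact_mod_cast h2

lemma val_eq_of_isLocalUnit_div {χ : G →* ℂˣ} {f f' : RatField n} (hf0 : f ≠ 0)
    (hf : IsHomog ρ χ f) (hf' : IsHomog ρ χ f') {P : S.PrimeDivisor}
    (H : IsLocalUnit S.fieldEmb P.1 (f' / f)) : S.val P f' = S.val P f := by
  obtain ⟨h, hh⟩ := hf.exists_fieldEmb_mul S hf0 hf'
  have e : f' / f = S.fieldEmb h := by rw [hh, mul_div_cancel_right₀ _ hf0]
  rw [e] at H
  have h0 : h ≠ 0 := fun h0 => H.1 (by rw [h0, map_zero])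
  rw [hh, val_fieldEmb_mul P h0 hf0 hf, ord_eq_zero_of_isLocalUnit H]
  simp

/-- The power `f ^ |G|` is a unit on a neighbourhood `W` of the generic point, so `D` vanishes at
the prime divisors meeting `V ⊓ W`; only finitely many others exist. -/
lemma finite_support_val {χ : G →* ℂˣ} {f : RatField n} (hf0 : f ≠ 0) (hf : IsHomog ρ χ f)
    {V : S.Y.Opens} (hV : genericPoint S.Y ∈ V) (D : S.PrimeDivisor → ℚ)
    (hD : ∀ P : S.PrimeDivisor, P.1 ∈ V → D P = S.val P f) : (Function.support D).Finite := by
  obtain ⟨k, hk⟩ := hf.exists_fieldEmb_eq_pow_card S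
  have hk0 : k ≠ 0 := fun h0 => pow_ne_zero (Nat.card G) hf0 (by rw [← hk, h0, map_zero])
  obtain ⟨W, hW, hu⟩ := (isLocalUnit_genericPoint (κ := S.fieldEmb) hk0).eventually
  refine ((finite_coheight_eq_one_notMem (W := V ⊓ W) ⟨hV, hW⟩).preimage
    Subtype.val_injective.injOn).subset fun P hP => ⟨P.2, fun hVW => hP ?_⟩
  rw [hD P hVW.1, val_eq P hk, ord_eq_zero_of_isLocalUnit (hu _ hVW.2)]
  simp

lemma fract_val_eq_zero (P : S.PrimeDivisor) {f : RatField n} (hf0 : f ≠ 0) (hf : IsHomog ρ 1 f) :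
    Int.fract (S.val P f) = 0 := by
  obtain ⟨h, rfl⟩ := S.exists_fieldEmb_eq (IsHomog.one_iff.mp hf)
  rw [val_fieldEmb P fun h0 => hf0 (by rw [h0, map_zero])]
  exact Int.fract_intCast _

/-- Functions of equal weight differ by a factor in `K(Y)`, whose order at `P` is an integer. -/
lemma exists_val_sub_fract_val (P : S.PrimeDivisor) {χ : G →* ℂˣ} {f f' : RatField n}
    (hf0 : f ≠ 0) (hf'0 : f' ≠ 0) (hf : IsHomog ρ χ f) (hf' : IsHomog ρ χ f') :
    ∃ k : ℤ, S.val P f - Int.fract (S.val P f') = k := by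
  obtain ⟨h, hh⟩ := hf'.exists_fieldEmb_mul S hf'0 hf
  have h0 : h ≠ 0 := by rintro rfl; exact hf0 (by rw [hh, map_zero, zero_mul])
  refine ⟨Scheme.ord h P.1 + ⌊S.val P f'⌋, ?_⟩
  rw [hh, val_fieldEmb_mul P h0 hf'0 hf', Int.fract]
  push_cast
  ring

end Resolution

end Valuation

/-! ### Locally free sheaves: frames on stalks, injectivity into the generic stalk -/

section LocallyFree

variable {Y : Scheme.{0}} {M : Y.Modules}

lemma IsFreeOn.exists_stalk_frame {U : Y.Opens} {m : ℕ} (hM : IsFreeOn M U m) :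
    ∃ e : Fin m → Γ(M, U), ∀ (z : Y) (hz : z ∈ U) (s : M.presheaf.stalk z),
      ∃ a : Fin m → Y.presheaf.stalk z, s = ∑ i, a i • M.presheaf.germ U z hz (e i) := by
  obtain ⟨e, he⟩ := hM
  refine ⟨e, fun z hz s => ?_⟩
  obtain ⟨V, hV, t, rfl⟩ := M.presheaf.exists_germ_eq s
  have hW : z ∈ U ⊓ V := mem_inf_opens hz hV
  have hmem : res (inf_le_right : U ⊓ V ≤ V) t ∈
      Submodule.span Γ(Y, U ⊓ V) (Set.range fun i => res (inf_le_left : U ⊓ V ≤ U) (e i)) :=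
    (he (U ⊓ V) inf_le_left).2 ▸ Submodule.mem_top
  obtain ⟨r, hr⟩ := (Submodule.mem_span_range_iff_exists_fun _).mp hmem
  refine ⟨fun i => Y.presheaf.germ _ z hW (r i), ?_⟩
  rw [← germ_eq_germ_res (inf_le_right : U ⊓ V ≤ V) hW, ← hr, map_sum]
  refine Finset.sum_congr rfl fun i _ => ?_
  have := germ_smul M z _ hW (r i) (res inf_le_left (e i))
  rw [this, germ_eq_germ_res (inf_le_left : U ⊓ V ≤ U) hW]

lemma IsLocallyFree.finite_stalk (hM : IsLocallyFree M) (y : Y) :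
    Module.Finite (Y.presheaf.stalk y) (M.presheaf.stalk y) := by
  classical
  obtain ⟨U, hy, m, hU⟩ := hM y
  obtain ⟨e, he⟩ := hU.exists_stalk_frame
  refine ⟨⟨Finset.univ.image fun i => M.presheaf.germ U y hy (e i),
    Submodule.eq_top_iff'.mpr fun s => ?_⟩⟩
  obtain ⟨a, rfl⟩ := he y hy s
  exact sum_mem fun i _ => Submodule.smul_mem _ _ (Submodule.subset_span (by simp))

/-- In a local frame, the coordinates of `s` vanish near the generic point, hence vanish, `Y` being
integral. -/
lemma IsLocallyFree.germ_genericPoint_injective [IsIntegral Y] (hM : IsLocallyFree M)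
    {U : Y.Opens} (hU : genericPoint Y ∈ U) :
    Function.Injective (M.presheaf.germ U (genericPoint Y) hU) := by
  rw [injective_iff_map_eq_zero]
  intro s hs
  refine section_ext fun y hy => ?_
  obtain ⟨W, hyW, m, e, he⟩ := hM y
  refine ⟨W ⊓ U, inf_le_right, mem_inf_opens hyW hy, ?_⟩
  have hmem : res (inf_le_right : W ⊓ U ≤ U) s ∈
      Submodule.span Γ(Y, W ⊓ U) (Set.range fun i => res (inf_le_left : W ⊓ U ≤ W) (e i)) :=
    (he (W ⊓ U) inf_le_left).2 ▸ Submodule.mem_top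
  obtain ⟨r, hr⟩ := (Submodule.mem_span_range_iff_exists_fun _).mp hmem
  have hη : genericPoint Y ∈ W ⊓ U := genericPoint_mem (mem_inf_opens hyW hy)
  obtain ⟨T, hTη, i₁, i₂, hT⟩ := M.presheaf.germ_eq _ hη hη (res (inf_le_right : W ⊓ U ≤ U) s) 0
    (by rw [map_zero, germ_eq_germ_res (inf_le_right : W ⊓ U ≤ U) hη, hs])
  have hT' : res i₁.le (res (inf_le_right : W ⊓ U ≤ U) s) = 0 := hT.trans (map_zero _)
  rw [← hr, map_sum] at hT'
  simp only [res_smul, res_res] at hT'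
  have hlin := (he T (i₁.le.trans inf_le_left)).1
  have hz := Fintype.linearIndependent_iff.mp hlin _ hT'
  have hr0 : ∀ i, r i = 0 := fun i => by
    apply germ_injective_of_isIntegral _ _ hη
    rw [map_zero]
    have h1 : Y.presheaf.germ T _ hTη (resO i₁.le (r i)) = Y.presheaf.germ (W ⊓ U) _ hη (r i) :=
      Y.presheaf.germ_res_apply i₁ _ hTη _
    rw [← h1, hz i, map_zero]
  rw [← hr, map_zero]
  exact Finset.sum_eq_zero fun i _ => by rw [hr0 i, zero_smul]

end LocallyFree

/-! ### Deformations inside `K(ℂⁿ)` and generation of stalks by an orbit -/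

section Deformation

variable {n : ℕ} {G : Type*} [CommGroup G] {ρ : G →* GL (Fin n) ℂ} {S : Resolution ρ}

lemma Resolution.fieldEmb_germ_const (c : ℂ) {U : S.Y.Opens} {y : S.Y} (hy : y ∈ U) :
    value S.fieldEmb (genericPoint_mem hy) (S.const c U) = constRat n c := by
  have h1 : S.Y.presheaf.germ U _ (genericPoint_mem hy) (S.const c U) =
      algebraMap (invariants ρ) S.Y.functionField (algebraMap ℂ _ c) :=
    S.Y.presheaf.germ_res_apply (homOfLE (le_top : U ≤ ⊤)) _ (genericPoint_mem hy) _
  change S.fieldEmb _ = _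
  rw [h1, S.fieldEmb_algebraMap]
  rfl

lemma Resolution.constRat_mem_localSubring (c : ℂ) (y : S.Y) :
    constRat n c ∈ localSubring S.fieldEmb y :=
  mem_localSubring.mpr ⟨⊤, trivial, S.const c ⊤, S.fieldEmb_germ_const c (U := ⊤) (y := y) trivial⟩

namespace Deformation

variable (F : Deformation S)

/-- The embedding of a deformation into the constant sheaf `K(ℂⁿ)`. -/
def genericEmbedding : GenericEmbedding S.fieldEmb F.sheaf where
  emb U hU := F.ι.toAddMonoidHom.comp (F.sheaf.presheaf.germ U (genericPoint S.Y) hU).hom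
  emb_res h hV s := congrArg F.ι (germ_eq_germ_res h hV s)
  emb_smul {U} hU r s := by
    have := germ_smul F.sheaf _ U hU r s
    exact (congrArg F.ι this).trans (F.ι_smul _ _)
  emb_injective hU := F.ι.injective.comp (F.locallyFree.germ_genericPoint_injective hU)

lemma emb_actG (g : G) {U : S.Y.Opens} (hU : genericPoint S.Y ∈ U) (s : Γ(F.sheaf, U)) :
    F.genericEmbedding.emb U hU (Scheme.Modules.Hom.app (F.actG g) U s) =
      ratAct ρ g (F.genericEmbedding.emb U hU s) := by
  change F.ι (F.sheaf.presheaf.germ _ _ _ _) = ratAct ρ g (F.ι (F.sheaf.presheaf.germ _ _ _ _))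
  rw [← F.ι_actG, stalkAddHom_germ]

lemma emb_actR (f : PolyRing n) {U : S.Y.Opens} (hU : genericPoint S.Y ∈ U) (s : Γ(F.sheaf, U)) :
    F.genericEmbedding.emb U hU (Scheme.Modules.Hom.app (F.actR f) U s) =
      algebraMap _ _ f * F.genericEmbedding.emb U hU s := by
  change F.ι (F.sheaf.presheaf.germ _ _ _ _) = _ * (F.ι (F.sheaf.presheaf.germ _ _ _ _))
  rw [← F.ι_actR, stalkAddHom_germ]

/-- The image in `K(ℂⁿ)` of the stalk of a deformation. -/
def stalkImage (y : S.Y) : AddSubgroup (RatField n) := F.genericEmbedding.stalkImage y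

lemma mem_range_embed {U : S.Y.Opens} (hU : genericPoint S.Y ∈ U) {x : RatField n} :
    x ∈ Set.range (F.embed U hU) ↔ ∀ y ∈ U, x ∈ F.stalkImage y :=
  F.genericEmbedding.mem_range_emb hU

lemma mem_stalkImage_genericPoint (x : RatField n) : x ∈ F.stalkImage (genericPoint S.Y) := by
  obtain ⟨U, hU, s, hs⟩ := F.sheaf.presheaf.exists_germ_eq (F.ι.symm x)
  exact ⟨U, hU, s, (congrArg F.ι hs).trans (F.ι.apply_symm_apply x)⟩

lemma ratAct_mem_stalkImage (g : G) {y : S.Y} {x : RatField n} (hx : x ∈ F.stalkImage y) :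
    ratAct ρ g x ∈ F.stalkImage y := by
  obtain ⟨U, hy, s, rfl⟩ := hx
  exact ⟨U, hy, _, F.emb_actG g _ s⟩

lemma mul_mem_stalkImage {y : S.Y} {a x : RatField n} (ha : a ∈ localSubring S.fieldEmb y)
    (hx : x ∈ F.stalkImage y) : a * x ∈ F.stalkImage y :=
  F.genericEmbedding.mul_mem_stalkImage ha hx

lemma weightProj_mem_stalkImage [Finite G] (χ : G →* ℂˣ) {y : S.Y} {x : RatField n}
    (hx : x ∈ F.stalkImage y) : weightProj ρ χ x ∈ F.stalkImage y :=
  weightProj_mem (fun c _ h => F.mul_mem_stalkImage (S.constRat_mem_localSubring c y) h)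
    (fun g _ h => F.ratAct_mem_stalkImage g h) χ hx

lemma stalkMap_actG (g : G) (y : S.Y) (m : F.sheaf.presheaf.stalk y) :
    F.genericEmbedding.stalkMap y (stalkLinearMap (F.actG g) y m) =
      ratAct ρ g (F.genericEmbedding.stalkMap y m) :=
  GenericEmbedding.stalkMap_stalkAddHom F.genericEmbedding F.genericEmbedding
    (fun _ hU s => F.emb_actG g hU s) y m

/-- The stalk at `y` is generated over the local ring by an orbit of `G`, on which each character
occurs. -/
lemma exists_stalk_orbit [Fintype G] (y : S.Y) : ∃ x : RatField n,
    (∀ χ : G →* ℂˣ, weightProj ρ χ x ≠ 0) ∧ x ∈ F.stalkImage y ∧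
      ∀ x' ∈ F.stalkImage y, ∃ a : G → RatField n, (∀ g, a g ∈ localSubring S.fieldEmb y) ∧
        x' = ∑ g, a g * ratAct ρ g x := by
  have hfin := F.locallyFree.finite_stalk y
  obtain ⟨b, hb⟩ := F.isConstellation y
  obtain ⟨s, hs⟩ : ∃ s : F.sheaf.presheaf.stalk y,
      (1 : ResField S.Y y) ⊗ₜ[S.Y.presheaf.stalk y] s = b 1 :=
    TensorProduct.mk_surjective _ _ _ Ideal.Quotient.mk_surjective (b 1)
  have hbg : ∀ g, (1 : ResField S.Y y) ⊗ₜ[S.Y.presheaf.stalk y]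
      stalkLinearMap (F.actG g) y s = b g := fun g => by
    have := hb g 1
    rw [mul_one, ← hs] at this
    exact this
  -- Nakayama's lemma: the translates of `s` lift a basis of the fibre.
  have hspan := IsLocalRing.span_eq_top_of_tmul_eq_basis
    (fun g => stalkLinearMap (F.actG g) y s) b hbg
  have hinj := F.genericEmbedding.stalkMap_injective y
  refine ⟨F.genericEmbedding.stalkMap y s, fun χ h0 => ?_,
    (F.genericEmbedding.range_stalkMap y _).mp ⟨s, rfl⟩, fun x' hx' => ?_⟩
  -- A vanishing projection is a relation `∑ |G|⁻¹ χ(g) g.s = 0`. It reduces to a relation in the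
  -- basis `b` whose coefficient at `1` is the non-zero constant `|G|⁻¹`.
  · have hm : (Nat.card G : ℂ) ≠ 0 := Nat.cast_ne_zero.mpr Nat.card_pos.ne'
    let c : G → S.Y.presheaf.stalk y := fun g =>
      S.Y.presheaf.germ ⊤ y trivial (S.const ((Nat.card G : ℂ)⁻¹ * χ g) ⊤)
    have hc : ∀ g, S.fieldEmb (algebraMap _ S.Y.functionField (c g)) =
        constRat n ((Nat.card G : ℂ)⁻¹ * χ g) := fun g =>
      (algebraMap_germ _ _).trans (S.fieldEmb_germ_const _ (U := ⊤) (y := y) trivial)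
    have hsum : ∑ g, c g • stalkLinearMap (F.actG g) y s = 0 := by
      apply hinj
      rw [map_zero, ← h0, map_sum, weightProj_apply]
      refine Finset.sum_congr rfl fun g _ => ?_
      rw [GenericEmbedding.stalkMap_smul, hc, stalkMap_actG]
    have hsum' : ∑ g, IsLocalRing.residue _ (c g) • b g = 0 := by
      rw [← TensorProduct.tmul_zero (R := S.Y.presheaf.stalk y) (F.sheaf.presheaf.stalk y)
        (1 : ResField S.Y y), ← hsum, TensorProduct.tmul_sum]
      refine Finset.sum_congr rfl fun g _ => ?_
      rw [TensorProduct.tmul_smul, hbg]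
      exact algebraMap_smul _ _ _
    have h1 := Fintype.linearIndependent_iff.mp b.linearIndependent _ hsum' 1
    have hunit : IsUnit (c 1) := by
      have : IsUnit ((Nat.card G : ℂ)⁻¹ * χ 1) := by simp
      exact this.map ((S.Y.presheaf.germ ⊤ y trivial).hom.comp
        ((S.Y.presheaf.map (homOfLE (le_top : (⊤ : S.Y.Opens) ≤ ⊤)).op).hom.comp
        (S.pullback.comp (algebraMap ℂ (invariants ρ)))))
    exact (hunit.map (IsLocalRing.residue _)).ne_zero h1
  · obtain ⟨m, rfl⟩ := (F.genericEmbedding.range_stalkMap y _).mpr hx'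
    obtain ⟨a, rfl⟩ := (Submodule.mem_span_range_iff_exists_fun _).mp
      (hspan ▸ Submodule.mem_top : m ∈ Submodule.span _ _)
    refine ⟨fun g => S.fieldEmb (algebraMap _ S.Y.functionField (a g)), fun g => ⟨a g, rfl⟩, ?_⟩
    rw [map_sum]
    refine Finset.sum_congr rfl fun g _ => ?_
    rw [GenericEmbedding.stalkMap_smul, stalkMap_actG]

end Deformation

end Deformation

/-! ### Local generators of the weight parts and their Weil divisors -/

section LocalGenerators

variable {n : ℕ} {G : Type*} [CommGroup G] {ρ : G →* GL (Fin n) ℂ} {S : Resolution ρ}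

lemma exists_opens_of_eventually {Y : Scheme.{0}} {y : Y} {p : Y → Prop} (h : ∀ᶠ z in nhds y, p z) :
    ∃ V : Y.Opens, y ∈ V ∧ ∀ z ∈ V, p z := by
  obtain ⟨V, hV, hVo, hy⟩ := eventually_nhds_iff.mp h
  exact ⟨⟨V, hVo⟩, hy, hV⟩

lemma eventually_of_opens {Y : Scheme.{0}} {y : Y} {p : Y → Prop} {V : Y.Opens} (hy : y ∈ V)
    (h : ∀ z ∈ V, p z) : ∀ᶠ z in nhds y, p z :=
  Filter.eventually_of_mem (V.isOpen.mem_nhds hy) h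

lemma weightProj_ratAct [Finite G] (χ : G →* ℂˣ) (g : G) (x : RatField n) :
    weightProj ρ χ (ratAct ρ g x) = constRat n (χ g⁻¹ : ℂˣ) * weightProj ρ χ x := by
  have := Fintype.ofFinite G
  rw [weightProj_apply, weightProj_apply, Finset.mul_sum,
    ← Equiv.sum_comp (Equiv.mulRight g⁻¹)]
  refine Finset.sum_congr rfl fun h _ => ?_
  rw [← ratAct_mul, ← mul_assoc, ← map_mul]
  simp only [Equiv.coe_mulRight, map_mul, Units.val_mul, inv_mul_cancel_right]
  ring

lemma weightProj_mul_of_mem_localSubring [Finite G] (χ : G →* ℂˣ) {y : S.Y} {a : RatField n}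
    (ha : a ∈ localSubring S.fieldEmb y) (x : RatField n) :
    weightProj ρ χ (a * x) = a * weightProj ρ χ x := by
  obtain ⟨b, rfl⟩ := ha
  exact weightProj_fieldEmb_mul S χ _ x

namespace Deformation

variable (F : Deformation S)

/-- `f` generates the weight `χ` part of the deformation over `V`. -/
def IsLocalGenerator (χ : G →* ℂˣ) (V : S.Y.Opens) (f : RatField n) : Prop :=
  f ≠ 0 ∧ IsHomog ρ χ f ∧ ∀ z ∈ V, f ∈ F.stalkImage z ∧
    ∀ x ∈ F.stalkImage z, IsHomog ρ χ x → x / f ∈ localSubring S.fieldEmb z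

/-- Projection to weight `χ` turns each translate `g.x` into a constant times the projection of `x`,
so an expansion in the orbit of `x` becomes a multiple of that one element. -/
lemma exists_isLocalGenerator [Finite G] (χ : G →* ℂˣ) (y : S.Y) :
    ∃ (V : S.Y.Opens) (f : RatField n), y ∈ V ∧ F.IsLocalGenerator χ V f := by
  have := Fintype.ofFinite G
  obtain ⟨x, hx0, hx, hgen⟩ := F.exists_stalk_orbit y
  obtain ⟨U, hyU, m, hU⟩ := F.locallyFree y
  obtain ⟨e, he⟩ := hU.exists_stalk_frame
  have hη := genericPoint_mem hyU
  -- The frame `e` generates all stalks over `U`. Its finitely many expansion coefficients in the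
  -- orbit are regular at `y`, hence near `y`, which spreads generation from `y` to a neighbourhood.
  choose a ha hae using fun i => hgen _ (F.genericEmbedding.emb_mem_stalkImage hyU hη (e i))
  have h1 : ∀ᶠ z in nhds y, ∀ i g, a i g ∈ localSubring S.fieldEmb z :=
    Filter.eventually_all.mpr fun i => Filter.eventually_all.mpr fun g => by
      obtain ⟨V, hy, hV⟩ := eventually_mem_localSubring (ha i g)
      exact eventually_of_opens hy hV
  have h2 : ∀ᶠ z in nhds y, x ∈ F.stalkImage z := by
    obtain ⟨V, hy, s, rfl⟩ := hx
    exact eventually_of_opens hy fun z hz => F.genericEmbedding.emb_mem_stalkImage hz _ s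
  obtain ⟨V, hyV, hV⟩ := exists_opens_of_eventually
    ((eventually_of_opens (p := fun z => z ∈ U) hyU fun _ h => h).and (h1.and h2))
  refine ⟨V, weightProj ρ χ x, hyV, hx0 χ, isHomog_weightProj χ x, fun z hz => ?_⟩
  obtain ⟨hzU, haz, hxz⟩ := hV z hz
  refine ⟨F.weightProj_mem_stalkImage χ hxz, fun x' hx' hhom => ?_⟩
  obtain ⟨s, rfl⟩ := (F.genericEmbedding.range_stalkMap z _).mpr hx'
  obtain ⟨b, hb⟩ := he z hzU s
  have hmem : ∀ i, S.fieldEmb (algebraMap _ S.Y.functionField (b i)) ∈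
      localSubring S.fieldEmb z := fun i => ⟨b i, rfl⟩
  have key : F.genericEmbedding.stalkMap z s = (∑ i, S.fieldEmb (algebraMap _ _ (b i)) *
      ∑ g, a i g * constRat n (χ g⁻¹ : ℂˣ)) * weightProj ρ χ x := by
    rw [← weightProj_of_isHomog hhom, hb, map_sum, map_sum, Finset.sum_mul]
    refine Finset.sum_congr rfl fun i _ => ?_
    rw [GenericEmbedding.stalkMap_smul, weightProj_mul_of_mem_localSubring χ (hmem i), mul_assoc,
      GenericEmbedding.stalkMap_germ, hae, map_sum, Finset.sum_mul]
    congr 1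
    refine Finset.sum_congr rfl fun g _ => ?_
    rw [weightProj_mul_of_mem_localSubring χ (haz i g), weightProj_ratAct, mul_assoc]
  rw [key, mul_div_cancel_right₀ _ (hx0 χ)]
  exact sum_mem fun i _ => mul_mem (hmem i) (sum_mem fun g _ => mul_mem (haz i g)
    (S.constRat_mem_localSubring _ z))

variable {F}

lemma IsLocalGenerator.mem_iff {χ : G →* ℂˣ} {V : S.Y.Opens} {f : RatField n}
    (hf : F.IsLocalGenerator χ V f) {z : S.Y} (hz : z ∈ V) {x : RatField n} (hx : IsHomog ρ χ x) :
    x ∈ F.stalkImage z ↔ x / f ∈ localSubring S.fieldEmb z :=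
  ⟨fun h => (hf.2.2 z hz).2 x h hx, fun h => by
    rw [← div_mul_cancel₀ x hf.1]
    exact F.mul_mem_stalkImage h (hf.2.2 z hz).1⟩

lemma IsLocalGenerator.isLocalUnit_div {χ : G →* ℂˣ} {V V' : S.Y.Opens} {f f' : RatField n}
    (hf : F.IsLocalGenerator χ V f) (hf' : F.IsLocalGenerator χ V' f') {z : S.Y} (hz : z ∈ V)
    (hz' : z ∈ V') : IsLocalUnit S.fieldEmb z (f' / f) :=
  ⟨div_ne_zero hf'.1 hf.1, (hf.mem_iff hz hf'.2.1).mp (hf'.2.2 z hz').1, by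
    rw [inv_div]; exact (hf'.mem_iff hz' hf.2.1).mp (hf.2.2 z hz).1⟩

lemma mem_stalkImage_iff_weightProj [Finite G] {y : S.Y} {x : RatField n} :
    x ∈ F.stalkImage y ↔ ∀ χ, weightProj ρ χ x ∈ F.stalkImage y := by
  refine ⟨fun h χ => F.weightProj_mem_stalkImage χ h, fun h => ?_⟩
  have := Fintype.ofFinite (G →* ℂˣ)
  rw [← sum_weightProj (ρ := ρ) x]
  exact sum_mem fun χ _ => h χ

variable (F) [Finite G]

/-- The `χ`-Weil divisor of the weight `χ` part of a deformation. -/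
def weilDivisor (χ : G →* ℂˣ) : S.QDivisor :=
  Finsupp.ofSupportFinite
    (fun P => S.val P (F.exists_isLocalGenerator χ P.1).choose_spec.choose) (by
      -- A single generator near the generic point computes the coefficients at all prime divisors
      -- meeting `V`.
      obtain ⟨V, f, hV, hf⟩ := F.exists_isLocalGenerator χ (genericPoint S.Y)
      refine Resolution.finite_support_val hf.1 hf.2.1 hV _ fun P hP => ?_
      have h := (F.exists_isLocalGenerator χ P.1).choose_spec.choose_spec
      exact Resolution.val_eq_of_isLocalUnit_div hf.1 hf.2.1 h.2.2.1
        (hf.isLocalUnit_div h.2 hP h.1))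

variable {F}

lemma IsLocalGenerator.weilDivisor_apply {χ : G →* ℂˣ} {V : S.Y.Opens} {f : RatField n}
    (hf : F.IsLocalGenerator χ V f) {P : S.PrimeDivisor} (hP : P.1 ∈ V) :
    F.weilDivisor χ P = S.val P f := by
  have h := (F.exists_isLocalGenerator χ P.1).choose_spec.choose_spec
  exact Resolution.val_eq_of_isLocalUnit_div hf.1 hf.2.1 h.2.2.1 (hf.isLocalUnit_div h.2 hP h.1)

lemma IsLocalGenerator.isLocalEquation {χ : G →* ℂˣ} {V : S.Y.Opens} {f : RatField n}
    (hf : F.IsLocalGenerator χ V f) {y : S.Y} (hy : y ∈ V) :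
    S.IsLocalEquation χ (F.weilDivisor χ) y f :=
  ⟨hf.1, hf.2.1, V, hy, fun _ hP => hf.weilDivisor_apply hP⟩

omit [Finite G] in
lemma _root_.GOrbit.Resolution.isHomog_of_mem_negSections {χ : G →* ℂˣ} {D : S.QDivisor}
    {U : S.Y.Opens} (hU : genericPoint S.Y ∈ U) {s : RatField n} (hs : s ∈ S.negSections χ D U) :
    IsHomog ρ χ s := by
  obtain ⟨f, hf, a, rfl⟩ := hs _ hU
  exact hf.2.1.fieldEmb_mul _

/-- A local equation of the divisor has the same valuations near `y` as a local generator, so by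
normality they differ by a unit and span the same module. -/
lemma mem_negSections_weilDivisor {χ : G →* ℂˣ} {U : S.Y.Opens} (hU : genericPoint S.Y ∈ U)
    {s : RatField n} : s ∈ S.negSections χ (F.weilDivisor χ) U ↔
      IsHomog ρ χ s ∧ ∀ y ∈ U, s ∈ F.stalkImage y := by
  refine ⟨fun h => ⟨Resolution.isHomog_of_mem_negSections hU h, fun y hy => ?_⟩, fun h y hy => ?_⟩
  · obtain ⟨f, ⟨hf0, hf, V, hyV, hV⟩, a, rfl⟩ := h y hy
    obtain ⟨V', f', hyV', hf'⟩ := F.exists_isLocalGenerator χ y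
    refine F.mul_mem_stalkImage ⟨a, rfl⟩ ((hf'.mem_iff hyV' hf).mpr ?_)
    refine (Resolution.isLocalUnit_div hf'.1 hf0 hf'.2.1 hf (V := V ⊓ V') (fun P hP => ?_)
      (mem_inf_opens hyV hyV')).2.1
    rw [← hV P hP.1, hf'.weilDivisor_apply hP.2]
  · obtain ⟨V, f, hyV, hf⟩ := F.exists_isLocalGenerator χ y
    obtain ⟨a, ha⟩ := (hf.mem_iff hyV h.1).mp (h.2 y hy)
    exact ⟨f, hf.isLocalEquation hyV, a, by
      rw [← div_mul_cancel₀ s hf.1, ← ha]; rfl⟩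

variable (F) in
lemma isSum_weilDivisor : F.IsSum F.weilDivisor := by
  refine ⟨fun χ P f hf0 hf => ?_, fun U hU => Set.ext fun x => ?_⟩
  · obtain ⟨V, f', hyV, hf'⟩ := F.exists_isLocalGenerator χ P.1
    rw [hf'.weilDivisor_apply hyV]
    exact Resolution.exists_val_sub_fract_val P hf'.1 hf0 hf'.2.1 hf
  · rw [mem_range_embed]
    constructor
    · exact fun h => ⟨fun χ => weightProj ρ χ x, fun χ => (mem_negSections_weilDivisor hU).mpr
        ⟨isHomog_weightProj χ x, fun y hy => F.weightProj_mem_stalkImage χ (h y hy)⟩,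
        (finsum_weightProj x).symm⟩
    · rintro ⟨t, ht, rfl⟩ y hy
      have := Fintype.ofFinite (G →* ℂˣ)
      rw [finsum_eq_sum_of_fintype]
      exact sum_mem fun χ _ => ((mem_negSections_weilDivisor hU).mp (ht χ)).2 y hy

/-- The divisors of a deformation are determined by it. -/
lemma IsSum.eq_weilDivisor {D : (G →* ℂˣ) → S.QDivisor} (hD : F.IsSum D) : D = F.weilDivisor := by
  have hgen : ∀ {χ : G →* ℂˣ} {V : S.Y.Opens} {f : RatField n}, F.IsLocalGenerator χ V f →
      ∀ y ∈ V, f ∈ S.negSections χ (D χ) V := by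
    intro χ V f hf y hy
    have hη := genericPoint_mem hy
    have hmem : f ∈ S.sumNegSections D V := by
      rw [← hD.2 V hη, F.mem_range_embed hη]
      exact fun z hz => (hf.2.2 z hz).1
    obtain ⟨t, ht, rfl⟩ := hmem
    have h := weightProj_finsum (ρ := ρ)
      (fun χ => Resolution.isHomog_of_mem_negSections hη (ht χ)) χ
    rw [weightProj_of_isHomog hf.2.1] at h
    exact h ▸ ht χ
  -- Even for `0`, membership demands a local equation of `D χ` at each point; `hgen` supplies one.
  have hzero : ∀ (χ : G →* ℂˣ) (V : S.Y.Opens), (0 : RatField n) ∈ S.negSections χ (D χ) V := by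
    intro χ V y _
    obtain ⟨V, f, hyV, hf⟩ := F.exists_isLocalGenerator χ y
    obtain ⟨f', hf', -⟩ := hgen hf y hyV y hyV
    exact ⟨f', hf', 0, by rw [map_zero, zero_mul]⟩
  funext χ
  ext P
  obtain ⟨V, f, hPV, hf⟩ := F.exists_isLocalGenerator χ P.1
  obtain ⟨f', ⟨hf'0, hf', V', hPV', hV'⟩, a, ha⟩ := hgen hf P.1 hPV P.1 hPV
  -- So far `f = a f'` with `a` regular at `P`. Conversely, `f'` alone is a section of the sum, so
  -- it lies in the stalk of `F` and is a regular multiple of `f`.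
  have hf'neg : f' ∈ S.negSections χ (D χ) V' := fun z hz =>
    ⟨f', ⟨hf'0, hf', V', hz, hV'⟩, 1, by rw [map_one, one_mul]⟩
  have hf'mem : f' ∈ F.stalkImage P.1 := by
    have hη := genericPoint_mem hPV'
    refine (F.mem_range_embed hη).mp ?_ P.1 hPV'
    rw [hD.2 V' hη]
    classical
    refine ⟨Pi.single χ f', fun χ' => ?_, ?_⟩
    · by_cases h : χ' = χ
      · subst h; rwa [Pi.single_eq_same]
      · rw [Pi.single_eq_of_ne h]; exact hzero χ' V'
    · rw [finsum_eq_single _ χ fun χ' h => Pi.single_eq_of_ne h _, Pi.single_eq_same]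
  rw [hV' P hPV', hf.weilDivisor_apply hPV]
  refine Resolution.val_eq_of_isLocalUnit_div hf.1 hf.2.1 hf' ⟨div_ne_zero hf'0 hf.1,
    (hf.mem_iff hPV hf').mp hf'mem, ?_⟩
  rw [inv_div, ha, mul_div_cancel_right₀ _ hf'0]
  exact ⟨a, rfl⟩

/-- Two deformations differ near `V` by the factor `h` if and only if their divisors differ by
`(h)` there. -/
lemma weilDivisor_sub_eq_ord_iff {F F' : Deformation S} {V : S.Y.Opens} {h : S.Y.functionField}
    (hh : h ≠ 0) :
    (∀ χ, ∀ P : S.PrimeDivisor, P.1 ∈ V →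
      F'.weilDivisor χ P - F.weilDivisor χ P = Scheme.ord h P.1) ↔
    ∀ y ∈ V, ∀ x, x ∈ F.stalkImage y ↔ S.fieldEmb h * x ∈ F'.stalkImage y := by
  have hh' : S.fieldEmb h ≠ 0 := (map_ne_zero _).mpr hh
  constructor
  · intro H y hy x
    rw [mem_stalkImage_iff_weightProj, mem_stalkImage_iff_weightProj]
    refine forall_congr' fun χ => ?_
    rw [weightProj_fieldEmb_mul]
    obtain ⟨W, f, hyW, hf⟩ := F.exists_isLocalGenerator χ y
    obtain ⟨W', f', hyW', hf'⟩ := F'.exists_isLocalGenerator χ y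
    have hx := isHomog_weightProj (ρ := ρ) χ x
    rw [hf.mem_iff hyW hx, hf'.mem_iff hyW' (hx.fieldEmb_mul h)]
    -- The hypothesis says that `f'` and `h f` have equal valuations near `y`.
    have hu : IsLocalUnit S.fieldEmb y (f' / (S.fieldEmb h * f)) := by
      refine Resolution.isLocalUnit_div (mul_ne_zero hh' hf.1) hf'.1 (hf.2.1.fieldEmb_mul h)
        hf'.2.1 (V := V ⊓ (W ⊓ W')) (fun P hP => ?_) (mem_inf_opens hy (mem_inf_opens hyW hyW'))
      rw [Resolution.val_fieldEmb_mul P hh hf.1 hf.2.1, ← H χ P hP.1,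
        hf.weilDivisor_apply hP.2.1, hf'.weilDivisor_apply hP.2.2]
      ring
    have hf0 := hf.1
    have hf'0 := hf'.1
    constructor
    · intro hm
      convert mul_mem hm hu.2.2 using 1
      field_simp
    · intro hm
      convert mul_mem hm hu.2.1 using 1
      field_simp
  · intro H χ P hP
    obtain ⟨W, f, hyW, hf⟩ := F.exists_isLocalGenerator χ P.1
    obtain ⟨W', f', hyW', hf'⟩ := F'.exists_isLocalGenerator χ P.1
    rw [hf.weilDivisor_apply hyW, hf'.weilDivisor_apply hyW']
    have hhf := hf.2.1.fieldEmb_mul h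
    -- Both `h f` and `f'` generate the weight `χ` part of `F'` at `P`.
    have hv := Resolution.val_eq_of_isLocalUnit_div (P := P) (mul_ne_zero hh' hf.1) hhf hf'.2.1 (by
      refine ⟨div_ne_zero hf'.1 (mul_ne_zero hh' hf.1), ?_, ?_⟩
      · rw [← div_div]
        have hx : IsHomog ρ χ (f' / S.fieldEmb h) := by
          rw [div_eq_inv_mul, ← map_inv₀]
          exact hf'.2.1.fieldEmb_mul _
        refine (hf.mem_iff hyW hx).mp ((H _ hP _).mpr ?_)
        rw [mul_div_cancel₀ _ hh']
        exact (hf'.2.2 _ hyW').1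
      · rw [inv_div]
        exact (hf'.mem_iff hyW' hhf).mp ((H _ hP _).mp (hf.2.2 _ hyW).1))
    rw [hv, Resolution.val_fieldEmb_mul P hh hf.1 hf.2.1]
    ring

end Deformation

end LocalGenerators

/-! ### Recognising generators, and endomorphisms acting through maps of `K` -/

section Generator

variable {Y : Scheme.{0}} [IsIntegral Y] {K : Type} [Field K] {κ : Y.functionField →+* K}

/-- Quotients by the value of `l` lie in all the local rings, hence come from regular functions by
`exists_value_eq`. -/
lemma GenericEmbedding.isGenerator {L : Y.Modules} (j : GenericEmbedding κ L) {V : Y.Opens}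
    (hV : genericPoint Y ∈ V) {l : Γ(L, V)} (hl : j.emb V hV l ≠ 0)
    (H : ∀ z ∈ V, ∀ x ∈ j.stalkImage z, x / j.emb V hV l ∈ localSubring κ z) :
    IsGenerator l := by
  intro W hW
  by_cases hη : genericPoint Y ∈ W
  · refine ⟨fun r r' hr => value_injective (κ := κ) hη ?_, fun t => ?_⟩
    · have h1 := congrArg (j.emb W hη) hr
      simp only [j.emb_smul, j.emb_res] at h1
      exact mul_right_cancel₀ hl h1
    · obtain ⟨r, hr⟩ := exists_value_eq (κ := κ) hη (x := j.emb W hη t / j.emb V hV l)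
        fun z hz => H z (hW hz) _ (j.emb_mem_stalkImage hz hη t)
      refine ⟨r, j.emb_injective hη ?_⟩
      rw [j.emb_smul, j.emb_res, hr, div_mul_cancel₀ _ hl]
  · have := section_subsingleton (M := L) (notMem_of_genericPoint_notMem hη)
    have : Subsingleton Γ(Y, W) :=
      ⟨fun _ _ => sectionO_ext fun y hy => (notMem_of_genericPoint_notMem hη y hy).elim⟩
    exact ⟨fun _ _ _ => Subsingleton.elim _ _, fun _ => ⟨0, Subsingleton.elim _ _⟩⟩

namespace GenericEmbedding

variable {M M' : Y.Modules}

/-- The endomorphism `φ` acts through the map `f` of `K`. -/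
def ActsBy (j : GenericEmbedding κ M) (φ : M ⟶ M) (f : K → K) : Prop :=
  ∀ (U : Y.Opens) (hU : genericPoint Y ∈ U) (s : Γ(M, U)),
    j.emb U hU (φ.app U s) = f (j.emb U hU s)

variable {j : GenericEmbedding κ M} {j' : GenericEmbedding κ M'} {φ : M ⟶ M} {φ' : M' ⟶ M'}
  {f : K → K}

lemma ActsBy.scale (h : j.ActsBy φ f) (c : K) (hc : c ≠ 0) (hf : ∀ x, f (c * x) = c * f x) :
    (j.scale c hc).ActsBy φ f := fun U hU s => by
  rw [scale_emb, h, scale_emb, hf]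

lemma ActsBy.comap (h : j'.ActsBy φ' f) (e : M ≅ M') (he : φ ≫ e.hom = e.hom ≫ φ') :
    (j'.comap e).ActsBy φ f := fun U hU s => by
  have h1 : e.hom.app U (φ.app U s) = φ'.app U (e.hom.app U s) :=
    ConcreteCategory.congr_hom (congrArg (fun ψ => Scheme.Modules.Hom.app ψ U) he) s
  exact (congrArg _ h1).trans (h U hU _)

lemma ActsBy.comp_isoOfEq (h : j.ActsBy φ f) (h' : j'.ActsBy φ' f)
    (H : ∀ y, j.stalkImage y = j'.stalkImage y) :
    φ ≫ (isoOfEq H).hom = (isoOfEq H).hom ≫ φ' := hom_eq j' fun U hU s => by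
  rw [Scheme.Modules.Hom.comp_app, Scheme.Modules.Hom.comp_app, ConcreteCategory.comp_apply,
    ConcreteCategory.comp_apply, h', emb_isoOfEq, emb_isoOfEq, h]

end GenericEmbedding

end Generator

/-! ### Isomorphism and equivalence in terms of stalks -/

section Isomorphisms

variable {n : ℕ} {G : Type*} [CommGroup G] [Finite G] {ρ : G →* GL (Fin n) ℂ} {S : Resolution ρ}

namespace Deformation

omit [Finite G] in
lemma actsBy_actG (F : Deformation S) (g : G) :
    F.genericEmbedding.ActsBy (F.actG g) (ratAct ρ g) := fun _ hU s => F.emb_actG g hU s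

omit [Finite G] in
lemma actsBy_actR (F : Deformation S) (f : PolyRing n) :
    F.genericEmbedding.ActsBy (F.actR f) (algebraMap _ _ f * ·) := fun _ hU s => F.emb_actR f hU s

/-- Any equivariant embedding of a deformation into `K(ℂⁿ)` differs from the given one by a
factor in `K(Y)`. -/
lemma exists_emb_eq_fieldEmb_mul (F : Deformation S) (j : GenericEmbedding S.fieldEmb F.sheaf)
    (hG : ∀ g : G, j.ActsBy (F.actG g) (ratAct ρ g))
    (hR : ∀ f : PolyRing n, j.ActsBy (F.actR f) (algebraMap _ _ f * ·)) :
    ∃ h : S.Y.functionField, h ≠ 0 ∧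
      ∀ y x, x ∈ F.stalkImage y ↔ S.fieldEmb h * x ∈ j.stalkImage y := by
  obtain ⟨c, hc0, -, hc⟩ := GenericEmbedding.exists_emb_eq_mul F.actR F.genericEmbedding j
    F.actsBy_actR hR (F.mem_stalkImage_genericPoint 1)
  -- On a section of value `1`, equivariance of `j` says that `c` is invariant.
  obtain ⟨U, hU, s, hs⟩ := F.mem_stalkImage_genericPoint 1
  obtain ⟨h, rfl⟩ := S.exists_fieldEmb_eq (x := c) fun g => by
    have h1 := hG g U hU s
    rw [hc, hc, F.emb_actG, hs, map_one, mul_one] at h1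
    exact h1.symm
  refine ⟨h, fun h0 => hc0 (by rw [h0, map_zero]), fun y x => ⟨?_, ?_⟩⟩
  · rintro ⟨U, hy, s, rfl⟩
    exact ⟨U, hy, s, hc U _ s⟩
  · rintro ⟨U, hy, s, hs⟩
    rw [hc] at hs
    exact ⟨U, hy, s, mul_left_cancel₀ hc0 hs⟩

/-- An isomorphism pulls the embedding of `F'` back to a second equivariant embedding of `F`,
proportional to the first. Conversely, the embedding of `F` scaled by `h` has the same image as that
of `F'`. -/
lemma isomorphic_iff (F F' : Deformation S) : F.Isomorphic F'.toGRFamily ↔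
    ∃ h : S.Y.functionField, h ≠ 0 ∧
      ∀ y x, x ∈ F.stalkImage y ↔ S.fieldEmb h * x ∈ F'.stalkImage y := by
  constructor
  · rintro ⟨e, heG, heR⟩
    obtain ⟨h, h0, H⟩ := F.exists_emb_eq_fieldEmb_mul (F'.genericEmbedding.comap e)
      (fun g => (F'.actsBy_actG g).comap e (heG g)) (fun f => (F'.actsBy_actR f).comap e (heR f))
    refine ⟨h, h0, fun y x => ?_⟩
    rw [H, GenericEmbedding.stalkImage_comap]
    rfl
  · rintro ⟨h, h0, H⟩
    have hh : S.fieldEmb h ≠ 0 := (map_ne_zero _).mpr h0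
    have Heq : ∀ y, (F.genericEmbedding.scale (S.fieldEmb h) hh).stalkImage y =
        F'.genericEmbedding.stalkImage y := fun y => by
      ext x
      rw [GenericEmbedding.mem_stalkImage_scale]
      constructor
      · rintro ⟨z, hz, rfl⟩
        exact (H y z).mp hz
      · exact fun hx => ⟨(S.fieldEmb h)⁻¹ * x,
          (H y _).mpr (by rwa [mul_inv_cancel_left₀ hh]), by rw [mul_inv_cancel_left₀ hh]⟩
    exact ⟨GenericEmbedding.isoOfEq Heq,
      fun g => ((F.actsBy_actG g).scale _ hh fun x => by rw [map_mul, S.ratAct_fieldEmb]).comp_isoOfEq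
        (F'.actsBy_actG g) Heq,
      fun f => ((F.actsBy_actR f).scale _ hh fun x => mul_left_comm _ _ _).comp_isoOfEq
        (F'.actsBy_actR f) Heq⟩

omit [Finite G] in
lemma isomorphicAsDeformation_of_eq {F F' : Deformation S}
    (H : ∀ y, F.stalkImage y = F'.stalkImage y) : F.IsomorphicAsDeformation F' := by
  refine ⟨GenericEmbedding.isoOfEq H,
    ⟨fun g => (F.actsBy_actG g).comp_isoOfEq (F'.actsBy_actG g) H,
      fun f => (F.actsBy_actR f).comp_isoOfEq (F'.actsBy_actR f) H⟩, fun m => ?_⟩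
  obtain ⟨U, hU, s, rfl⟩ := F.sheaf.presheaf.exists_germ_eq m
  rw [stalkAddHom_germ]
  exact GenericEmbedding.emb_isoOfEq H hU s

/-- Locally on `Y`, the deformations differ by a factor in `K(Y)`. -/
def IsLocallyProportional (F F' : Deformation S) : Prop :=
  ∀ y, ∃ (V : S.Y.Opens) (h : S.Y.functionField), y ∈ V ∧ h ≠ 0 ∧
    ∀ z ∈ V, ∀ x, x ∈ F.stalkImage z ↔ S.fieldEmb h * x ∈ F'.stalkImage z

omit [Finite G] in
lemma actsBy_tensorSheafMap_actG (F : Deformation S) {L : S.Y.Modules} {U₀ : S.Y.Opens}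
    {l₀ : Γ(L, U₀)} (hl₀ : IsGenerator l₀) (hU₀ : genericPoint S.Y ∈ U₀) (hL : IsInvertible L)
    (g : G) : (tensorEmbedding F.genericEmbedding hl₀ hU₀ hL).ActsBy
      (tensorSheafMap (F.actG g) L) (ratAct ρ g) :=
  tensorEmb_map F.genericEmbedding hl₀ hU₀ (F.actG g) (F.actsBy_actG g)

omit [Finite G] in
lemma actsBy_tensorSheafMap_actR (F : Deformation S) {L : S.Y.Modules} {U₀ : S.Y.Opens}
    {l₀ : Γ(L, U₀)} (hl₀ : IsGenerator l₀) (hU₀ : genericPoint S.Y ∈ U₀) (hL : IsInvertible L)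
    (f : PolyRing n) : (tensorEmbedding F.genericEmbedding hl₀ hU₀ hL).ActsBy
      (tensorSheafMap (F.actR f) L) (algebraMap _ _ f * ·) :=
  tensorEmb_map F.genericEmbedding hl₀ hU₀ (F.actR f) (F.actsBy_actR f)

variable {F F' : Deformation S}

/-- As in `isomorphic_iff`, with `F' ⊗ L` embedded through a trivialisation of `L` at the generic
point. Passing to a trivialisation near `y` divides the global factor `h` by the transition function
`w`. -/
lemma IsLocallyProportional.of_equivalent (H : F.Equivalent F'.toGRFamily) :
    F.IsLocallyProportional F' := by
  obtain ⟨L, hL, e, heG, heR⟩ := H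
  obtain ⟨U₀, hU₀, hfree⟩ := hL (genericPoint S.Y)
  obtain ⟨l₀, hl₀⟩ := exists_isGenerator hfree
  let j := tensorEmbedding F'.genericEmbedding hl₀ hU₀ hL
  obtain ⟨h, h0, H⟩ := F.exists_emb_eq_fieldEmb_mul (j.comap e)
    (fun g => (F'.actsBy_tensorSheafMap_actG hl₀ hU₀ hL g).comap e (heG g))
    (fun f => (F'.actsBy_tensorSheafMap_actR hl₀ hU₀ hL f).comap e (heR f))
  intro y
  obtain ⟨V, hyV, hV⟩ := hL y
  obtain ⟨l, hl⟩ := exists_isGenerator hV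
  have hη : genericPoint S.Y ∈ V ⊓ U₀ := mem_inf_opens (genericPoint_mem hyV) hU₀
  obtain ⟨u, hu, hu0⟩ := exists_unit_of_isGenerator (κ := S.fieldEmb) hl hl₀ hη
  let w : S.Y.functionField := S.Y.presheaf.germ _ _ hη u
  have hw : value S.fieldEmb hη u = S.fieldEmb w := rfl
  rw [hw] at hu0
  have hw0 : w ≠ 0 := fun h0 => hu0 (by rw [h0, map_zero])
  refine ⟨V, w⁻¹ * h, hyV, mul_ne_zero (inv_ne_zero hw0) h0, fun z hz x => ?_⟩
  rw [H, GenericEmbedding.stalkImage_comap, mem_stalkImage_tensorEmbedding _ _ _ _ hl hη u hu hz,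
    hw, map_mul, map_inv₀]
  constructor
  · rintro ⟨t, ht, hxt⟩
    rw [mul_assoc, hxt, inv_mul_cancel_left₀ hu0]
    exact ht
  · exact fun hx => ⟨_, hx, by rw [mul_assoc, mul_inv_cancel_left₀ hu0]⟩

variable (F F') in
/-- The elements of `K(Y)` mapping `F'` into `F` at `z`. -/
def ratio (z : S.Y) : AddSubgroup (RatField n) where
  carrier := {x | x ∈ S.fieldEmb.range ∧ ∀ m ∈ F'.stalkImage z, x * m ∈ F.stalkImage z}
  zero_mem' := ⟨zero_mem _, fun m _ => by rw [zero_mul]; exact zero_mem _⟩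
  add_mem' ha hb := ⟨add_mem ha.1 hb.1, fun m hm => by
    rw [add_mul]; exact add_mem (ha.2 m hm) (hb.2 m hm)⟩
  neg_mem' ha := ⟨neg_mem ha.1, fun m hm => by rw [neg_mul]; exact neg_mem (ha.2 m hm)⟩

omit [Finite G] in
lemma mul_mem_ratio (y : S.Y) (a : RatField n) (ha : a ∈ localSubring S.fieldEmb y)
    (x : RatField n) (hx : x ∈ ratio F F' y) : a * x ∈ ratio F F' y := by
  refine ⟨mul_mem ?_ hx.1, fun m hm => ?_⟩
  · obtain ⟨b, rfl⟩ := ha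
    exact ⟨_, rfl⟩
  · rw [mul_assoc]
    exact F.mul_mem_stalkImage ha (hx.2 m hm)

/-- If `k` maps `F'` into `F` then `hk` maps `F'` into itself. Testing on a generator of the
invariants of `F'` shows that `hk` is regular. -/
lemma mem_ratio_iff {z : S.Y} {h : S.Y.functionField} (h0 : h ≠ 0)
    (H : ∀ x, x ∈ F.stalkImage z ↔ S.fieldEmb h * x ∈ F'.stalkImage z) (x : RatField n) :
    x ∈ ratio F F' z ↔ x / (S.fieldEmb h)⁻¹ ∈ localSubring S.fieldEmb z := by
  have hh : S.fieldEmb h ≠ 0 := (map_ne_zero _).mpr h0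
  rw [div_inv_eq_mul]
  constructor
  · rintro ⟨⟨k, rfl⟩, hx⟩
    obtain ⟨V, f, hzV, hf⟩ := F'.exists_isLocalGenerator 1 z
    have h1 := (H _).mp (hx f (hf.2.2 z hzV).1)
    have h2 := (hf.mem_iff hzV ((hf.2.1.fieldEmb_mul k).fieldEmb_mul h)).mp h1
    rwa [← mul_assoc, mul_div_cancel_right₀ _ hf.1, mul_comm] at h2
  · intro hx
    refine ⟨?_, fun m hm => (H _).mpr ?_⟩
    · obtain ⟨b, hb⟩ := hx
      refine ⟨algebraMap _ S.Y.functionField b * h⁻¹, ?_⟩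
      rw [RingHom.comp_apply] at hb
      rw [map_mul, map_inv₀, hb, mul_inv_cancel_right₀ hh]
    · rw [← mul_assoc, mul_comm _ x]
      exact F'.mul_mem_stalkImage hx hm

/-- The twisting sheaf `L` consists of the `x ∈ K(Y)` with `x F' ⊆ F`. It is generated by `h⁻¹` near
each point, and multiplication identifies `F' ⊗ L` with `F`. -/
lemma IsLocallyProportional.equivalent (H : F.IsLocallyProportional F') :
    F.Equivalent F'.toGRFamily := by
  let L := subSheaf S.fieldEmb (ratio F F') mul_mem_ratio
  let jL : GenericEmbedding S.fieldEmb L := subSheafEmbedding S.fieldEmb (ratio F F') mul_mem_ratio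
  have hgen : ∀ y, ∃ (V : S.Y.Opens) (hy : y ∈ V) (h : S.Y.functionField) (l : Γ(L, V)), h ≠ 0 ∧
      IsGenerator l ∧ jL.emb V (genericPoint_mem hy) l = (S.fieldEmb h)⁻¹ ∧
      ∀ x, x ∈ F.stalkImage y ↔ S.fieldEmb h * x ∈ F'.stalkImage y := by
    intro y
    obtain ⟨V, h, hyV, h0, hV⟩ := H y
    have hh : S.fieldEmb h ≠ 0 := (map_ne_zero _).mpr h0
    obtain ⟨l, hl⟩ := exists_subSheaf_section (κ := S.fieldEmb) (N := ratio F F')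
      (hN := mul_mem_ratio) (genericPoint_mem hyV) (x := (S.fieldEmb h)⁻¹) (fun z hz => by
        rw [mem_ratio_iff h0 (hV z hz), div_self (inv_ne_zero hh)]
        exact one_mem _)
    have hl' : jL.emb V (genericPoint_mem hyV) l = (S.fieldEmb h)⁻¹ := hl
    refine ⟨V, hyV, h, l, h0, jL.isGenerator (genericPoint_mem hyV) ?_ fun z hz x hx => ?_, hl',
      hV y hyV⟩
    · rw [hl']; exact inv_ne_zero hh
    · rw [hl']
      obtain ⟨U, hzU, hU⟩ := mem_stalkImage_subSheaf.mp hx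
      exact (mem_ratio_iff h0 (hV z hz) x).mp (hU z hzU)
  have hL : IsInvertible L := fun y => by
    obtain ⟨V, hy, h, l, -, hl, -⟩ := hgen y
    exact ⟨V, hy, isFreeOn_of_isGenerator hl⟩
  obtain ⟨U₀, hU₀, h₀, l₀, h₀0, hl₀, hl₀h, -⟩ := hgen (genericPoint S.Y)
  have hh₀ : (S.fieldEmb h₀)⁻¹ ≠ 0 := inv_ne_zero ((map_ne_zero _).mpr h₀0)
  -- `tensorEmbedding` treats `l₀` as `1`; scaling by its actual value `h₀⁻¹` makes this the
  -- multiplication map `F' ⊗ L → K(ℂⁿ)`.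
  let j' := (tensorEmbedding F'.genericEmbedding hl₀ hU₀ hL).scale _ hh₀
  have Heq : ∀ y, F.genericEmbedding.stalkImage y = j'.stalkImage y := by
    intro y
    obtain ⟨V, hy, h, l, h0, hl, hlh, hF⟩ := hgen y
    have hh : S.fieldEmb h ≠ 0 := (map_ne_zero _).mpr h0
    have hη : genericPoint S.Y ∈ V ⊓ U₀ := mem_inf_opens (genericPoint_mem hy) hU₀
    obtain ⟨u, hu, hu0⟩ := exists_unit_of_isGenerator (κ := S.fieldEmb) hl hl₀ hη
    have hw := congrArg (jL.emb _ hη) hu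
    rw [jL.emb_smul, jL.emb_res, jL.emb_res, hlh, hl₀h] at hw
    ext x
    rw [GenericEmbedding.mem_stalkImage_scale]
    refine (hF x).trans ⟨fun hx => ?_, ?_⟩
    · refine ⟨_, (mem_stalkImage_tensorEmbedding _ _ _ _ hl hη u hu hy _).mpr ⟨_, hx, rfl⟩, ?_⟩
      rw [← mul_assoc, mul_comm _ (value _ _ _), ← hw, inv_mul_cancel_left₀ hh]
    · rintro ⟨_, ht, rfl⟩
      obtain ⟨z, hz, rfl⟩ := (mem_stalkImage_tensorEmbedding _ _ _ _ hl hη u hu hy _).mp ht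
      rw [← mul_assoc _ _ z, mul_comm _ (value _ _ _), ← hw, mul_inv_cancel_left₀ hh]
      exact hz
  exact ⟨L, hL, GenericEmbedding.isoOfEq Heq,
    fun g => (F.actsBy_actG g).comp_isoOfEq ((F'.actsBy_tensorSheafMap_actG hl₀ hU₀ hL g).scale _ hh₀
      fun x => by rw [map_mul, ← map_inv₀, S.ratAct_fieldEmb]) Heq,
    fun f => (F.actsBy_actR f).comp_isoOfEq ((F'.actsBy_tensorSheafMap_actR hl₀ hU₀ hL f).scale _ hh₀
      fun x => mul_left_comm _ _ _) Heq⟩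

end Deformation

end Isomorphisms

/-! ### Transport of frames, fibres and endomorphisms between proportional sheaves -/

section Transport

variable {Y : Scheme.{0}} {M M' : Y.Modules}

lemma IsFreeOn.mono {U V : Y.Opens} (h : V ≤ U) {m : ℕ} (hM : IsFreeOn M U m) : IsFreeOn M V m := by
  obtain ⟨e, he⟩ := hM
  refine ⟨fun i => res h (e i), fun W hW => ?_⟩
  have h1 : (fun i => M.presheaf.map (homOfLE hW).op (res h (e i))) =
      fun i => M.presheaf.map (homOfLE (hW.trans h)).op (e i) :=
    funext fun i => res_res h hW (e i)
  rw [h1]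
  exact he W (hW.trans h)

lemma baseChange_fibreMap {y : Y} (ψ : M.presheaf.stalk y ≃ₗ[Y.presheaf.stalk y] M'.presheaf.stalk y)
    {φ : M ⟶ M} {φ' : M' ⟶ M'}
    (H : ∀ m, ψ (stalkLinearMap φ y m) = stalkLinearMap φ' y (ψ m)) (v : Fibre M y) :
    ψ.baseChange (Y.presheaf.stalk y) (ResField Y y) _ _ (fibreMap φ y v) =
      fibreMap φ' y (ψ.baseChange (Y.presheaf.stalk y) (ResField Y y) _ _ v) := by
  induction v using TensorProduct.induction_on with
  | zero => simp only [map_zero]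
  | add a b ha hb => simp only [map_add, ha, hb]
  | tmul a m => exact congrArg (fun t => a ⊗ₜ[Y.presheaf.stalk y] t) (H m)

variable [IsIntegral Y] {K : Type} [Field K] {κ : Y.functionField →+* K}

namespace GenericEmbedding

variable (j : GenericEmbedding κ M) (j' : GenericEmbedding κ M')

section EndOfMap

variable (f : K →+ K) (hf : ∀ y, ∀ x ∈ j.stalkImage y, f x ∈ j.stalkImage y)
  (hlin : ∀ a x, f (κ a * x) = κ a * f x)

include hf in
lemma exists_section_map (U : Y.Opens) (s : Γ(M, U)) :
    ∃ t : Γ(M, U), ∀ hU : genericPoint Y ∈ U, j.emb U hU t = f (j.emb U hU s) := by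
  by_cases hU : genericPoint Y ∈ U
  · obtain ⟨t, ht⟩ := j.exists_emb_eq hU (x := f (j.emb U hU s))
      fun y hy => hf y _ (j.emb_mem_stalkImage hy hU s)
    exact ⟨t, fun _ => ht⟩
  · exact ⟨0, fun h => (hU h).elim⟩

/-- The endomorphism given by a linear map of `K` which preserves all stalks. -/
def endOfMap : M ⟶ M :=
  have hc := fun U s => (j.exists_section_map f hf U s).choose_spec
  homMk (fun U =>
    { toFun := fun s => (j.exists_section_map f hf U s).choose
      map_add' := fun s t => section_eq j fun hU => by
        rw [map_add, hc, hc, hc, map_add, map_add]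
      map_smul' := fun r t => section_eq j fun hU => by
        rw [RingHom.id_apply, emb_smul, hc, hc, emb_smul]
        exact hlin _ _ })
    (fun h s => section_eq j fun hV => by
      change j.emb _ hV (Exists.choose _) = j.emb _ hV (res h (Exists.choose _))
      rw [emb_res, hc, hc, emb_res])

lemma actsBy_endOfMap : j.ActsBy (j.endOfMap f hf hlin) f := fun U hU s =>
  (j.exists_section_map f hf U s).choose_spec hU

end EndOfMap

variable {j j'}

lemma ActsBy.hom_eq {φ ψ : M ⟶ M} {f g : K → K} (h : j.ActsBy φ f) (h' : j.ActsBy ψ g)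
    (H : ∀ x, f x = g x) : φ = ψ := GenericEmbedding.hom_eq j fun U hU s => by rw [h, h', H]

lemma ActsBy.comp {φ ψ : M ⟶ M} {f g : K → K} (h : j.ActsBy φ f) (h' : j.ActsBy ψ g) :
    j.ActsBy (φ ≫ ψ) (g ∘ f) := fun U hU s => by
  rw [Scheme.Modules.Hom.comp_app, ConcreteCategory.comp_apply, h', h]
  rfl

lemma ActsBy.add {φ ψ : M ⟶ M} {f g : K → K} (h : j.ActsBy φ f) (h' : j.ActsBy ψ g) :
    j.ActsBy (φ + ψ) (fun x => f x + g x) := fun U hU s => by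
  exact (map_add (j.emb U hU) (φ.app U s) (ψ.app U s)).trans
    (congrArg₂ (· + ·) (h U hU s) (h' U hU s))

variable (j) in
lemma actsBy_zero : j.ActsBy (0 : M ⟶ M) fun _ => 0 := fun U hU _ => map_zero (j.emb U hU)

variable (j) in
lemma actsBy_id : j.ActsBy (𝟙 M) id := fun _ _ _ => rfl

/-- Multiplication by `c` identifies the sections over each non-empty `V ≤ W`, so the frame `e` of
`M'` yields the frame `c⁻¹ e` of `M`. -/
lemma isFreeOn_of_mem_iff {W : Y.Opens} {c : K} (hc : c ≠ 0)
    (H : ∀ z ∈ W, ∀ x, x ∈ j.stalkImage z ↔ c * x ∈ j'.stalkImage z) {m : ℕ}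
    (hM : IsFreeOn M' W m) : IsFreeOn M W m := by
  obtain ⟨e, he⟩ := hM
  have hex : ∀ i, ∃ t : Γ(M, W), ∀ hW : genericPoint Y ∈ W, c * j.emb W hW t = j'.emb W hW (e i) := by
    intro i
    by_cases hW : genericPoint Y ∈ W
    · obtain ⟨t, ht⟩ := j.exists_emb_eq hW (x := c⁻¹ * j'.emb W hW (e i)) fun z hz => by
        rw [H z hz, mul_inv_cancel_left₀ hc]
        exact j'.emb_mem_stalkImage hz hW _
      exact ⟨t, fun _ => by rw [ht, mul_inv_cancel_left₀ hc]⟩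
    · exact ⟨0, fun h => (hW h).elim⟩
  choose t ht using hex
  refine ⟨t, fun V hV => ?_⟩
  change LinearIndependent Γ(Y, V) (fun i => res hV (t i)) ∧
    Submodule.span Γ(Y, V) (Set.range fun i => res hV (t i)) = ⊤
  obtain ⟨hli, hsp⟩ := he V hV
  by_cases hη : genericPoint Y ∈ V
  · have key : ∀ r : Fin m → Γ(Y, V), c * j.emb V hη (∑ i, r i • res hV (t i)) =
        j'.emb V hη (∑ i, r i • res hV (e i)) := fun r => by
      rw [map_sum, map_sum, Finset.mul_sum]
      refine Finset.sum_congr rfl fun i _ => ?_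
      rw [emb_smul, emb_smul, emb_res, emb_res, ← ht i (hV hη), mul_left_comm]
    constructor
    · refine Fintype.linearIndependent_iff.mpr fun r hr => ?_
      have h1 := key r
      rw [hr, map_zero, mul_zero] at h1
      exact Fintype.linearIndependent_iff.mp hli r
        (j'.emb_injective hη (h1.symm.trans (map_zero _).symm))
    · refine Submodule.eq_top_iff'.mpr fun s => ?_
      obtain ⟨s', hs'⟩ := j'.exists_emb_eq hη (x := c * j.emb V hη s) fun z hz =>
        (H z (hV hz) _).mp (j.emb_mem_stalkImage hz hη s)
      obtain ⟨r, hr⟩ := (Submodule.mem_span_range_iff_exists_fun _).mp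
        (hsp ▸ Submodule.mem_top : s' ∈ Submodule.span _ _)
      refine (Submodule.mem_span_range_iff_exists_fun _).mpr ⟨r, j.emb_injective hη ?_⟩
      refine mul_left_cancel₀ hc ((key r).trans ?_)
      rw [← hs', ← hr]
      rfl
  · have := section_subsingleton (M := M) (notMem_of_genericPoint_notMem hη)
    have : Subsingleton Γ(Y, V) :=
      ⟨fun _ _ => sectionO_ext fun y hy => (notMem_of_genericPoint_notMem hη y hy).elim⟩
    exact ⟨linearIndependent_of_subsingleton, Subsingleton.elim _ _⟩

lemma exists_stalk_equiv {y : Y} {c : K} (hc : c ≠ 0)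
    (H : ∀ x, x ∈ j.stalkImage y ↔ c * x ∈ j'.stalkImage y) :
    ∃ ψ : M.presheaf.stalk y ≃ₗ[Y.presheaf.stalk y] M'.presheaf.stalk y,
      ∀ m, j'.stalkMap y (ψ m) = c * j.stalkMap y m := by
  have hex : ∀ m, ∃ m', j'.stalkMap y m' = c * j.stalkMap y m := fun m =>
    (j'.range_stalkMap y _).mpr ((H _).mp ((j.range_stalkMap y _).mp ⟨m, rfl⟩))
  choose f hf using hex
  have hinj := j'.stalkMap_injective y
  let ψ : M.presheaf.stalk y →ₗ[Y.presheaf.stalk y] M'.presheaf.stalk y :=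
    { toFun := f
      map_add' := fun a b => hinj (by rw [map_add, hf, hf, hf, map_add, mul_add])
      map_smul' := fun r a => hinj (by
        rw [RingHom.id_apply, hf, stalkMap_smul, stalkMap_smul, hf, mul_left_comm]) }
  refine ⟨LinearEquiv.ofBijective ψ ⟨fun a b hab => ?_, fun m' => ?_⟩, hf⟩
  · refine j.stalkMap_injective y (mul_left_cancel₀ hc ?_)
    rw [← hf, ← hf]
    exact congrArg _ hab
  · obtain ⟨m, hm⟩ := (j.range_stalkMap y (c⁻¹ * j'.stalkMap y m')).mpr
      ((H _).mpr (by rw [mul_inv_cancel_left₀ hc]; exact (j'.range_stalkMap y _).mp ⟨m', rfl⟩))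
    exact ⟨m, hinj ((hf m).trans (by rw [hm, mul_inv_cancel_left₀ hc]))⟩

end GenericEmbedding

end Transport

/-! ### A subsheaf locally proportional to a deformation is a deformation -/

section Twist

variable {n : ℕ} {G : Type*} [CommGroup G] {ρ : G →* GL (Fin n) ℂ} {S : Resolution ρ}

namespace Deformation

variable (F : Deformation S) {M : S.Y.Modules} (j : GenericEmbedding S.fieldEmb M)
  (H : ∀ y, ∃ (V : S.Y.Opens) (h : S.Y.functionField), y ∈ V ∧ h ≠ 0 ∧
    ∀ z ∈ V, ∀ x, x ∈ j.stalkImage z ↔ S.fieldEmb h * x ∈ F.stalkImage z)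

include H

/-- The factor `h` lies in `K(Y)`, hence is fixed by `G`, so stability passes from `F` to the
proportional sheaf. -/
lemma twist_ratAct (g : G) (y : S.Y) (x : RatField n) (hx : x ∈ j.stalkImage y) :
    (ratAct ρ g : RatField n →+ RatField n) x ∈ j.stalkImage y := by
  obtain ⟨V, h, hy, -, hV⟩ := H y
  refine (hV y hy _).mpr ?_
  have := F.ratAct_mem_stalkImage g ((hV y hy _).mp hx)
  rwa [map_mul, S.ratAct_fieldEmb] at this

lemma twist_mul (f : PolyRing n) (y : S.Y) (x : RatField n) (hx : x ∈ j.stalkImage y) :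
    AddMonoidHom.mulLeft (algebraMap _ (RatField n) f) x ∈ j.stalkImage y := by
  obtain ⟨V, h, hy, -, hV⟩ := H y
  obtain ⟨U, hyU, s, hs⟩ := (hV y hy _).mp hx
  refine (hV y hy _).mpr ⟨U, hyU, Scheme.Modules.Hom.app (F.actR f) U s, ?_⟩
  rw [emb_actR, hs, AddMonoidHom.coe_mulLeft, mul_left_comm]

/-- The action of `G` on a sheaf which is locally proportional to a deformation. -/
def twistG (g : G) : End M :=
  j.endOfMap (ratAct ρ g : RatField n →+ RatField n) (F.twist_ratAct j H g)
    (fun a x => (map_mul (ratAct ρ g) _ _).trans (by rw [S.ratAct_fieldEmb]; rfl))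

/-- The action of `R` on a sheaf which is locally proportional to a deformation. -/
def twistR (f : PolyRing n) : End M :=
  j.endOfMap (AddMonoidHom.mulLeft (algebraMap _ (RatField n) f)) (F.twist_mul j H f)
    (fun _ _ => mul_left_comm _ _ _)

lemma actsBy_twistG (g : G) : j.ActsBy (F.twistG j H g) (ratAct ρ g) := j.actsBy_endOfMap _ _ _

lemma actsBy_twistR (f : PolyRing n) : j.ActsBy (F.twistR j H f) (algebraMap _ _ f * ·) :=
  j.actsBy_endOfMap _ _ _

/-- A subsheaf of `K(ℂⁿ)` which is locally proportional to a deformation, as a family. -/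
def twistFamily : GRFamily S where
  sheaf := M
  locallyFree y := by
    obtain ⟨V, h, hy, h0, hV⟩ := H y
    obtain ⟨U, hyU, m, hU⟩ := F.locallyFree y
    refine ⟨V ⊓ U, ⟨hy, hyU⟩, m, GenericEmbedding.isFreeOn_of_mem_iff (j := j)
      (j' := F.genericEmbedding) ((map_ne_zero S.fieldEmb).mpr h0) (W := V ⊓ U) (fun z hz => hV z hz.1)
      (hU.mono inf_le_right)⟩
  actG :=
    { toFun := F.twistG j H
      map_one' := (F.actsBy_twistG j H 1).hom_eq j.actsBy_id ratAct_one
      map_mul' := fun g g' => (F.actsBy_twistG j H _).hom_eq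
        ((F.actsBy_twistG j H g').comp (F.actsBy_twistG j H g)) (ratAct_mul g g') }
  actR :=
    { toFun := F.twistR j H
      map_one' := (F.actsBy_twistR j H 1).hom_eq j.actsBy_id fun x => by
        rw [map_one, one_mul]; rfl
      map_mul' := fun f f' => (F.actsBy_twistR j H _).hom_eq
        ((F.actsBy_twistR j H f').comp (F.actsBy_twistR j H f)) fun x => by
          rw [map_mul, mul_assoc]; rfl
      map_zero' := (F.actsBy_twistR j H 0).hom_eq j.actsBy_zero fun x => by
        rw [map_zero, zero_mul]
      map_add' := fun f f' => (F.actsBy_twistR j H _).hom_eq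
        ((F.actsBy_twistR j H f).add (F.actsBy_twistR j H f')) fun x => by
          rw [map_add, add_mul] }
  actR_const c U s := GenericEmbedding.section_eq j fun hU => by
    rw [j.emb_smul, S.fieldEmb_germ_const c hU]
    exact F.actsBy_twistR j H _ U hU s
  equivariant g f := ((F.actsBy_twistR j H f).comp (F.actsBy_twistG j H g)).hom_eq
    ((F.actsBy_twistG j H g).comp (F.actsBy_twistR j H (polyAct ρ g f))) fun x => by
      simp only [Function.comp_apply, map_mul, ratAct_algebraMap]

/-- Multiplication by the invariant factor `h` is an equivariant isomorphism of stalks, and carries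
the permuted basis back to the fibre of `M`. -/
lemma twistFamily_isConstellation : (F.twistFamily j H).IsConstellation := by
  intro y
  obtain ⟨V, h, hy, h0, hV⟩ := H y
  obtain ⟨b, hb⟩ := F.isConstellation y
  obtain ⟨ψ, hψ⟩ := GenericEmbedding.exists_stalk_equiv (j := j) (j' := F.genericEmbedding)
    ((map_ne_zero S.fieldEmb).mpr h0) (hV y hy)
  have hcomm : ∀ g m, ψ (stalkLinearMap (F.twistG j H g) y m) =
      stalkLinearMap (F.actG g) y (ψ m) := fun g m => by
    apply F.genericEmbedding.stalkMap_injective y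
    rw [hψ, stalkMap_actG, hψ, map_mul, S.ratAct_fieldEmb]
    congr 1
    exact GenericEmbedding.stalkMap_stalkAddHom j j (F.actsBy_twistG j H g) y m
  let E : Fibre M y ≃ₗ[ResField S.Y y] Fibre F.sheaf y :=
    ψ.baseChange (S.Y.presheaf.stalk y) (ResField S.Y y) _ _
  have hE : ∀ g k, fibreMap (F.twistG j H g) y (E.symm (b k)) = E.symm (b (g * k)) := fun g k => by
    apply E.injective
    refine (baseChange_fibreMap ψ (hcomm g) (E.symm (b k))).trans ?_
    change fibreMap (F.actG g) y (E (E.symm (b k))) = _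
    rw [E.apply_symm_apply, E.apply_symm_apply, hb]
  exact ⟨b.map E.symm, hE⟩

lemma twist_bijective : Function.Bijective (j.stalkMap (genericPoint S.Y)) := by
  refine ⟨j.stalkMap_injective _, fun x => (j.range_stalkMap _ x).mpr ?_⟩
  obtain ⟨V, h, hy, -, hV⟩ := H (genericPoint S.Y)
  exact (hV _ hy x).mpr (F.mem_stalkImage_genericPoint _)

/-- A subsheaf of `K(ℂⁿ)` which is locally proportional to a deformation, as a deformation. -/
def twist : Deformation S where
  toGRFamily := F.twistFamily j H
  isConstellation := F.twistFamily_isConstellation j H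
  ι := AddEquiv.ofBijective (j.stalkMap (genericPoint S.Y)) (F.twist_bijective j H)
  ι_smul a m := by
    obtain ⟨U, hU, r, rfl⟩ := S.Y.presheaf.exists_germ_eq a
    exact (j.stalkMap_smul _ _ _).trans (congrArg (· * _) (algebraMap_germ hU r))
  ι_actG g m := GenericEmbedding.stalkMap_stalkAddHom j j (F.actsBy_twistG j H g) _ m
  ι_actR f m := GenericEmbedding.stalkMap_stalkAddHom j j (F.actsBy_twistR j H f) _ m

lemma stalkImage_twist (y : S.Y) : (F.twist j H).stalkImage y = j.stalkImage y := by
  have h1 : ∀ (U : S.Y.Opens) (hU : genericPoint S.Y ∈ U) (s : Γ(M, U)),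
      (F.twist j H).genericEmbedding.emb U hU s = j.emb U hU s := fun U hU s =>
    j.stalkMap_germ hU s
  ext x
  constructor
  · rintro ⟨U, hy, s, rfl⟩
    exact ⟨U, hy, s, (h1 U _ s).symm⟩
  · rintro ⟨U, hy, s, rfl⟩
    exact ⟨U, hy, s, h1 U _ s⟩

end Deformation

end Twist

/-! ### Normalization at the trivial character -/

section Normalization

variable {n : ℕ} {G : Type*} [CommGroup G] {ρ : G →* GL (Fin n) ℂ} {S : Resolution ρ}

namespace Deformation

/-- The elements of `K(ℂⁿ)` which map the invariants of the stalk of `F` at `z` into the stalk. -/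
def normalizedStalk (F : Deformation S) (z : S.Y) : AddSubgroup (RatField n) where
  carrier := {x | ∀ m ∈ F.stalkImage z, IsHomog ρ 1 m → x * m ∈ F.stalkImage z}
  zero_mem' m _ _ := by rw [zero_mul]; exact zero_mem _
  add_mem' ha hb m hm h1 := by rw [add_mul]; exact add_mem (ha m hm h1) (hb m hm h1)
  neg_mem' ha m hm h1 := by rw [neg_mul]; exact neg_mem (ha m hm h1)

lemma mul_mem_normalizedStalk (F : Deformation S) (y : S.Y) (a : RatField n)
    (ha : a ∈ localSubring S.fieldEmb y) (x : RatField n) (hx : x ∈ F.normalizedStalk y) :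
    a * x ∈ F.normalizedStalk y := fun m hm h1 => by
  rw [mul_assoc]
  exact F.mul_mem_stalkImage ha (hx m hm h1)

/-- The invariants of the stalk are the regular multiples of `f`, so `f` is the only element to
test. -/
lemma IsLocalGenerator.mem_normalizedStalk_iff {F : Deformation S} {V : S.Y.Opens} {f : RatField n}
    (hf : F.IsLocalGenerator 1 V f) {z : S.Y} (hz : z ∈ V) (x : RatField n) :
    x ∈ F.normalizedStalk z ↔ f * x ∈ F.stalkImage z := by
  constructor
  · intro hx
    rw [mul_comm]
    exact hx f (hf.2.2 z hz).1 hf.2.1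
  · intro hx m hm h1
    have h2 := F.mul_mem_stalkImage ((hf.mem_iff hz h1).mp hm) hx
    rwa [← mul_assoc, div_mul_cancel₀ _ hf.1, mul_comm] at h2

/-- The embedding of the sheaf `ℒ(D_{χ₀}) ⊗ F`. -/
abbrev normalizedEmbedding (F : Deformation S) :
    GenericEmbedding S.fieldEmb (subSheaf S.fieldEmb F.normalizedStalk F.mul_mem_normalizedStalk) :=
  subSheafEmbedding S.fieldEmb F.normalizedStalk F.mul_mem_normalizedStalk

/-- The stalk of the subsheaf is all of `normalizedStalk`: the same `f` serves on `V`, and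
membership in a stalk of `F` persists nearby. -/
lemma IsLocalGenerator.mem_normalizedEmbedding_iff {F : Deformation S} {V : S.Y.Opens}
    {f : RatField n} (hf : F.IsLocalGenerator 1 V f) {z : S.Y} (hz : z ∈ V) (x : RatField n) :
    x ∈ F.normalizedEmbedding.stalkImage z ↔ f * x ∈ F.stalkImage z := by
  rw [mem_stalkImage_subSheaf]
  constructor
  · rintro ⟨U, hzU, hU⟩
    exact (hf.mem_normalizedStalk_iff hz x).mp (hU z hzU)
  · rintro ⟨U, hzU, s, hs⟩
    refine ⟨U ⊓ V, ⟨hzU, hz⟩, fun w hw => (hf.mem_normalizedStalk_iff hw.2 x).mpr ?_⟩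
    rw [← hs]
    exact F.genericEmbedding.emb_mem_stalkImage hw.1 _ s

variable [Finite G]

lemma exists_isLocalGenerator_fieldEmb (F : Deformation S) (y : S.Y) :
    ∃ (V : S.Y.Opens) (h : S.Y.functionField), y ∈ V ∧ h ≠ 0 ∧
      F.IsLocalGenerator 1 V (S.fieldEmb h) := by
  obtain ⟨V, f, hy, hf⟩ := F.exists_isLocalGenerator 1 y
  obtain ⟨h, rfl⟩ := S.exists_fieldEmb_eq (IsHomog.one_iff.mp hf.2.1)
  exact ⟨V, h, hy, (map_ne_zero _).mp hf.1, hf⟩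

/-- The normalized deformation equivalent to `F`. -/
def normalization (F : Deformation S) : Deformation S :=
  F.twist F.normalizedEmbedding fun y => by
    obtain ⟨V, h, hy, h0, hf⟩ := F.exists_isLocalGenerator_fieldEmb y
    exact ⟨V, h, hy, h0, fun z hz x => hf.mem_normalizedEmbedding_iff hz x⟩

lemma IsLocalGenerator.mem_normalization_iff {F : Deformation S} {V : S.Y.Opens}
    {f : RatField n} (hf : F.IsLocalGenerator 1 V f) {z : S.Y} (hz : z ∈ V) (x : RatField n) :
    x ∈ F.normalization.stalkImage z ↔ f * x ∈ F.stalkImage z := by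
  rw [normalization, stalkImage_twist, hf.mem_normalizedEmbedding_iff hz]

lemma isLocallyProportional_normalization (F : Deformation S) :
    F.IsLocallyProportional F.normalization := fun y => by
  obtain ⟨V, h, hy, h0, hf⟩ := F.exists_isLocalGenerator_fieldEmb y
  refine ⟨V, h⁻¹, hy, inv_ne_zero h0, fun z hz x => ?_⟩
  rw [hf.mem_normalization_iff hz, map_inv₀, mul_inv_cancel_left₀ hf.1]

lemma weilDivisor_normalization (F : Deformation S) : F.normalization.weilDivisor 1 = 0 := by
  ext P
  obtain ⟨V, f, hP, hf⟩ := F.exists_isLocalGenerator 1 P.1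
  -- Dividing `F` by `f` turns its invariant generator into the function `1`, of valuation zero.
  have h1 : F.normalization.IsLocalGenerator 1 V 1 := by
    refine ⟨one_ne_zero, IsHomog.one_iff.mpr fun g => map_one _,
      fun z hz => ⟨?_, fun x hx hx1 => ?_⟩⟩
    · rw [hf.mem_normalization_iff hz, mul_one]
      exact (hf.2.2 z hz).1
    · have h2 := (hf.2.2 z hz).2 _ ((hf.mem_normalization_iff hz x).mp hx)
        (IsHomog.one_iff.mpr fun g => by
          rw [map_mul, IsHomog.one_iff.mp hf.2.1, IsHomog.one_iff.mp hx1])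
      rwa [mul_div_cancel_left₀ _ hf.1, ← div_one x] at h2
  rw [h1.weilDivisor_apply hP, Resolution.val_one]
  rfl

end Deformation

end Normalization

/-! ### Classification by Weil divisors -/

section Classification

variable {n : ℕ} {G : Type*} [CommGroup G] [Finite G] {ρ : G →* GL (Fin n) ℂ} {S : Resolution ρ}

namespace Deformation

variable {F F' : Deformation S}

lemma isomorphic_iff_weilDivisor : F.Isomorphic F'.toGRFamily ↔
    ∃ g : S.Y.functionField, g ≠ 0 ∧
      ∀ χ, S.IsPrincipal g (F'.weilDivisor χ - F.weilDivisor χ) := by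
  rw [isomorphic_iff]
  refine exists_congr fun h => and_congr_right fun h0 => ?_
  have := weilDivisor_sub_eq_ord_iff (F := F) (F' := F') (V := ⊤) h0
  refine Iff.trans ?_ (this.symm.trans ?_)
  · exact ⟨fun H y _ => H y, fun H y => H y trivial⟩
  · exact forall_congr' fun χ => forall_congr' fun P => ⟨fun H => H trivial, fun H _ => H⟩

/-- Local proportionality by `h` makes every `D'_χ - D_χ` equal to `(h)` near `P`, hence integral
and independent of `χ`. Conversely, near each point `N` is the divisor of `f' / f` for invariant
generators `f`, `f'`, and this one factor then works for all weights. -/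
lemma equivalent_iff_weilDivisor : F.Equivalent F'.toGRFamily ↔
    ∃ N : S.QDivisor, S.IsWeil 1 N ∧ ∀ χ, F'.weilDivisor χ - F.weilDivisor χ = N := by
  constructor
  · intro H
    have key : ∀ P : S.PrimeDivisor, ∃ h : S.Y.functionField, ∀ χ,
        F'.weilDivisor χ P - F.weilDivisor χ P = Scheme.ord h P.1 := fun P => by
      obtain ⟨V, h, hP, h0, hV⟩ := IsLocallyProportional.of_equivalent H P.1
      exact ⟨h, fun χ => (weilDivisor_sub_eq_ord_iff h0).mpr hV χ P hP⟩
    refine ⟨F'.weilDivisor 1 - F.weilDivisor 1, fun P f hf0 hf => ?_, fun χ => ?_⟩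
    · obtain ⟨h, hh⟩ := key P
      exact ⟨Scheme.ord h P.1, by
        rw [Resolution.fract_val_eq_zero P hf0 hf, sub_zero, Finsupp.sub_apply, hh]⟩
    · ext P
      obtain ⟨h, hh⟩ := key P
      rw [Finsupp.sub_apply, Finsupp.sub_apply, hh, hh]
  · rintro ⟨N, -, hN⟩
    refine IsLocallyProportional.equivalent fun y => ?_
    obtain ⟨V, f, hy, hf0, hf⟩ := F.exists_isLocalGenerator_fieldEmb y
    obtain ⟨V', f', hy', hf'0, hf'⟩ := F'.exists_isLocalGenerator_fieldEmb y
    have h0 : f' * f⁻¹ ≠ 0 := mul_ne_zero hf'0 (inv_ne_zero hf0)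
    refine ⟨V ⊓ V', f' * f⁻¹, ⟨hy, hy'⟩, h0, (weilDivisor_sub_eq_ord_iff h0).mp fun χ P hP => ?_⟩
    have h1 := (hN χ).trans (hN 1).symm
    rw [← Finsupp.sub_apply, h1, Finsupp.sub_apply, hf.weilDivisor_apply hP.1,
      hf'.weilDivisor_apply hP.2, Resolution.val_fieldEmb P hf0, Resolution.val_fieldEmb P hf'0,
      sub_eq_iff_eq_add, ← Int.cast_add, ← Scheme.ord_mul h0 hf0, inv_mul_cancel_right₀ hf0]

lemma isomorphicAsDeformation_of_weilDivisor_eq (H : F.weilDivisor = F'.weilDivisor) :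
    F.IsomorphicAsDeformation F' := by
  refine isomorphicAsDeformation_of_eq fun y => AddSubgroup.ext fun x => ?_
  have := (weilDivisor_sub_eq_ord_iff (F := F) (F' := F') (V := ⊤)
    (one_ne_zero (α := S.Y.functionField))).mp (fun χ P _ => by
      rw [H, sub_self, ord_one, Int.cast_zero]) y trivial x
  rwa [map_one, one_mul] at this

end Deformation

end Classification

end GOrbit

end

theorem corollary3 {n : ℕ} {G : Type*} [CommGroup G] [Finite G] (ρ : G →* GL (Fin n) ℂ)
    (hρ : Function.Injective ρ) (S : GOrbit.Resolution ρ) :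
    -- isomorphism of deformations as sheaves of `(G, R)`-modules
    (∀ (F F' : GOrbit.Deformation S) (D D' : (G →* ℂˣ) → S.QDivisor), F.IsSum D → F'.IsSum D' →
      (F.Isomorphic F'.toGRFamily ↔
        ∃ g : S.Y.functionField, g ≠ 0 ∧ ∀ χ, S.IsPrincipal g (D' χ - D χ))) ∧
    -- equivalence of deformations
    (∀ (F F' : GOrbit.Deformation S) (D D' : (G →* ℂˣ) → S.QDivisor), F.IsSum D → F'.IsSum D' →
      (F.Equivalent F'.toGRFamily ↔
        ∃ N : S.QDivisor, S.IsWeil 1 N ∧ ∀ χ, D' χ - D χ = N)) ∧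
    -- every equivalence class contains a unique normalised family
    (∀ F : GOrbit.Deformation S, ∃ (F₀ : GOrbit.Deformation S) (D₀ : (G →* ℂˣ) → S.QDivisor),
      F.Equivalent F₀.toGRFamily ∧ F₀.IsSum D₀ ∧ D₀ 1 = 0 ∧
      ∀ (F₁ : GOrbit.Deformation S) (D₁ : (G →* ℂˣ) → S.QDivisor),
        F.Equivalent F₁.toGRFamily → F₁.IsSum D₁ → D₁ 1 = 0 →
          D₁ = D₀ ∧ F₁.IsomorphicAsDeformation F₀) := by
  refine ⟨fun F F' D D' hD hD' => ?_, fun F F' D D' hD hD' => ?_, fun F => ?_⟩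
  · rw [hD.eq_weilDivisor, hD'.eq_weilDivisor]
    exact GOrbit.Deformation.isomorphic_iff_weilDivisor
  · rw [hD.eq_weilDivisor, hD'.eq_weilDivisor]
    exact GOrbit.Deformation.equivalent_iff_weilDivisor
  · have hF := F.isLocallyProportional_normalization.equivalent
    refine ⟨F.normalization, F.normalization.weilDivisor, hF, F.normalization.isSum_weilDivisor,
      F.weilDivisor_normalization, fun F₁ D₁ h₁ hD₁ h0 => ?_⟩
    obtain ⟨N, -, hN⟩ := GOrbit.Deformation.equivalent_iff_weilDivisor.mp hF
    obtain ⟨N₁, -, hN₁⟩ := GOrbit.Deformation.equivalent_iff_weilDivisor.mp h₁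
    -- Both normalized divisors vanish at the trivial character, so both shifts equal minus the
    -- divisor of `F` there.
    have hNN : N₁ = N := by
      rw [← hN 1, ← hN₁ 1, ← hD₁.eq_weilDivisor, h0, F.weilDivisor_normalization]
    have hD : F₁.weilDivisor = F.normalization.weilDivisor := funext fun χ =>
      sub_left_injective (((hN₁ χ).trans hNN).trans (hN χ).symm)
    exact ⟨hD₁.eq_weilDivisor.trans hD,
      GOrbit.Deformation.isomorphicAsDeformation_of_weilDivisor_eq hD⟩
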